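/- Let $X$ be a (Hausdorff, second countable) complex manifold of dimension $n$ with a smooth Kähler metric $\omega$, let $L\to X$ be a holomorphic line bundle with a smooth Hermitian metric $e^{-\varphi}$, and let $Z\subset X$ be a smooth complex hypersurface. Let $E_Z\to X$ be the holomorphic line bundle of the divisor $Z$ and $f_Z$ a holomorphic section of $E_Z$ that defines $Z$, i.e. $Z=\{f_Z=0\}$ and $df_Z\neq 0$ at every point of $Z$. Let $q\ge 1$, and let $\xi$ be a transverse ambient $L$-valued $(0,q)$-form on $Z$: a smooth section over $Z$ of the restricted bundle $(L\otimes\Lambda^{0,q}_X)|_Z$ such that $\iota^*\xi=0$, where $\iota:Z\hookrightarrow X$ is the inclusion and $\iota^*\xi(v_1,\dots,v_q)=\xi(d\iota\, v_1,\dots,d\iota\, v_q)$ for $v_1,\dots,v_q\in T^{0,1}_{Z}$ at the same point of $Z$. Then for every $\varepsilon>0$ there exists a smooth $\bar\partial$-closed $L$-valued $(0,q)$-form $u$ on $X$ such that $$u(z)=\xi(z)\ \text{ for all } z\in Z \qquad\text{and}\qquad \int_X |u|_\omega^2e^{-\varphi}\,\omega^n<\varepsilon .$$ Moreover $u$ can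 be chosen of the form $u=\bar\partial\big(\rho\,\overline{f_Z}\,\tilde\alpha\big)$, where $\rho:X\to[0,1]$ is a smooth function equal to $1$ on a neighbourhood of $Z$ and $\tilde\alpha$ is a smooth $(0,q-1)$-form on $X$ with values in the line bundle $L\otimes\overline{E_Z^*}$. -/

import Mathlib

open Set MeasureTheory Bundle
open scoped Manifold ContDiff Topology Nat ENNReal

noncomputable section

namespace TransverseExtension

/-- The model space `ℂⁿ`. -/
abbrev Cn (n : ℕ) : Type := EuclideanSpace ℂ (Fin n)

section Forms

variable {n : ℕ} {X : Type*} [TopologicalSpace X] [ChartedSpace (Cn n) X]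

/-- The tangent space `T_x X` of the complex manifold `X`, a complex vector space. -/
abbrev Tan (n : ℕ) {X : Type*} [TopologicalSpace X] [ChartedSpace (Cn n) X] (x : X) : Type :=
  TangentSpace 𝓘(ℂ, Cn n) x

variable {X : Type*} [TopologicalSpace X] [ChartedSpace (Cn n) X]
  [IsManifold 𝓘(ℂ, Cn n) ω X]
  {L : X → Type*} [TopologicalSpace (TotalSpace ℂ L)]
  [∀ x, AddCommGroup (L x)] [∀ x, Module ℂ (L x)] [∀ x, TopologicalSpace (L x)]
  [FiberBundle ℂ L] [VectorBundle ℂ ℂ L]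

/-- Values at `x` of `L`-valued `q`-forms: real-multilinear alternating maps `(T_x X)^q → L_x`.
Those of type `(0,q)` are singled out by `IsType0q`. -/
abbrev FormAt (n : ℕ) {X : Type*} [TopologicalSpace X] [ChartedSpace (Cn n) X]
    (L : X → Type*) [∀ x, AddCommGroup (L x)] [∀ x, Module ℂ (L x)]
    [∀ x, TopologicalSpace (L x)] (q : ℕ) (x : X) : Type _ :=
  Tan n x [⋀^Fin q]→L[ℝ] L x

/-- The form is of type `(0,q)` at `x`: it is conjugate-linear in every argument. (A `(0,q)`-covector
is the same as such a map, through the conjugate-linear isomorphism `T_x X ≃ T^{0,1}_x X`.) -/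
def IsType0q {q : ℕ} {x : X} (η : FormAt n L q x) : Prop :=
  ∀ (v : Fin q → Tan n x) (i : Fin q) (c : ℂ),
    η (Function.update v i (c • v i)) = (starRingEnd ℂ c) • η v

/-- The expression of an `L`-valued form in the holomorphic chart of `X` and the holomorphic
trivialization of `L` around `x₀`. -/
def localRep {q : ℕ} (u : ∀ x, FormAt n L q x) (x₀ : X) (y : Cn n) :
    Cn n [⋀^Fin q]→L[ℝ] ℂ :=
  (((trivializationAt ℂ L x₀).continuousLinearMapAt ℂ
      ((chartAt (Cn n) x₀).symm y)).restrictScalars ℝ).compContinuousAlternatingMap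
    ((u ((chartAt (Cn n) x₀).symm y)).compContinuousLinearMap
      (((trivializationAt (Cn n) (TangentSpace 𝓘(ℂ, Cn n) : X → Type _) x₀).symmL ℂ
        ((chartAt (Cn n) x₀).symm y)).restrictScalars ℝ))

/-- The part of the chart around `x₀` that corresponds to the points of `S ∩ U`. -/
def chartPart (n : ℕ) {X : Type*} [TopologicalSpace X] [ChartedSpace (Cn n) X]
    (x₀ : X) (U S : Set X) : Set (Cn n) :=
  {y | y ∈ (chartAt (Cn n) x₀).target ∧ (chartAt (Cn n) x₀).symm y ∈ U ∩ S}

/-- The `L`-valued form `u` is smooth (real `C^∞`) along `S`. For `S` open this is smoothness of `u`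
on `S`, and for a submanifold `S` it says that `u|_S` is a smooth section over `S` of the
restriction to `S` of the bundle of `L`-valued forms on `X`. Only the values of `u` at points of `S`
matter. -/
def SmoothFormOn {q : ℕ} (u : ∀ x, FormAt n L q x) (S : Set X) : Prop :=
  ∀ x₀ : X, ContDiffOn ℝ ∞ (localRep u x₀)
    (chartPart n x₀ (trivializationAt ℂ L x₀).baseSet S)

/-- The conjugate-linear part `v ↦ (T v + i T (i v)) / 2` of a real-linear map. -/
def antilinearPart {V : Type*} [NormedAddCommGroup V] [NormedSpace ℂ V]
    (T : Cn n →L[ℝ] V) : Cn n →L[ℝ] V :=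
  (1 / 2 : ℂ) •
    (T + Complex.I • T.comp ((Complex.I • ContinuousLinearMap.id ℂ (Cn n)).restrictScalars ℝ))

/-- `∂̄` of a `(0,q)`-form on an open subset of `ℂⁿ`: with `∂̄_v = (∂_v + i ∂_{iv}) / 2`,
`(∂̄w)(v₀, …, v_q) = ∑ⱼ (-1)ʲ (∂̄_{vⱼ} w)(v₀, …, v̂ⱼ, …, v_q)`. -/
def flatDbar {q : ℕ} (w : Cn n → Cn n [⋀^Fin q]→L[ℝ] ℂ) (y : Cn n) :
    Cn n [⋀^Fin (q + 1)]→L[ℝ] ℂ :=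
  ContinuousAlternatingMap.alternatizeUncurryFin (antilinearPart (fderiv ℝ w y))

/-- `∂̄` of a (smooth) `L`-valued `(0,q)`-form, computed at each point `x` in the holomorphic
chart and trivialization around `x`; for `(0,q)`-forms the choice does not matter. -/
def dbar {q : ℕ} (u : ∀ x, FormAt n L q x) (x : X) : FormAt n L (q + 1) x :=
  (((trivializationAt ℂ L x).symmL ℂ x).restrictScalars ℝ).compContinuousAlternatingMap
    ((flatDbar (localRep u x) (chartAt (Cn n) x x)).compContinuousLinearMap
      (((trivializationAt (Cn n) (TangentSpace 𝓘(ℂ, Cn n) : X → Type _) x).continuousLinearMapAt ℂ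
        x).restrictScalars ℝ))

/-- The derivative at `z` of a section `f` of the holomorphic line bundle `L`, expressed in the
trivialization around `z`. If `f z = 0`, another trivialization only multiplies it by a nonzero
constant, and it is the intrinsic `df(z) : T_z X → L_z`. -/
def sectionDeriv (n : ℕ) {X : Type*} [TopologicalSpace X] [ChartedSpace (Cn n) X]
    {L : X → Type*} [TopologicalSpace (TotalSpace ℂ L)]
    [∀ x, TopologicalSpace (L x)] [FiberBundle ℂ L] (f : ∀ x, L x) (z : X) :
    Tan n z →L[ℂ] ℂ :=
  mfderiv 𝓘(ℂ, Cn n) 𝓘(ℂ, ℂ) (fun x => (trivializationAt ℂ L z ⟨x, f x⟩).2) z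

/-- `Z` is a smooth complex hypersurface and `f` is a holomorphic section, of the line bundle of
the divisor `Z`, that defines `Z`: the zero set of `f` is `Z`, and `f` vanishes to first order
along `Z`. -/
structure IsDefiningSection (n : ℕ) {X : Type*} [TopologicalSpace X] [ChartedSpace (Cn n) X]
    {L : X → Type*} [TopologicalSpace (TotalSpace ℂ L)]
    [∀ x, AddCommGroup (L x)] [∀ x, Module ℂ (L x)]
    [∀ x, TopologicalSpace (L x)] [FiberBundle ℂ L] (f : ∀ x, L x) (Z : Set X) : Prop where
  holomorphic : ContMDiff 𝓘(ℂ, Cn n) (𝓘(ℂ, Cn n).prod 𝓘(ℂ, ℂ)) ω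
    (fun x => TotalSpace.mk' ℂ x (f x))
  zero_set : Z = {x | f x = 0}
  deriv_ne_zero : ∀ z ∈ Z, sectionDeriv n f z ≠ 0

/-- `ι^* ξ = 0` for the inclusion `ι : Z → X` of the hypersurface defined by `f`: at every point
`z` of `Z`, `ξ` vanishes on tuples of vectors of `T_z Z = ker df(z)`. -/
def IsTransverse {E : X → Type*} [TopologicalSpace (TotalSpace ℂ E)]
    [∀ x, TopologicalSpace (E x)] [FiberBundle ℂ E] (f : ∀ x, E x) (Z : Set X)
    {q : ℕ} (ξ : ∀ x, FormAt n L q x) : Prop :=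
  ∀ z ∈ Z, ∀ v : Fin q → Tan n z, (∀ i, sectionDeriv n f z (v i) = 0) → ξ z v = 0

/-- A smooth `(0,q)`-form `α` on `X` with values in `L ⊗ Ē^*`, the line bundle of conjugate-linear
maps `E_x → L_x`; `α x s` is the value of `α x` on `s ∈ E_x`. Smoothness is tested on the local
holomorphic frames of `E`. -/
structure IsSmoothTwistedForm {E : X → Type*} [TopologicalSpace (TotalSpace ℂ E)]
    [∀ x, AddCommGroup (E x)] [∀ x, Module ℂ (E x)]
    [∀ x, TopologicalSpace (E x)] [FiberBundle ℂ E] [VectorBundle ℂ ℂ E]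
    {q : ℕ} (α : ∀ x, E x → FormAt n L q x) : Prop where
  add : ∀ x (s t : E x) (v : Fin q → Tan n x), α x (s + t) v = α x s v + α x t v
  smul : ∀ x (c : ℂ) (s : E x) (v : Fin q → Tan n x),
    α x (c • s) v = (starRingEnd ℂ c) • α x s v
  type0q : ∀ x (s : E x), IsType0q (α x s)
  smooth : ∀ x₀ : X, SmoothFormOn (fun x => α x ((trivializationAt ℂ E x₀).symm x 1))
    (trivializationAt ℂ E x₀).baseSet

end Forms

section Metrics

variable {n : ℕ} {X : Type*} [TopologicalSpace X] [ChartedSpace (Cn n) X]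

/-- A smooth Hermitian metric on a complex vector bundle `V` with model fibre `F` over `X`
(conjugate-linear in the first variable). -/
structure HermitianMetric (n : ℕ) {X : Type*} [TopologicalSpace X] [ChartedSpace (Cn n) X]
    (F : Type*) [NormedAddCommGroup F] [NormedSpace ℂ F] (V : X → Type*)
    [TopologicalSpace (TotalSpace F V)] [∀ x, AddCommGroup (V x)] [∀ x, Module ℂ (V x)]
    [∀ x, TopologicalSpace (V x)] [FiberBundle F V] [VectorBundle ℂ F V] where
  inner : ∀ x, V x →ₗ⋆[ℂ] V x →ₗ[ℂ] ℂ
  conj_symm : ∀ x (v w : V x), (starRingEnd ℂ) (inner x v w) = inner x w v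
  pos : ∀ x (v : V x), v ≠ 0 → 0 < (inner x v v).re
  smooth : ∀ (x₀ : X) (a b : F), ContDiffOn ℝ ∞
    (fun y : Cn n => inner ((chartAt (Cn n) x₀).symm y)
      ((trivializationAt F V x₀).symm ((chartAt (Cn n) x₀).symm y) a)
      ((trivializationAt F V x₀).symm ((chartAt (Cn n) x₀).symm y) b))
    (chartPart n x₀ (trivializationAt F V x₀).baseSet univ)

variable [IsManifold 𝓘(ℂ, Cn n) ω X]

/-- Coefficients `⟨a, b⟩` of a Hermitian metric on `T X` in the chart around `x₀`, for constant
vector fields `a`, `b` on the chart. -/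
def metricCoeff (g : HermitianMetric n (Cn n) (TangentSpace 𝓘(ℂ, Cn n) : X → Type _)) (x₀ : X)
    (a b y : Cn n) : ℂ :=
  g.inner ((chartAt (Cn n) x₀).symm y)
    ((trivializationAt (Cn n) (TangentSpace 𝓘(ℂ, Cn n) : X → Type _) x₀).symm
      ((chartAt (Cn n) x₀).symm y) a)
    ((trivializationAt (Cn n) (TangentSpace 𝓘(ℂ, Cn n) : X → Type _) x₀).symm
      ((chartAt (Cn n) x₀).symm y) b)

/-- The Hermitian metric is Kähler: its fundamental form `ω(a, b) = Im ⟨a, b⟩`, which is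
`(i/2) ∑ αʲ ∧ ᾱʲ` in an orthonormal coframe `αʲ`, is closed (`dω = 0`, written in charts). -/
def IsKahler (g : HermitianMetric n (Cn n) (TangentSpace 𝓘(ℂ, Cn n) : X → Type _)) : Prop :=
  ∀ (x₀ : X), ∀ y ∈ (chartAt (Cn n) x₀).target, ∀ a b c : Cn n,
    fderiv ℝ (fun y => (metricCoeff g x₀ b c y).im) y a +
    fderiv ℝ (fun y => (metricCoeff g x₀ c a y).im) y b +
    fderiv ℝ (fun y => (metricCoeff g x₀ a b y).im) y c = 0

/-- The volume measure of the metric on the domain of the chart around `x₀`: Lebesgue measure of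
`ℂⁿ` multiplied by `det (⟨∂ⱼ, ∂ₖ⟩)`, which is the density of `ωⁿ / n!`. -/
def chartVolume [MeasurableSpace X]
    (g : HermitianMetric n (Cn n) (TangentSpace 𝓘(ℂ, Cn n) : X → Type _)) (x₀ : X) :
    Measure X :=
  Measure.map (chartAt (Cn n) x₀).symm
    (((volume : Measure (Cn n)).restrict (chartAt (Cn n) x₀).target).withDensity fun y =>
      ENNReal.ofReal (Matrix.det (Matrix.of fun j k : Fin n =>
        metricCoeff g x₀ (EuclideanSpace.single j 1) (EuclideanSpace.single k 1) y)).re)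

/-- The volume measure `dV = ωⁿ / n!` of the metric: the measure on `X` glued from the volume
measures of the charts (these agree on overlaps, so that their least upper bound restricts to each
of them). -/
def volumeMeasure [MeasurableSpace X]
    (g : HermitianMetric n (Cn n) (TangentSpace 𝓘(ℂ, Cn n) : X → Type _)) : Measure X :=
  ⨆ x₀ : X, chartVolume g x₀

variable {L : X → Type*} [TopologicalSpace (TotalSpace ℂ L)]
  [∀ x, AddCommGroup (L x)] [∀ x, Module ℂ (L x)] [∀ x, TopologicalSpace (L x)]
  [FiberBundle ℂ L] [VectorBundle ℂ ℂ L]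

/-- The unitary frames of `T_x X`. -/
def UnitaryFrame (g : HermitianMetric n (Cn n) (TangentSpace 𝓘(ℂ, Cn n) : X → Type _)) (x : X) :
    Type :=
  {e : Fin n → Tan n x // ∀ i j, g.inner x (e i) (e j) = if i = j then 1 else 0}

/-- The pointwise square norm `|η|²_ω e^{-φ}` of an `L`-valued `(0,q)`-form: if `ᾱᴶ` is the
coframe of a unitary frame and `η = ∑_{|J| = q} η_J ᾱᴶ`, this is `∑_{|J| = q} |η_J|² e^{-φ}`, or
`1 / q!` times the sum over all `q`-tuples of indices. It is the same number for all unitary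
frames. -/
def normSq (g : HermitianMetric n (Cn n) (TangentSpace 𝓘(ℂ, Cn n) : X → Type _))
    (h : HermitianMetric n ℂ L) {q : ℕ} {x : X} (η : FormAt n L q x) : ℝ≥0∞ :=
  ⨆ e : UnitaryFrame g x, ENNReal.ofReal
    ((1 / (q ! : ℝ)) * ∑ J : Fin q → Fin n,
      (h.inner x (η fun i => e.1 (J i)) (η fun i => e.1 (J i))).re)

end Metrics

end TransverseExtension

end

noncomputable section

namespace TransverseExtension

set_option linter.unusedSectionVars false

universe u

/-! Along `Z`, the form `ξ` is conjugate-linear in each slot and kills tuples from `ker df`, so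
linear algebra divides it by the conjugate of `df`: `ξ = conj(df) ∧ β` with `β` the contraction of
`ξ` with a vector `a`, divided by `conj(df(a))` (`IsConjLin.wedge_contract`). Composing with a
holomorphic retraction onto `{f = 0}` extends `β` smoothly off `Z` (`exists_local_division`), and a
partition of unity glues the local factors to a twisted form `α` (`exists_twisted_form`). In `∂̄(f̄
α)` every term in which `f̄` is not differentiated vanishes on `Z`, so only `conj(df) ∧ α = ξ` is
left there. Hence, for every smooth `ρ` equal to `1` near `Z`, the form `u = ∂̄(ρ f̄ α)` is
`∂̄`-closed and has the values `ξ` on `Z`.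

It remains to choose `ρ` so that `u` is small. If `ρ` is cut off at `|f| ~ δ` in a local frame, its
derivative is `O(1/δ)`, but `f̄` is `O(δ)` where it lives. So `u` stays bounded uniformly in `δ` on
a compact piece (`exists_conjCutoff_bound`, `exists_dbar_tubeCutoff_bound`), while its support there
lies in a tube around `Z` whose volume tends to `0`, because `Z` is a null set
(`exists_volume_tube_lt`).

As `X` need not be compact, `ρ = ∑ ψᵢ χ(f/δᵢ)` uses a radius `δᵢ` for each member of a countable
partition of unity. A weighted Cauchy–Schwarz inequality with weights of total mass at most `1`
(`normSq_sum_le`) bounds the squared norm of the sum by a sum of squared norms. Each `δᵢ` is then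
chosen against its weight and its share of `ε` (`exists_tube_radius`).

The volume measure is a supremum of chart measures. Only an upper bound for it is needed: inside a
chart it is at most the measure of that chart (`volumeMeasure_le`), by the change of variables
formula. -/

/-- The values of `(0,q)`-forms on `ℂⁿ`: alternating maps that are conjugate-linear in every
argument. -/
def IsConjLin {n q : ℕ} (η : Cn n [⋀^Fin q]→L[ℝ] ℂ) : Prop :=
  ∀ (v : Fin q → Cn n) (i : Fin q) (c : ℂ),
    η (Function.update v i (c • v i)) = (starRingEnd ℂ c) * η v

/-! ### The operator `∂̄` on `(0,q)`-forms on `ℂⁿ` -/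

section Flat

variable {n q : ℕ}

/-- Multiplication by `i`, as a real-linear map. -/
abbrev mulI (n : ℕ) : Cn n →L[ℝ] Cn n :=
  (Complex.I • ContinuousLinearMap.id ℂ (Cn n)).restrictScalars ℝ

theorem IsConjLin.apply_update {η : Cn n [⋀^Fin q]→L[ℝ] ℂ} (hη : IsConjLin η)
    (v : Fin q → Cn n) (i : Fin q) (c : ℂ) (a : Cn n) :
    η (Function.update v i (c • a)) = (starRingEnd ℂ c) * η (Function.update v i a) := by
  simpa using hη (Function.update v i a) i c

theorem IsConjLin.zero : IsConjLin (0 : Cn n [⋀^Fin q]→L[ℝ] ℂ) := fun _ _ _ => by simp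

theorem IsConjLin.add {η θ : Cn n [⋀^Fin q]→L[ℝ] ℂ} (hη : IsConjLin η) (hθ : IsConjLin θ) :
    IsConjLin (η + θ) := fun v i c => by
  simp only [ContinuousAlternatingMap.add_apply, hη v i c, hθ v i c, mul_add]

theorem IsConjLin.smul {η : Cn n [⋀^Fin q]→L[ℝ] ℂ} (hη : IsConjLin η) (a : ℂ) :
    IsConjLin (a • η) := fun v i c => by
  simp only [ContinuousAlternatingMap.smul_apply, hη v i c, smul_eq_mul]; ring

theorem IsConjLin.sum {ι : Type*} {s : Finset ι} {η : ι → Cn n [⋀^Fin q]→L[ℝ] ℂ}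
    (hη : ∀ i ∈ s, IsConjLin (η i)) : IsConjLin (∑ i ∈ s, η i) := fun v i c => by
  simp only [ContinuousAlternatingMap.sum_apply, Finset.mul_sum]
  exact Finset.sum_congr rfl fun j hj => hη j hj v i c

theorem IsConjLin.comp {m : ℕ} {η : Cn n [⋀^Fin q]→L[ℝ] ℂ} (hη : IsConjLin η)
    (A : Cn m →L[ℂ] Cn n) : IsConjLin (η.compContinuousLinearMap (A.restrictScalars ℝ)) :=
  fun v i c => by
  have h : ∀ a, (⇑(A.restrictScalars ℝ)) ∘ Function.update v i a =
      Function.update (A ∘ v) i (A a) := fun a => by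
    ext1 j; by_cases hj : j = i
    · subst hj; simp
    · simp [hj]
  rw [ContinuousAlternatingMap.compContinuousLinearMap_apply, h, map_smul]
  exact hη (A ∘ v) i c

theorem antilinearPart_apply {V : Type*} [NormedAddCommGroup V] [NormedSpace ℂ V]
    (T : Cn n →L[ℝ] V) (v : Cn n) :
    antilinearPart T v = (1 / 2 : ℂ) • (T v + Complex.I • T (Complex.I • v)) := rfl

theorem antilinearPart_smul_I {V : Type*} [NormedAddCommGroup V] [NormedSpace ℂ V]
    (T : Cn n →L[ℝ] V) (v : Cn n) :
    antilinearPart T (Complex.I • v) = -Complex.I • antilinearPart T v := by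
  simp only [antilinearPart_apply, smul_add, smul_smul, Complex.I_mul_I, map_neg, neg_smul,
    one_smul, smul_neg]
  have : -Complex.I * (1 / 2 * Complex.I) = (1 / 2 : ℂ) := by
    linear_combination (-1 / 2 : ℂ) * Complex.I_mul_I
  rw [this, add_comm]
  congr 1
  rw [← neg_smul]; congr 1; ring

theorem antilinearPart_smul {V : Type*} [NormedAddCommGroup V] [NormedSpace ℂ V]
    (T : Cn n →L[ℝ] V) (c : ℂ) (v : Cn n) :
    antilinearPart T (c • v) = (starRingEnd ℂ c) • antilinearPart T v := by
  have hr : ∀ (r : ℝ) (w : Cn n),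
      antilinearPart T ((r : ℂ) • w) = (r : ℂ) • antilinearPart T w := fun r w => by
    have := map_smul (antilinearPart T) r w
    simpa only [Complex.coe_smul] using this
  conv_lhs => rw [← Complex.re_add_im c]
  rw [add_smul, mul_smul, map_add, hr, hr, antilinearPart_smul_I, smul_smul, ← add_smul]
  congr 1
  apply Complex.ext <;> simp

theorem antilinearPart_of_antilinear {V : Type*} [NormedAddCommGroup V] [NormedSpace ℂ V]
    {T : Cn n →L[ℝ] V} (hT : ∀ v, T (Complex.I • v) = -Complex.I • T v) :
    antilinearPart T = T := by
  ext v
  rw [antilinearPart_apply, hT, smul_smul, mul_neg, Complex.I_mul_I, neg_neg, one_smul, ← two_smul ℂ,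
    smul_smul]
  norm_num

theorem antilinearPart_of_linear {V : Type*} [NormedAddCommGroup V] [NormedSpace ℂ V]
    {T : Cn n →L[ℝ] V} (hT : ∀ v, T (Complex.I • v) = Complex.I • T v) :
    antilinearPart T = 0 := by
  ext v
  rw [antilinearPart_apply, hT, smul_smul, Complex.I_mul_I]
  simp

/-- `antilinearPart` as a continuous linear map. -/
def antilinearPartCLM (n : ℕ) (V : Type*) [NormedAddCommGroup V] [NormedSpace ℂ V] :
    (Cn n →L[ℝ] V) →L[ℝ] (Cn n →L[ℝ] V) :=
  (1 / 2 : ℂ) • (ContinuousLinearMap.id ℝ _ + Complex.I •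
    ((ContinuousLinearMap.compL ℝ (Cn n) (Cn n) V).flip (mulI n)))

theorem antilinearPartCLM_apply {V : Type*} [NormedAddCommGroup V] [NormedSpace ℂ V]
    (T : Cn n →L[ℝ] V) : antilinearPartCLM n V T = antilinearPart T := rfl

/-- `flatDbar` is this continuous linear map applied to the derivative. -/
def dbarSymbol (n q : ℕ) :
    (Cn n →L[ℝ] (Cn n [⋀^Fin q]→L[ℝ] ℂ)) →L[ℝ] (Cn n [⋀^Fin (q + 1)]→L[ℝ] ℂ) :=
  ContinuousAlternatingMap.alternatizeUncurryFinCLM ℝ (Cn n) ℂ ∘L antilinearPartCLM n _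

theorem flatDbar_eq (w : Cn n → Cn n [⋀^Fin q]→L[ℝ] ℂ) (y : Cn n) :
    flatDbar w y = dbarSymbol n q (fderiv ℝ w y) := rfl

theorem dbarSymbol_apply (T : Cn n →L[ℝ] (Cn n [⋀^Fin q]→L[ℝ] ℂ)) (v : Fin (q + 1) → Cn n) :
    dbarSymbol n q T v = ∑ j : Fin (q + 1), (-1) ^ (j : ℕ) •
      antilinearPart T (v j) (j.removeNth v) := by
  rw [dbarSymbol, ContinuousLinearMap.comp_apply, antilinearPartCLM_apply,
    ContinuousAlternatingMap.alternatizeUncurryFinCLM_apply,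
    ContinuousAlternatingMap.alternatizeUncurryFin_apply]

theorem flatDbar_congr {w w' : Cn n → Cn n [⋀^Fin q]→L[ℝ] ℂ} {y : Cn n} (h : w =ᶠ[𝓝 y] w') :
    flatDbar w y = flatDbar w' y := by
  rw [flatDbar_eq, flatDbar_eq, h.fderiv_eq]

/-- In each summand the slot being scaled is either the direction of differentiation, where the
antilinear part is conjugate-linear, or a slot of the differentiated form, which is conjugate-linear
by hypothesis. -/
theorem isConjLin_dbarSymbol {T : Cn n →L[ℝ] (Cn n [⋀^Fin q]→L[ℝ] ℂ)}
    (hT : ∀ v, IsConjLin (T v)) : IsConjLin (dbarSymbol n q T) := fun v i c => by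
  have hA : ∀ v, IsConjLin (antilinearPart T v) := fun v =>
    (((hT v).add ((hT _).smul _)).smul _)
  rw [dbarSymbol_apply, dbarSymbol_apply, Finset.mul_sum]
  refine Finset.sum_congr rfl fun j _ => ?_
  by_cases hij : i = j
  · subst hij
    simp only [Function.update_self, Fin.removeNth_update, antilinearPart_smul,
      ContinuousAlternatingMap.smul_apply, smul_eq_mul]
    rw [mul_smul_comm]
  · obtain ⟨k, rfl⟩ := Fin.exists_succAbove_eq hij
    rw [Function.update_of_ne (Ne.symm hij), mul_smul_comm]
    congr 1
    have : j.removeNth (Function.update v (j.succAbove k) (c • v (j.succAbove k))) =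
        Function.update (j.removeNth v) k (c • j.removeNth v k) := by
      rw [Fin.removeNth_update_succAbove]; rfl
    rw [this, hA _ _ k c]

/-- Conjugate-linearity is a family of linear equations on the values, which can be differentiated.
Where `w` is not differentiable, the default value `0` satisfies them too. -/
theorem isConjLin_fderiv {w : Cn n → Cn n [⋀^Fin q]→L[ℝ] ℂ} {y : Cn n}
    (hw : ∀ᶠ y' in 𝓝 y, IsConjLin (w y')) (v : Cn n) : IsConjLin (fderiv ℝ w y v) := by
  by_cases hd : DifferentiableAt ℝ w y
  swap
  · rw [fderiv_zero_of_not_differentiableAt hd]; exact IsConjLin.zero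
  intro u i c
  have h1 := (hd.hasFDerivAt.continuousAlternatingMap_apply_const
    (Function.update u i (c • u i)))
  have h2 := (hd.hasFDerivAt.continuousAlternatingMap_apply_const u).const_mul
    (starRingEnd ℂ c)
  have h3 := h1.congr_of_eventuallyEq (f₁ := fun y' => (starRingEnd ℂ c) * w y' u)
    (hw.mono fun y' hy' => (hy' u i c).symm)
  have := DFunLike.congr_fun (h3.unique h2) v
  simpa using this

theorem isConjLin_flatDbar {w : Cn n → Cn n [⋀^Fin q]→L[ℝ] ℂ} {y : Cn n}
    (hw : ∀ᶠ y' in 𝓝 y, IsConjLin (w y')) : IsConjLin (flatDbar w y) := by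
  rw [flatDbar_eq]; exact isConjLin_dbarSymbol (isConjLin_fderiv hw)

theorem fderiv_clm_apply_comp {E F G : Type*} [NormedAddCommGroup E] [NormedSpace ℝ E]
    [NormedAddCommGroup F] [NormedSpace ℝ F] [NormedAddCommGroup G] [NormedSpace ℝ G]
    (L : F →L[ℝ] G) {f : E → F} {x : E} (h : DifferentiableAt ℝ f x) :
    fderiv ℝ (fun y => L (f y)) x = L ∘L fderiv ℝ f x :=
  (L.hasFDerivAt.comp x h.hasFDerivAt).fderiv

/-- The second derivative is symmetric, hence so is `(a, b) ↦ ∂̄_a ∂̄_b w`, and the double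
alternatization of a symmetric bilinear map vanishes. -/
theorem flatDbar_flatDbar {w : Cn n → Cn n [⋀^Fin q]→L[ℝ] ℂ} {y : Cn n}
    (hw : ContDiffAt ℝ ∞ w y) : flatDbar (flatDbar w) y = 0 := by
  have hd : DifferentiableAt ℝ (fderiv ℝ w) y :=
    (hw.fderiv_right (m := 1) (by norm_cast)).differentiableAt one_ne_zero
  have hs : ∀ a b, fderiv ℝ (fderiv ℝ w) y a b = fderiv ℝ (fderiv ℝ w) y b a :=
    hw.isSymmSndFDerivAt (by simp; norm_cast)
  have h1 : fderiv ℝ (flatDbar w) y = dbarSymbol n q ∘L fderiv ℝ (fderiv ℝ w) y :=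
    fderiv_clm_apply_comp (E := Cn n) (F := Cn n →L[ℝ] Cn n [⋀^Fin q]→L[ℝ] ℂ)
      (G := Cn n [⋀^Fin (q + 1)]→L[ℝ] ℂ) (dbarSymbol n q) hd
  rw [flatDbar_eq, h1]
  set B := fderiv ℝ (fderiv ℝ w) y
  -- `f a b` is `∂̄_a ∂̄_b w` at `y`.
  let f : Cn n →L[ℝ] Cn n →L[ℝ] (Cn n [⋀^Fin q]→L[ℝ] ℂ) :=
    antilinearPart (antilinearPartCLM n _ ∘L B)
  have hf : ∀ a b, f a b = f b a := fun a b => by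
    have hfe : ∀ a b, f a b = (1 / 4 : ℂ) • (B a b + Complex.I • B a (Complex.I • b) +
        Complex.I • B (Complex.I • a) b - B (Complex.I • a) (Complex.I • b)) := fun a b => by
      change (1 / 2 : ℂ) • ((1 / 2 : ℂ) • (B a b + Complex.I • B a (Complex.I • b)) +
        Complex.I • (1 / 2 : ℂ) • (B (Complex.I • a) b +
          Complex.I • B (Complex.I • a) (Complex.I • b))) = _
      ext v
      simp only [ContinuousAlternatingMap.smul_apply, ContinuousAlternatingMap.add_apply,
        ContinuousAlternatingMap.sub_apply, smul_eq_mul]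
      linear_combination (1 / 4 * B (Complex.I • a) (Complex.I • b) v) * Complex.I_mul_I
    rw [hfe, hfe, hs a b, hs a (Complex.I • b), hs (Complex.I • a) b,
      hs (Complex.I • a) (Complex.I • b)]
    abel_nf
  have h2 := ContinuousAlternatingMap.alternatizeUncurryFin_alternatizeUncurryFinCLM_comp_of_symmetric hf
  -- The outer antilinear part acts on the new direction only, so it commutes with alternatization
  -- in the other slots.
  have h3 : antilinearPart (dbarSymbol n q ∘L B) =
      ContinuousAlternatingMap.alternatizeUncurryFinCLM ℝ (Cn n) ℂ ∘L f := by
    ext1 a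
    change (1 / 2 : ℂ) • (ContinuousAlternatingMap.alternatizeUncurryFin (antilinearPart (B a)) +
      Complex.I • ContinuousAlternatingMap.alternatizeUncurryFin
        (antilinearPart (B (Complex.I • a)))) =
      ContinuousAlternatingMap.alternatizeUncurryFin ((1 / 2 : ℂ) • (antilinearPart (B a) +
        Complex.I • antilinearPart (B (Complex.I • a))))
    rw [ContinuousAlternatingMap.alternatizeUncurryFin_smul,
      ContinuousAlternatingMap.alternatizeUncurryFin_add,
      ContinuousAlternatingMap.alternatizeUncurryFin_smul]
  rw [← h2, ← h3]; rfl

/-- The wedge product of a conjugate-linear functional with a form. -/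
theorem flatDbar_smul {c : Cn n → ℂ} {w : Cn n → Cn n [⋀^Fin q]→L[ℝ] ℂ} {y : Cn n}
    (hc : DifferentiableAt ℝ c y) (hw : DifferentiableAt ℝ w y) :
    flatDbar (fun y => c y • w y) y =
      c y • flatDbar w y + dbarSymbol n q ((fderiv ℝ c y).smulRight (w y)) := by
  have h : fderiv ℝ (fun y => c y • w y) y =
      c y • fderiv ℝ w y + (fderiv ℝ c y).smulRight (w y) := fderiv_fun_smul hc hw
  rw [flatDbar_eq, h, map_add, flatDbar_eq]
  congr 1
  ext v
  simp only [dbarSymbol_apply, antilinearPart_apply, ContinuousAlternatingMap.smul_apply,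
    Finset.smul_sum, _root_.smul_apply, ContinuousAlternatingMap.add_apply]
  refine Finset.sum_congr rfl fun j _ => ?_
  simp only [smul_eq_mul, mul_smul_comm]
  congr 1; ring

theorem dbarSymbol_smulRight_apply (l : Cn n →L[ℝ] ℂ) (η : Cn n [⋀^Fin q]→L[ℝ] ℂ)
    (v : Fin (q + 1) → Cn n) :
    dbarSymbol n q (l.smulRight η) v = ∑ j : Fin (q + 1), (-1) ^ (j : ℕ) •
      (antilinearPart l (v j) * η (j.removeNth v)) := by
  rw [dbarSymbol_apply]
  refine Finset.sum_congr rfl fun j _ => ?_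
  simp only [antilinearPart_apply, ContinuousLinearMap.smulRight_apply,
    ContinuousAlternatingMap.smul_apply, ContinuousAlternatingMap.add_apply, smul_eq_mul]
  congr 1; ring

/-- The extra Leibniz term contains `∂̄c`, the antilinear part of a complex-linear derivative, which
is `0`. -/
theorem flatDbar_holomorphic_smul {c : Cn n → ℂ} {w : Cn n → Cn n [⋀^Fin q]→L[ℝ] ℂ} {y : Cn n}
    (hc : DifferentiableAt ℂ c y) (hw : DifferentiableAt ℝ w y) :
    flatDbar (fun y => c y • w y) y = c y • flatDbar w y := by
  rw [flatDbar_smul (hc.restrictScalars ℝ) hw, add_eq_left]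
  ext v
  rw [dbarSymbol_smulRight_apply]
  have : antilinearPart (fderiv ℝ c y) = 0 := antilinearPart_of_linear fun v => by
    rw [hc.fderiv_restrictScalars ℝ]; simp
  simp [this]

/-- Differentiating the pullback gives the pullback of the derivative of `w` and a term `B`
containing the second derivative of `T`. Holomorphy of `T` lets the antilinear part pass through the
first term; the second alternatizes to `0` because the second derivative is symmetric. -/
theorem flatDbar_pullback {T : Cn n → Cn n} {w : Cn n → Cn n [⋀^Fin q]→L[ℝ] ℂ} {y : Cn n}
    (hT : ContDiffAt ℂ ω T y) (hw : DifferentiableAt ℝ w (T y))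
    (hwc : IsConjLin (w (T y))) :
    flatDbar (fun y => (w (T y)).compContinuousLinearMap ((fderiv ℂ T y).restrictScalars ℝ)) y =
      (flatDbar w (T y)).compContinuousLinearMap ((fderiv ℂ T y).restrictScalars ℝ) := by
  have hTd : DifferentiableAt ℂ T y := hT.differentiableAt (by simp)
  have hT2 : DifferentiableAt ℂ (fderiv ℂ T) y :=
    (hT.fderiv_right (m := 1) (by simp)).differentiableAt one_ne_zero
  have hsymm : ∀ a b, fderiv ℂ (fderiv ℂ T) y a b = fderiv ℂ (fderiv ℂ T) y b a :=
    hT.isSymmSndFDerivAt (by simp)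
  set G := fderiv ℂ T y with hG
  set H := fderiv ℂ (fderiv ℂ T) y with hH
  let R : (Cn n →L[ℂ] Cn n) →L[ℝ] (Cn n →L[ℝ] Cn n) :=
    ContinuousLinearMap.restrictScalarsL ℂ (Cn n) (Cn n) ℝ ℝ
  let h : Cn n →L[ℝ] Cn n →L[ℝ] Cn n := R ∘L (H.restrictScalars ℝ)
  have hg' : HasFDerivAt (fun y => (fderiv ℂ T y).restrictScalars ℝ) h y :=
    R.hasFDerivAt.comp y (hT2.hasFDerivAt.restrictScalars ℝ)
  have hw' : HasFDerivAt (fun y => w (T y)) (fderiv ℝ w (T y) ∘L G.restrictScalars ℝ) y :=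
    hw.hasFDerivAt.comp y (hTd.hasFDerivAt.restrictScalars ℝ)
  have hd := (hw'.continuousAlternatingMapCompContinuousLinearMap hg').fderiv
  rw [flatDbar_eq, hd, map_add]
  set B := (w (T y)).fderivCompContinuousLinearMap (G.restrictScalars ℝ) ∘L h with hB
  -- The second derivative of `T` is complex-linear in the direction and enters a conjugate-linear
  -- slot of `w`. So `B` equals its antilinear part, and its alternatization is the one that
  -- vanishes in the proof that `d` commutes with pullback.
  have hB0 : dbarSymbol n q B = 0 := by
    have : antilinearPart B = B := antilinearPart_of_antilinear fun v => by
      ext u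
      simp only [hB, ContinuousLinearMap.comp_apply, ContinuousAlternatingMap.smul_apply,
        ContinuousAlternatingMap.fderivCompContinuousLinearMap_apply, Finset.smul_sum]
      refine Finset.sum_congr rfl fun i _ => ?_
      have key : ∀ v, (fun j => (Function.update (fun _ => G.restrictScalars ℝ) i (h v) j) (u j)) =
          Function.update (fun j => G (u j)) i (H v (u i)) := fun v => by
        ext1 j
        by_cases hj : j = i
        · subst hj; simp; rfl
        · simp [hj]
      rw [key, key, map_smul, _root_.smul_apply, hwc.apply_update]
      simp
    change ContinuousAlternatingMap.alternatizeUncurryFin (antilinearPart B) = 0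
    rw [this]
    exact ContinuousAlternatingMap.alternatizeUncurryFin_fderivCompContinuousLinearMap_eq_zero
      _ _ fun a b => hsymm a b
  rw [hB0, add_zero]
  ext v
  rw [dbarSymbol_apply, ContinuousAlternatingMap.compContinuousLinearMap_apply, flatDbar_eq,
    dbarSymbol_apply]
  refine Finset.sum_congr rfl fun j _ => ?_
  congr 1
  simp only [antilinearPart_apply, ContinuousLinearMap.comp_apply,
    ContinuousLinearMap.coe_restrictScalars', map_smul, Function.comp_apply]
  rfl

end Flat

/-! ### Smoothness of form-valued functions -/

section FormCalculus

variable {n q : ℕ}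

/-- Evaluation of a form on all tuples of vectors of a basis. -/
def evalBasis (n q : ℕ) : (Cn n [⋀^Fin q]→L[ℝ] ℂ) →L[ℝ]
    ((Fin q → Fin (Module.finrank ℝ (Cn n))) → ℂ) :=
  ContinuousLinearMap.pi fun J =>
    ContinuousAlternatingMap.apply ℝ (Cn n) ℂ fun i => Module.finBasis ℝ (Cn n) (J i)

theorem evalBasis_injective (n q : ℕ) : Function.Injective (evalBasis n q) := fun η θ h => by
  apply ContinuousAlternatingMap.toAlternatingMap_injective
  exact (Module.finBasis ℝ (Cn n)).ext_alternating fun J _ => congrFun h J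

/-- Evaluation on tuples of basis vectors is an injective linear map between finite-dimensional
spaces. It has a continuous linear left inverse, which recovers `w` from finitely many smooth
functions. -/
theorem contDiffWithinAt_form {E : Type*} [NormedAddCommGroup E] [NormedSpace ℝ E]
    {w : E → Cn n [⋀^Fin q]→L[ℝ] ℂ} {s : Set E} {y : E}
    (h : ∀ v : Fin q → Cn n, ContDiffWithinAt ℝ ∞ (fun y => w y v) s y) :
    ContDiffWithinAt ℝ ∞ w s y := by
  obtain ⟨R, hR⟩ := (evalBasis n q).toLinearMap.exists_leftInverse_of_injective
    (LinearMap.ker_eq_bot.2 (evalBasis_injective n q))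
  have h1 : ContDiffWithinAt ℝ ∞ (fun y => evalBasis n q (w y)) s y :=
    contDiffWithinAt_pi.2 fun J => h _
  have h2 := (LinearMap.toContinuousLinearMap R).contDiff.contDiffAt.comp_contDiffWithinAt y h1
  have h3 : (fun y => LinearMap.toContinuousLinearMap R (evalBasis n q (w y))) = w :=
    funext fun y => LinearMap.congr_fun hR (w y)
  rw [← h3]; exact h2

theorem ContDiffWithinAt.form_pullback {E : Type*} [NormedAddCommGroup E] [NormedSpace ℝ E]
    {m : ℕ} {w : E → Cn n [⋀^Fin q]→L[ℝ] ℂ} {A : E → Cn m →L[ℝ] Cn n} {s : Set E} {y : E}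
    (hw : ContDiffWithinAt ℝ ∞ w s y) (hA : ContDiffWithinAt ℝ ∞ A s y) :
    ContDiffWithinAt ℝ ∞ (fun y => (w y).compContinuousLinearMap (A y)) s y := by
  apply contDiffWithinAt_form
  intro v
  have h1 : ContDiffWithinAt ℝ ∞ (fun y =>
      ContinuousAlternatingMap.toContinuousMultilinearMapCLM ℝ (w y)) s y :=
    ContDiffWithinAt.continuousLinearMap_comp (F := Cn n [⋀^Fin q]→L[ℝ] ℂ)
      (G := ContinuousMultilinearMap ℝ (fun _ : Fin q => Cn n) ℂ)
      (ContinuousAlternatingMap.toContinuousMultilinearMapCLM ℝ) hw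
  have h2 : ContDiffWithinAt ℝ ∞ (fun y =>
      ContinuousMultilinearMap.compContinuousLinearMapContinuousMultilinear ℝ
        (fun _ : Fin q => Cn m) (fun _ : Fin q => Cn n) ℂ (fun _ => A y)) s y :=
    (ContinuousMultilinearMap.contDiff _).contDiffAt.comp_contDiffWithinAt y
      (contDiffWithinAt_pi.2 fun _ => hA)
  have h3 := h2.clm_apply h1
  exact (ContinuousMultilinearMap.apply ℝ (fun _ : Fin q => Cn m) ℂ v).contDiff.contDiffAt.comp_contDiffWithinAt y h3

theorem ContDiffAt.form_pullback {E : Type*} [NormedAddCommGroup E] [NormedSpace ℝ E]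
    {m : ℕ} {w : E → Cn n [⋀^Fin q]→L[ℝ] ℂ} {A : E → Cn m →L[ℝ] Cn n} {y : E}
    (hw : ContDiffAt ℝ ∞ w y) (hA : ContDiffAt ℝ ∞ A y) :
    ContDiffAt ℝ ∞ (fun y => (w y).compContinuousLinearMap (A y)) y :=
  ContDiffWithinAt.form_pullback hw hA

theorem contDiffAt_clm_apply_comp {E F G : Type*} [NormedAddCommGroup E] [NormedSpace ℝ E]
    [NormedAddCommGroup F] [NormedSpace ℝ F] [NormedAddCommGroup G] [NormedSpace ℝ G]
    (L : F →L[ℝ] G) {f : E → F} {x : E} (h : ContDiffAt ℝ ∞ f x) :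
    ContDiffAt ℝ ∞ (fun y => L (f y)) x :=
  L.contDiff.contDiffAt.comp x h

theorem ContDiffAt.flatDbar {w : Cn n → Cn n [⋀^Fin q]→L[ℝ] ℂ} {y : Cn n}
    (hw : ContDiffAt ℝ ∞ w y) : ContDiffAt ℝ ∞ (flatDbar w) y :=
  contDiffAt_clm_apply_comp (E := Cn n) (F := Cn n →L[ℝ] Cn n [⋀^Fin q]→L[ℝ] ℂ)
    (G := Cn n [⋀^Fin (q + 1)]→L[ℝ] ℂ) (f := fderiv ℝ w) (dbarSymbol n q)
    (hw.fderiv_right (m := ∞) (by norm_cast))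

end FormCalculus

/-! ### Forms in charts and frames; invariance of `∂̄` -/

section Manifold

variable {n q : ℕ} {X : Type*} [TopologicalSpace X] [ChartedSpace (Cn n) X]
  [IsManifold 𝓘(ℂ, Cn n) ω X]
  {L : X → Type*} [TopologicalSpace (TotalSpace ℂ L)]
  [∀ x, AddCommGroup (L x)] [∀ x, Module ℂ (L x)] [∀ x, TopologicalSpace (L x)]
  [FiberBundle ℂ L] [VectorBundle ℂ ℂ L]

/-- The domain of the chart of `X` and of the trivialization of `L` around `x₀`. -/
def frameDomain (n : ℕ) {X : Type*} [TopologicalSpace X] [ChartedSpace (Cn n) X] (L : X → Type*)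
    [TopologicalSpace (TotalSpace ℂ L)] [∀ x, TopologicalSpace (L x)] [FiberBundle ℂ L]
    (x₀ : X) : Set X :=
  (chartAt (Cn n) x₀).source ∩ (trivializationAt ℂ L x₀).baseSet

theorem isOpen_frameDomain (x₀ : X) : IsOpen (frameDomain n L x₀) :=
  (chartAt (Cn n) x₀).open_source.inter (trivializationAt ℂ L x₀).open_baseSet

theorem mem_frameDomain_self (x₀ : X) : x₀ ∈ frameDomain n L x₀ :=
  ⟨mem_chart_source _ _, FiberBundle.mem_baseSet_trivializationAt' x₀⟩

/-- The expression of the value `η` of a form at `x`, in the chart and frame around `x₀`. -/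
def formRep (x₀ x : X) (η : FormAt n L q x) : Cn n [⋀^Fin q]→L[ℝ] ℂ :=
  (((trivializationAt ℂ L x₀).continuousLinearMapAt ℂ x).restrictScalars
    ℝ).compContinuousAlternatingMap
    (η.compContinuousLinearMap
      (((trivializationAt (Cn n) (TangentSpace 𝓘(ℂ, Cn n) : X → Type _) x₀).symmL ℂ
        x).restrictScalars ℝ))

/-- The inverse of `formRep`. -/
def formOfRep (L : X → Type*) [TopologicalSpace (TotalSpace ℂ L)]
    [∀ x, AddCommGroup (L x)] [∀ x, Module ℂ (L x)] [∀ x, TopologicalSpace (L x)]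
    [FiberBundle ℂ L] [VectorBundle ℂ ℂ L] (x₀ x : X) (θ : Cn n [⋀^Fin q]→L[ℝ] ℂ) :
    FormAt n L q x :=
  (((trivializationAt ℂ L x₀).symmL ℂ x).restrictScalars ℝ).compContinuousAlternatingMap
    (θ.compContinuousLinearMap
      (((trivializationAt (Cn n) (TangentSpace 𝓘(ℂ, Cn n) : X → Type _) x₀).continuousLinearMapAt ℂ
        x).restrictScalars ℝ))

theorem localRep_eq (u : ∀ x, FormAt n L q x) (x₀ : X) (y : Cn n) :
    localRep u x₀ y = formRep x₀ ((chartAt (Cn n) x₀).symm y) (u ((chartAt (Cn n) x₀).symm y)) :=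
  rfl

theorem localRep_chart (u : ∀ x, FormAt n L q x) {x₀ x : X} (hx : x ∈ (chartAt (Cn n) x₀).source) :
    localRep u x₀ (chartAt (Cn n) x₀ x) = formRep x₀ x (u x) := by
  rw [localRep_eq, (chartAt (Cn n) x₀).left_inv hx]

theorem dbar_eq (u : ∀ x, FormAt n L q x) (x : X) :
    dbar u x = formOfRep L x x (flatDbar (localRep u x) (chartAt (Cn n) x x)) := rfl

theorem formRep_apply (x₀ x : X) (η : FormAt n L q x) (v : Fin q → Cn n) :
    formRep x₀ x η v = (trivializationAt ℂ L x₀).continuousLinearMapAt ℂ x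
      (η fun i => (trivializationAt (Cn n) (TangentSpace 𝓘(ℂ, Cn n) : X → Type _) x₀).symmL ℂ x
        (v i)) := rfl

theorem formOfRep_apply (x₀ x : X) (θ : Cn n [⋀^Fin q]→L[ℝ] ℂ) (v : Fin q → Tan n x) :
    formOfRep L x₀ x θ v = (trivializationAt ℂ L x₀).symmL ℂ x
      (θ fun i => (trivializationAt (Cn n) (TangentSpace 𝓘(ℂ, Cn n) : X → Type _) x₀).continuousLinearMapAt ℂ x
        (v i)) := rfl

theorem mem_tangent_baseSet {x₀ x : X} (hx : x ∈ frameDomain n L x₀) :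
    x ∈ (trivializationAt (Cn n) (TangentSpace 𝓘(ℂ, Cn n) : X → Type _) x₀).baseSet := by
  rw [TangentBundle.trivializationAt_baseSet]; exact hx.1

theorem formRep_formOfRep {x₀ x : X} (hx : x ∈ frameDomain n L x₀) (θ : Cn n [⋀^Fin q]→L[ℝ] ℂ) :
    formRep x₀ x (formOfRep L x₀ x θ) = θ := by
  ext v
  rw [formRep_apply, formOfRep_apply,
    (trivializationAt ℂ L x₀).continuousLinearMapAt_symmL hx.2]
  congr 1
  ext1 i
  exact (trivializationAt (Cn n) (TangentSpace 𝓘(ℂ, Cn n) : X → Type _) x₀).continuousLinearMapAt_symmL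
    (R := ℂ) (mem_tangent_baseSet hx) (v i)

theorem formOfRep_formRep {x₀ x : X} (hx : x ∈ frameDomain n L x₀) (η : FormAt n L q x) :
    formOfRep L x₀ x (formRep x₀ x η) = η := by
  ext v
  rw [formOfRep_apply, formRep_apply,
    (trivializationAt ℂ L x₀).symmL_continuousLinearMapAt hx.2]
  congr 1
  ext1 i
  exact (trivializationAt (Cn n) (TangentSpace 𝓘(ℂ, Cn n) : X → Type _) x₀).symmL_continuousLinearMapAt
    (R := ℂ) (mem_tangent_baseSet hx) (v i)

theorem isConjLin_formRep {x₀ x : X} {η : FormAt n L q x} (hη : IsType0q η) :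
    IsConjLin (formRep x₀ x η) := fun v i c => by
  rw [formRep_apply, formRep_apply]
  have : (fun j => (trivializationAt (Cn n) (TangentSpace 𝓘(ℂ, Cn n) : X → Type _) x₀).symmL ℂ x
      (Function.update v i (c • v i) j)) =
      Function.update (fun j => (trivializationAt (Cn n) (TangentSpace 𝓘(ℂ, Cn n) : X → Type _)
        x₀).symmL ℂ x (v j)) i (c • (trivializationAt (Cn n) (TangentSpace 𝓘(ℂ, Cn n) : X → Type _)
        x₀).symmL ℂ x (v i)) := by
    ext1 j
    by_cases hj : j = i
    · subst hj; simp only [Function.update_self, map_smul]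
    · simp only [Function.update_of_ne hj]
  rw [this, hη _ i c, map_smul, smul_eq_mul]

theorem isType0q_formOfRep {x₀ x : X} {θ : Cn n [⋀^Fin q]→L[ℝ] ℂ} (hθ : IsConjLin θ) :
    IsType0q (formOfRep L x₀ x θ) := fun v i c => by
  rw [formOfRep_apply, formOfRep_apply]
  have : (fun j => (trivializationAt (Cn n) (TangentSpace 𝓘(ℂ, Cn n) : X → Type _)
      x₀).continuousLinearMapAt ℂ x (Function.update v i (c • v i) j)) =
      Function.update (fun j => (trivializationAt (Cn n) (TangentSpace 𝓘(ℂ, Cn n) : X → Type _)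
        x₀).continuousLinearMapAt ℂ x (v j)) i (c • (trivializationAt (Cn n)
        (TangentSpace 𝓘(ℂ, Cn n) : X → Type _) x₀).continuousLinearMapAt ℂ x (v i)) := by
    ext1 j
    by_cases hj : j = i
    · subst hj; simp only [Function.update_self, map_smul]
    · simp only [Function.update_of_ne hj]
  rw [this, hθ _ i c, ← smul_eq_mul, map_smul]

/-- The chart transition from the chart around `x₁` to the chart around `x₀`. -/
def transition (n : ℕ) {X : Type*} [TopologicalSpace X] [ChartedSpace (Cn n) X] (x₀ x₁ : X) :
    Cn n → Cn n :=
  chartAt (Cn n) x₀ ∘ (chartAt (Cn n) x₁).symm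

/-- The change of frame of `L` from the trivialization around `x₀` to the one around `x₁`. -/
def frameChange (L : X → Type*) [TopologicalSpace (TotalSpace ℂ L)]
    [∀ x, AddCommGroup (L x)] [∀ x, Module ℂ (L x)] [∀ x, TopologicalSpace (L x)]
    [FiberBundle ℂ L] [VectorBundle ℂ ℂ L] (x₀ x₁ x : X) : ℂ :=
  (trivializationAt ℂ L x₁).continuousLinearMapAt ℂ x ((trivializationAt ℂ L x₀).symmL ℂ x 1)

theorem frameChange_mul {x₀ x₁ x : X} (hx : x ∈ (trivializationAt ℂ L x₀).baseSet) (s : L x) :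
    (trivializationAt ℂ L x₁).continuousLinearMapAt ℂ x s = frameChange L x₀ x₁ x *
      (trivializationAt ℂ L x₀).continuousLinearMapAt ℂ x s := by
  conv_lhs => rw [← (trivializationAt ℂ L x₀).symmL_continuousLinearMapAt (R := ℂ) hx s,
    ← mul_one ((trivializationAt ℂ L x₀).continuousLinearMapAt ℂ x s), ← smul_eq_mul, map_smul,
    map_smul]
  rw [smul_eq_mul, mul_comm]; rfl

theorem contDiffAt_transition {x₀ x₁ x : X} (h0 : x ∈ (chartAt (Cn n) x₀).source)
    (h1 : x ∈ (chartAt (Cn n) x₁).source) :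
    ContDiffAt ℂ ω (transition n x₀ x₁) (chartAt (Cn n) x₁ x) := by
  have h := contDiffWithinAt_ext_coord_change (I := 𝓘(ℂ, Cn n)) (n := ω) x₀ x₁
    (y := chartAt (Cn n) x₁ x) (by simp [(chartAt (Cn n) x₁).left_inv h1, h0, h1])
  simpa [contDiffWithinAt_univ] using! h

/-- Both trivializations are compared with the chart centred at `x`; the cocycle identity of the
tangent bundle core removes that intermediate chart. -/
theorem tangent_transition {x₀ x₁ x : X} (h0 : x ∈ (chartAt (Cn n) x₀).source)
    (h1 : x ∈ (chartAt (Cn n) x₁).source) :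
    (trivializationAt (Cn n) (TangentSpace 𝓘(ℂ, Cn n) : X → Type _) x₀).continuousLinearMapAt ℂ x ∘L
      (trivializationAt (Cn n) (TangentSpace 𝓘(ℂ, Cn n) : X → Type _) x₁).symmL ℂ x =
    fderiv ℂ (transition n x₀ x₁) (chartAt (Cn n) x₁ x) := by
  rw [TangentBundle.continuousLinearMapAt_trivializationAt_eq_core h0,
    TangentBundle.symmL_trivializationAt_eq_core h1]
  ext1 v
  have h := (tangentBundleCore 𝓘(ℂ, Cn n) X).coordChange_comp (achart _ x₁) (achart _ x)
    (achart _ x₀) x ⟨⟨h1, mem_chart_source _ x⟩, h0⟩ v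
  refine Eq.trans h ?_
  rw [tangentBundleCore_coordChange, modelWithCornersSelf_coe, range_id, fderivWithin_univ]
  rfl

theorem formRep_transition {x₀ x₁ x : X} (h0 : x ∈ frameDomain n L x₀)
    (h1 : x ∈ (chartAt (Cn n) x₁).source) (η : FormAt n L q x) :
    formRep x₁ x η = frameChange L x₀ x₁ x • (formRep x₀ x η).compContinuousLinearMap
      ((fderiv ℂ (transition n x₀ x₁) (chartAt (Cn n) x₁ x)).restrictScalars ℝ) := by
  rw [← tangent_transition h0.1 h1]
  ext v
  rw [formRep_apply, frameChange_mul h0.2, ContinuousAlternatingMap.smul_apply,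
    ContinuousAlternatingMap.compContinuousLinearMap_apply, formRep_apply, smul_eq_mul]
  congr 3
  ext1 i
  exact ((trivializationAt (Cn n) (TangentSpace 𝓘(ℂ, Cn n) : X → Type _) x₀).symmL_continuousLinearMapAt
    (R := ℂ) (mem_tangent_baseSet h0) _).symm


theorem contDiffAt_frameChange [ContMDiffVectorBundle ω ℂ L 𝓘(ℂ, Cn n)] {x₀ x₁ x₂ x : X}
    (h0 : x ∈ (trivializationAt ℂ L x₀).baseSet) (h1 : x ∈ (trivializationAt ℂ L x₁).baseSet)
    (h2 : x ∈ (chartAt (Cn n) x₂).source) :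
    ContDiffAt ℂ ω (fun y => frameChange L x₀ x₁ ((chartAt (Cn n) x₂).symm y))
      (chartAt (Cn n) x₂ x) := by
  have hx : (chartAt (Cn n) x₂).symm (chartAt (Cn n) x₂ x) = x := (chartAt (Cn n) x₂).left_inv h2
  have hopen : IsOpen ((trivializationAt ℂ L x₀).baseSet ∩ (trivializationAt ℂ L x₁).baseSet) :=
    (trivializationAt ℂ L x₀).open_baseSet.inter (trivializationAt ℂ L x₁).open_baseSet
  have hc : ContMDiffAt 𝓘(ℂ, Cn n) 𝓘(ℂ, ℂ →L[ℂ] ℂ) ω (fun b => (((trivializationAt ℂ L x₀).coordChangeL ℂ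
      (trivializationAt ℂ L x₁) b : ℂ ≃L[ℂ] ℂ) : ℂ →L[ℂ] ℂ)) x :=
    (contMDiffOn_coordChangeL (n := ω) (IB := 𝓘(ℂ, Cn n)) (trivializationAt ℂ L x₀)
      (trivializationAt ℂ L x₁)).contMDiffAt (hopen.mem_nhds ⟨h0, h1⟩)
  have hs : ContMDiffAt 𝓘(ℂ, Cn n) 𝓘(ℂ, Cn n) ω (chartAt (Cn n) x₂).symm (chartAt (Cn n) x₂ x) :=
    (contMDiffOn_chart_symm (I := 𝓘(ℂ, Cn n)) (n := ω)).contMDiffAt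
      ((chartAt (Cn n) x₂).open_target.mem_nhds ((chartAt (Cn n) x₂).map_source h2))
  have h3 : ContMDiffAt 𝓘(ℂ, Cn n) 𝓘(ℂ, ℂ →L[ℂ] ℂ) ω ((fun b => (((trivializationAt ℂ L x₀).coordChangeL ℂ
      (trivializationAt ℂ L x₁) b : ℂ ≃L[ℂ] ℂ) : ℂ →L[ℂ] ℂ)) ∘ (chartAt (Cn n) x₂).symm)
      (chartAt (Cn n) x₂ x) := ContMDiffAt.comp _ (by rw [hx]; exact hc) hs
  have h4 := h3.contDiffAt.clm_apply (contDiffAt_const (c := (1 : ℂ)))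
  refine h4.congr_of_eventuallyEq ?_
  have hev : ∀ᶠ y in 𝓝 (chartAt (Cn n) x₂ x), (chartAt (Cn n) x₂).symm y ∈
      (trivializationAt ℂ L x₀).baseSet ∩ (trivializationAt ℂ L x₁).baseSet :=
    hs.continuousAt.eventually_mem (hopen.mem_nhds (by rw [hx]; exact ⟨h0, h1⟩))
  filter_upwards [hev] with y hy
  simp only [Function.comp_apply, frameChange]
  rw [ContinuousLinearEquiv.coe_coe, Trivialization.coordChangeL_apply _ _ hy,
    Trivialization.continuousLinearMapAt_apply, Trivialization.linearMapAt_apply, if_pos hy.2,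
    Trivialization.symmL_apply _ hy.1]

theorem eventually_mem_chart {x₀ x : X} (hx : x ∈ (chartAt (Cn n) x₀).source) {s : Set X}
    (hs : s ∈ 𝓝 x) :
    ∀ᶠ y in 𝓝 (chartAt (Cn n) x₀ x), y ∈ (chartAt (Cn n) x₀).target ∧
      (chartAt (Cn n) x₀).symm y ∈ s := by
  have ht := (chartAt (Cn n) x₀).map_source hx
  refine Filter.Eventually.and ((chartAt (Cn n) x₀).open_target.mem_nhds ht) ?_
  refine ((chartAt (Cn n) x₀).continuousAt_symm ht).eventually_mem ?_
  rwa [(chartAt (Cn n) x₀).left_inv hx]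

theorem localRep_transition (u : ∀ x, FormAt n L q x) {x₀ x₁ x : X} (h0 : x ∈ frameDomain n L x₀)
    (h1 : x ∈ (chartAt (Cn n) x₁).source) :
    localRep u x₁ =ᶠ[𝓝 (chartAt (Cn n) x₁ x)] fun y =>
      frameChange L x₀ x₁ ((chartAt (Cn n) x₁).symm y) •
        (localRep u x₀ (transition n x₀ x₁ y)).compContinuousLinearMap
          ((fderiv ℂ (transition n x₀ x₁) y).restrictScalars ℝ) := by
  filter_upwards [eventually_mem_chart h1 ((isOpen_frameDomain x₀).mem_nhds h0)] with y hy
  rw [transition, Function.comp_apply, localRep_chart u hy.2.1, localRep_eq,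
    formRep_transition hy.2 ((chartAt (Cn n) x₁).map_target hy.1),
    (chartAt (Cn n) x₁).right_inv hy.1]
  rfl

/-- Smoothness of a form at a point, in the chart and frame around this point. -/
def SmoothFormAt (u : ∀ x, FormAt n L q x) (x : X) : Prop :=
  ContDiffAt ℝ ∞ (localRep u x) (chartAt (Cn n) x x)

theorem contDiffAt_localRep_change [ContMDiffVectorBundle ω ℂ L 𝓘(ℂ, Cn n)]
    {u : ∀ x, FormAt n L q x} {x₀ x₁ x : X}
    (h0 : x ∈ frameDomain n L x₀) (h1 : x ∈ frameDomain n L x₁)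
    (hu : ContDiffAt ℝ ∞ (localRep u x₀) (chartAt (Cn n) x₀ x)) :
    ContDiffAt ℝ ∞ (localRep u x₁) (chartAt (Cn n) x₁ x) := by
  refine ContDiffAt.congr_of_eventuallyEq ?_ (localRep_transition u h0 h1.1)
  have hT := contDiffAt_transition h0.1 h1.1
  have hTx : transition n x₀ x₁ (chartAt (Cn n) x₁ x) = chartAt (Cn n) x₀ x := by
    rw [transition, Function.comp_apply, (chartAt (Cn n) x₁).left_inv h1.1]
  have hc := contDiffAt_frameChange h0.2 h1.2 h1.1
  have hT' : ContDiffAt ℂ ω (fderiv ℂ (transition n x₀ x₁)) (chartAt (Cn n) x₁ x) :=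
    hT.fderiv_right (by simp)
  have hA : ContDiffAt ℝ ∞ (fun y => (fderiv ℂ (transition n x₀ x₁) y).restrictScalars ℝ)
      (chartAt (Cn n) x₁ x) :=
    ContDiffAt.continuousLinearMap_comp
      (ContinuousLinearMap.restrictScalarsL ℂ (Cn n) (Cn n) ℝ ℝ)
      ((hT'.restrict_scalars ℝ).of_le le_top)
  refine ((hc.restrict_scalars ℝ).of_le le_top).smul (ContDiffAt.form_pullback ?_ hA)
  exact ContDiffAt.comp _ (by rw [hTx]; exact hu) ((hT.restrict_scalars ℝ).of_le le_top)

theorem smoothFormAt_iff [ContMDiffVectorBundle ω ℂ L 𝓘(ℂ, Cn n)]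
    {u : ∀ x, FormAt n L q x} {x₀ x : X} (h0 : x ∈ frameDomain n L x₀) :
    SmoothFormAt u x ↔ ContDiffAt ℝ ∞ (localRep u x₀) (chartAt (Cn n) x₀ x) :=
  ⟨contDiffAt_localRep_change (mem_frameDomain_self x) h0,
    contDiffAt_localRep_change h0 (mem_frameDomain_self x)⟩

theorem smoothFormOn_of_smoothFormAt [ContMDiffVectorBundle ω ℂ L 𝓘(ℂ, Cn n)]
    {u : ∀ x, FormAt n L q x} {S : Set X} (hu : ∀ x ∈ S, SmoothFormAt u x) : SmoothFormOn u S :=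
  fun x₀ y hy => by
  have hs := (chartAt (Cn n) x₀).map_target hy.1
  have := (smoothFormAt_iff (x₀ := x₀) ⟨hs, hy.2.1⟩).1 (hu _ hy.2.2)
  rw [(chartAt (Cn n) x₀).right_inv hy.1] at this
  exact this.contDiffWithinAt

theorem SmoothFormOn.smoothFormAt {u : ∀ x, FormAt n L q x} {S : Set X} (hu : SmoothFormOn u S)
    {x : X} (hS : S ∈ 𝓝 x) : SmoothFormAt u x := by
  have hx := mem_chart_source (Cn n) x
  refine (hu x _ ⟨mem_chart_target _ x, ?_⟩).contDiffAt ?_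
  · rw [(chartAt (Cn n) x).left_inv hx]
    exact ⟨FiberBundle.mem_baseSet_trivializationAt' x, mem_of_mem_nhds hS⟩
  · exact eventually_mem_chart hx (Filter.inter_mem
      ((trivializationAt ℂ L x).open_baseSet.mem_nhds (FiberBundle.mem_baseSet_trivializationAt' x)) hS)

/-- `dbar` is computed at each point in the chart and frame of that very point. Any other choice
differs by a holomorphic pullback and a holomorphic factor, and `∂̄` commutes with both on
`(0,q)`-forms; thus one fixed chart serves for a whole neighbourhood. -/
theorem localRep_dbar [ContMDiffVectorBundle ω ℂ L 𝓘(ℂ, Cn n)] {u : ∀ x, FormAt n L q x}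
    {x₀ x : X} (h0 : x ∈ frameDomain n L x₀) (hu : SmoothFormAt u x) (ht : IsType0q (u x)) :
    formRep x₀ x (dbar u x) = flatDbar (localRep u x₀) (chartAt (Cn n) x₀ x) := by
  have hx := mem_frameDomain_self (n := n) (L := L) x
  have hT := contDiffAt_transition hx.1 h0.1
  have hTx : transition n x x₀ (chartAt (Cn n) x₀ x) = chartAt (Cn n) x x := by
    rw [transition, Function.comp_apply, (chartAt (Cn n) x₀).left_inv h0.1]
  have hc := contDiffAt_frameChange hx.2 h0.2 h0.1
  have hd : DifferentiableAt ℝ (localRep u x) (transition n x x₀ (chartAt (Cn n) x₀ x)) := by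
    rw [hTx]; exact hu.differentiableAt (by simp)
  have hA : DifferentiableAt ℝ (fun y => (fderiv ℂ (transition n x x₀) y).restrictScalars ℝ)
      (chartAt (Cn n) x₀ x) :=
    (ContinuousLinearMap.restrictScalarsL ℂ (Cn n) (Cn n) ℝ ℝ).differentiableAt.comp _
      (((hT.fderiv_right (m := 1) (by simp)).differentiableAt one_ne_zero).restrictScalars ℝ)
  rw [flatDbar_congr (localRep_transition u hx h0.1), flatDbar_holomorphic_smul
    (hc.differentiableAt (by simp)) ?_, flatDbar_pullback hT hd, hTx, dbar_eq,
    formRep_transition hx h0.1, formRep_formOfRep hx, (chartAt (Cn n) x₀).left_inv h0.1]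
  · rw [hTx, localRep_chart u hx.1]; exact isConjLin_formRep ht
  · exact DifferentiableAt.continuousAlternatingMapCompContinuousLinearMap (𝕜 := ℝ)
      (hd.comp _ ((hT.differentiableAt (by simp)).restrictScalars ℝ)) hA

theorem eventually_localRep_dbar [ContMDiffVectorBundle ω ℂ L 𝓘(ℂ, Cn n)]
    {u : ∀ x, FormAt n L q x} {x₀ x : X} (h0 : x ∈ frameDomain n L x₀)
    (hu : ∀ᶠ x' in 𝓝 x, SmoothFormAt u x') (ht : ∀ᶠ x' in 𝓝 x, IsType0q (u x')) :
    localRep (dbar u) x₀ =ᶠ[𝓝 (chartAt (Cn n) x₀ x)] flatDbar (localRep u x₀) := by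
  filter_upwards [eventually_mem_chart h0.1 (Filter.inter_mem ((isOpen_frameDomain x₀).mem_nhds h0)
    (Filter.inter_mem hu ht))] with y hy
  rw [localRep_eq, localRep_dbar hy.2.1 hy.2.2.1 hy.2.2.2, (chartAt (Cn n) x₀).right_inv hy.1]

theorem smoothFormAt_dbar [ContMDiffVectorBundle ω ℂ L 𝓘(ℂ, Cn n)] {u : ∀ x, FormAt n L q x}
    (hu : ∀ x, SmoothFormAt u x) (ht : ∀ x, IsType0q (u x)) (x : X) : SmoothFormAt (dbar u) x :=
  (ContDiffAt.flatDbar (hu x)).congr_of_eventuallyEq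
    (eventually_localRep_dbar (mem_frameDomain_self x) (.of_forall hu) (.of_forall ht))

theorem isConjLin_localRep {u : ∀ x, FormAt n L q x} (ht : ∀ x, IsType0q (u x)) (x₀ : X)
    (y : Cn n) : IsConjLin (localRep u x₀ y) := isConjLin_formRep (ht _)

theorem isType0q_dbar {u : ∀ x, FormAt n L q x} (ht : ∀ x, IsType0q (u x)) (x : X) :
    IsType0q (dbar u x) :=
  isType0q_formOfRep (isConjLin_flatDbar (.of_forall (isConjLin_localRep ht x)))

theorem dbar_dbar [ContMDiffVectorBundle ω ℂ L 𝓘(ℂ, Cn n)] {u : ∀ x, FormAt n L q x}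
    (hu : ∀ x, SmoothFormAt u x) (ht : ∀ x, IsType0q (u x)) (x : X) : dbar (dbar u) x = 0 := by
  rw [dbar_eq, flatDbar_congr (eventually_localRep_dbar (mem_frameDomain_self x) (.of_forall hu)
    (.of_forall ht)), flatDbar_flatDbar (hu x)]
  ext v
  rw [formOfRep_apply]
  simp

end Manifold

/-! ### Division of a covector by a conjugate-linear functional -/

section Division

variable {n p : ℕ}

/-- Split every argument as an element of `ker l` plus a multiple of `a` and expand. The term with
all arguments in the kernel vanishes by `hker`; any other term has a multiple of `a` in some slot,
which is moved to the front at the cost of a sign and killed by `hins`. -/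
theorem IsConjLin.eq_zero_of_insert_eq_zero {θ : Cn n [⋀^Fin (p + 1)]→L[ℝ] ℂ} (hθ : IsConjLin θ)
    {l : Cn n →L[ℂ] ℂ} {a : Cn n} (ha : l a = 1)
    (hker : ∀ v : Fin (p + 1) → Cn n, (∀ i, l (v i) = 0) → θ v = 0)
    (hins : ∀ v : Fin p → Cn n, θ (Matrix.vecCons a v) = 0) : θ = 0 := by
  have hslot : ∀ (v : Fin (p + 1) → Cn n) (j : Fin (p + 1)) (c : ℂ), v j = c • a → θ v = 0 := by
    intro v j c hv
    have h1 := hθ.apply_update v j c a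
    rw [← hv, Function.update_eq_self] at h1
    have h2 : Function.update v j a = j.insertNth a (j.removeNth v) := by
      rw [Fin.insertNth_removeNth]
    rw [h1, h2, ContinuousAlternatingMap.map_insertNth, hins]
    simp
  ext v
  have hv : v = (fun j => v j - l (v j) • a) + fun j => l (v j) • a := by
    ext1 j; simp
  have h := θ.toMultilinearMap.map_add_univ (fun j => v j - l (v j) • a) (fun j => l (v j) • a)
  rw [← hv] at h
  change θ v = 0
  refine Eq.trans h (Finset.sum_eq_zero fun S _ => ?_)
  by_cases hS : S = Finset.univ
  · subst hS
    rw [Finset.piecewise_univ]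
    refine hker _ fun i => ?_
    simp [ha]
  · obtain ⟨j, hj⟩ : ∃ j, j ∉ S := by
      by_contra! hcon
      exact hS (Finset.eq_univ_of_forall hcon)
    exact hslot _ j (l (v j)) (by simp [Finset.piecewise_eq_of_notMem _ _ _ hj])

/-- The conjugate of a complex-linear functional. -/
def conjFunctional (l : Cn n →L[ℂ] ℂ) : Cn n →L[ℝ] ℂ :=
  (Complex.conjCLE : ℂ →L[ℝ] ℂ) ∘L l.restrictScalars ℝ

theorem conjFunctional_apply (l : Cn n →L[ℂ] ℂ) (v : Cn n) :
    conjFunctional l v = (starRingEnd ℂ) (l v) := rfl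

theorem antilinearPart_conjFunctional (l : Cn n →L[ℂ] ℂ) :
    antilinearPart (conjFunctional l) = conjFunctional l :=
  antilinearPart_of_antilinear fun v => by
    rw [conjFunctional_apply, conjFunctional_apply, map_smul, smul_eq_mul, map_mul, Complex.conj_I,
      smul_eq_mul]

/-- A `(0,p+1)`-covector that vanishes on the kernel of `l` is divisible by the conjugate of `l`. -/
theorem IsConjLin.wedge_contract {η : Cn n [⋀^Fin (p + 1)]→L[ℝ] ℂ} (hη : IsConjLin η)
    {l : Cn n →L[ℂ] ℂ} {a : Cn n} (ha : l a ≠ 0)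
    (hker : ∀ v : Fin (p + 1) → Cn n, (∀ i, l (v i) = 0) → η v = 0) :
    dbarSymbol n p ((conjFunctional l).smulRight
      (((starRingEnd ℂ) (l a))⁻¹ • η.curryLeft a)) = η := by
  -- Normalizing `a` so that `l b = 1` absorbs the factor `(conj (l a))⁻¹` into the contraction,
  -- since `η` is conjugate-linear.
  set b : Cn n := (l a)⁻¹ • a
  have hb : l b = 1 := by simp [b, ha]
  have hcb : ((starRingEnd ℂ) (l a))⁻¹ • η.curryLeft a = η.curryLeft b := by
    ext v
    have h := hη.apply_update (Matrix.vecCons a v) 0 (l a)⁻¹ a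
    rw [map_inv₀] at h
    simpa [b, Matrix.vecCons] using h.symm
  rw [hcb]
  have hcl : IsConjLin (η.curryLeft b) := fun v i c => by
    have h := hη (Matrix.vecCons b v) i.succ c
    have h2 : Function.update (Matrix.vecCons b v) i.succ (c • v i) =
        Matrix.vecCons b (Function.update v i (c • v i)) := by
      simp [Matrix.vecCons]
    simp only [Matrix.cons_val_succ] at h
    rw [h2] at h
    exact h
  have hT : ∀ v, IsConjLin ((conjFunctional l).smulRight (η.curryLeft b) v) := fun v => hcl.smul _
  have hD := isConjLin_dbarSymbol hT
  have happ : ∀ v, dbarSymbol n p ((conjFunctional l).smulRight (η.curryLeft b)) v =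
      ∑ j : Fin (p + 1), (-1) ^ (j : ℕ) •
        ((starRingEnd ℂ) (l (v j)) * η (Matrix.vecCons b (j.removeNth v))) := fun v => by
    rw [dbarSymbol_smulRight_apply, antilinearPart_conjFunctional]; rfl
  rw [← sub_eq_zero, sub_eq_add_neg, ← neg_one_smul ℂ η]
  -- The difference of the two sides is again conjugate-linear, so it suffices to test it on `ker l`
  -- and after inserting `b`.
  refine (hD.add (hη.smul _)).eq_zero_of_insert_eq_zero hb (fun v hv => ?_) fun v => ?_
  · rw [ContinuousAlternatingMap.add_apply, happ, ContinuousAlternatingMap.smul_apply, hker v hv]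
    simp [hv]
  · rw [ContinuousAlternatingMap.add_apply, happ, Fin.sum_univ_succ]
    -- Omitting a slot other than the first leaves two copies of `b`: the one inserted by the
    -- contraction and the one in front. Only the summand `j = 0` survives.
    have : ∀ j : Fin p, η (Matrix.vecCons b (j.succ.removeNth (Matrix.vecCons b v))) = 0 := by
      intro j
      have hp : ∃ m, p = m + 1 := ⟨p - 1, by have := j.2; omega⟩
      obtain ⟨m, rfl⟩ := hp
      refine η.map_eq_zero_of_eq _ (i := 0) (j := 1) ?_ (by simp)
      simp [Fin.removeNth, Matrix.vecCons]
    rw [Finset.sum_eq_zero fun j _ => by rw [this, mul_zero, smul_zero]]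
    simp [hb, Matrix.vecCons]

end Division

/-! ### Holomorphic retraction onto the zero set, and its uses -/

section Retraction

variable {n p : ℕ}

/-- The local biholomorphism `Φ` straightens the zero set: `l (Φ y - y₀) = f y`. The retraction is
`Φ⁻¹ ∘ P ∘ Φ`, where `P` projects along `a` onto the affine hyperplane `l (w - y₀) = 0`. -/
theorem exists_holomorphic_retraction {f : Cn n → ℂ} {y₀ : Cn n} (hf : ContDiffAt ℂ ω f y₀)
    (hf0 : f y₀ = 0) (hdf : fderiv ℂ f y₀ ≠ 0) :
    ∃ r : Cn n → Cn n, r y₀ = y₀ ∧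
      ∀ᶠ y in 𝓝 y₀, ContDiffAt ℂ ω r y ∧ f (r y) = 0 ∧ (f y = 0 → r y = y) := by
  set l := fderiv ℂ f y₀ with hl
  obtain ⟨a, ha⟩ : ∃ a, l a = 1 := by
    obtain ⟨b, hb⟩ : ∃ b, l b ≠ 0 := by
      by_contra! h; exact hdf (ContinuousLinearMap.ext h)
    exact ⟨(l b)⁻¹ • b, by simp [hb]⟩
  -- The identity, corrected along `a` by the nonlinear part of `f`. Its derivative at `y₀` is the
  -- identity, so the inverse function theorem applies.
  let Φ : Cn n → Cn n := fun y => y + (f y - l (y - y₀)) • a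
  have hΦ : ContDiffAt ℂ ω Φ y₀ := by
    have : ContDiffAt ℂ ω (fun y => l (y - y₀)) y₀ :=
      l.contDiff.contDiffAt.comp y₀ (contDiffAt_id.sub contDiffAt_const)
    exact contDiffAt_id.add ((hf.sub this).smul contDiffAt_const)
  have hΦ' : HasFDerivAt Φ ((ContinuousLinearEquiv.refl ℂ (Cn n) : Cn n →L[ℂ] Cn n)) y₀ := by
    have h1 : HasFDerivAt f l y₀ := (hf.differentiableAt (by simp)).hasFDerivAt
    have h2 : HasFDerivAt (fun y => l (y - y₀)) l y₀ :=
      l.hasFDerivAt.comp y₀ ((hasFDerivAt_id y₀).sub_const y₀)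
    have h3 := (hasFDerivAt_id (𝕜 := ℂ) y₀).add ((h1.sub h2).smul_const a)
    have h4 : ContinuousLinearMap.id ℂ (Cn n) + (l - l).smulRight a =
        ((ContinuousLinearEquiv.refl ℂ (Cn n) : Cn n →L[ℂ] Cn n)) := by
      ext1 v
      simp
    rwa [h4] at h3
  let e := hΦ.toOpenPartialHomeomorph Φ hΦ' (by simp)
  have he : ∀ y, e y = Φ y := fun y => rfl
  have hy₀ : y₀ ∈ e.source := hΦ.mem_toOpenPartialHomeomorph_source hΦ' (by simp)
  have hΦ0 : Φ y₀ = y₀ := by simp [Φ, hf0]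
  have hsymm : ContDiffAt ℂ ω e.symm y₀ := by
    have := hΦ.to_localInverse hΦ' (by simp)
    rw [hΦ0] at this
    exact this
  have hes : e.symm y₀ = y₀ := by
    conv_lhs => rw [← hΦ0, ← he]
    exact e.left_inv hy₀
  have htar : y₀ ∈ e.target := by
    have := e.map_source hy₀; rwa [he, hΦ0] at this
  let P : Cn n → Cn n := fun w => w - l (w - y₀) • a
  have hP0 : P y₀ = y₀ := by simp [P]
  have hP : ContDiff ℂ ω P :=
    contDiff_id.sub ((l.contDiff.comp (contDiff_id.sub contDiff_const)).smul contDiff_const)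
  have hlΦ : ∀ y, l (Φ y - y₀) = f y := fun y => by
    simp only [Φ, map_sub, map_add, map_smul, ha, smul_eq_mul, mul_one]
    ring
  have hlP : ∀ w, l (P w - y₀) = 0 := fun w => by
    simp [P, ha]
  have hPΦ : ContDiffAt ℂ ω (fun y => P (Φ y)) y₀ := hP.contDiffAt.comp y₀ hΦ
  have hr : ContDiffAt ℂ ω (fun y => e.symm (P (Φ y))) y₀ :=
    ContDiffAt.comp y₀ (by rw [hΦ0, hP0]; exact hsymm) hPΦ
  refine ⟨fun y => e.symm (P (Φ y)), by simp only [hΦ0, hP0, hes], ?_⟩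
  have hev1 := hr.eventually (by simp)
  have hev2 : ∀ᶠ y in 𝓝 y₀, P (Φ y) ∈ e.target :=
    hPΦ.continuousAt.eventually_mem (e.open_target.mem_nhds (by rw [hΦ0, hP0]; exact htar))
  filter_upwards [hev1, hev2, e.open_source.mem_nhds hy₀] with y h1 h2 h3
  refine ⟨h1, ?_, fun h => ?_⟩
  · rw [← hlΦ, ← he, e.right_inv h2, hlP]
  · have : P (Φ y) = Φ y := by simp only [P, hlΦ, h, zero_smul, sub_zero]
    rw [this, ← he, e.left_inv h3]

/-- Near `y₀` the zero set is its own image under the retraction `r`. There `df ∘ dr = 0` with `df ≠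
0`, so `dr` is not surjective and its determinant is `0`; the image of a set on which the Jacobian
vanishes is null. -/
theorem exists_nhds_volume_zeroSet {f : Cn n → ℂ} {y₀ : Cn n} (hf : ContDiffAt ℂ ω f y₀)
    (hf0 : f y₀ = 0) (hdf : fderiv ℂ f y₀ ≠ 0) :
    ∃ U ∈ 𝓝 y₀, volume (U ∩ {y | f y = 0}) = 0 := by
  obtain ⟨r, hr0, hr⟩ := exists_holomorphic_retraction hf hf0 hdf
  have hdc : ∀ᶠ y in 𝓝 y₀, fderiv ℂ f y ≠ 0 :=
    ((hf.fderiv_right (m := 0) (by simp)).continuousAt).eventually_ne hdf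
  have hcd : ∀ᶠ y in 𝓝 y₀, ContDiffAt ℂ ω f y := hf.eventually (by simp)
  refine ⟨_, (hr.eventually_nhds.and (hdc.and hcd)), ?_⟩
  -- The properties of `r` are required in a neighbourhood of each point of `s`, so that `f ∘ r = 0`
  -- can be differentiated there.
  set s := {y | (∀ᶠ y in 𝓝 y, ContDiffAt ℂ ω r y ∧ f (r y) = 0 ∧ (f y = 0 → r y = y)) ∧
    fderiv ℂ f y ≠ 0 ∧ ContDiffAt ℂ ω f y} ∩ {y | f y = 0} with hs
  have himg : s = r '' s := by
    have : ∀ y ∈ s, r y = y := fun y hy => hy.1.1.self_of_nhds.2.2 hy.2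
    rw [Set.image_congr this, Set.image_id']
  rw [himg]
  refine addHaar_image_eq_zero_of_det_fderivWithin_eq_zero volume
    (f' := fun y => (fderiv ℂ r y).restrictScalars ℝ) (fun y hy => ?_) fun y hy => ?_
  · exact (((hy.1.1.self_of_nhds.1).differentiableAt
      (by simp)).hasFDerivAt.restrictScalars ℝ).hasFDerivWithinAt
  · have hry : r y = y := hy.1.1.self_of_nhds.2.2 hy.2
    by_contra hdet
    have hz : fderiv ℂ f y ∘L fderiv ℂ r y = 0 := by
      have h1 : HasFDerivAt r (fderiv ℂ r y) y :=
        ((hy.1.1.self_of_nhds.1).differentiableAt (by simp)).hasFDerivAt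
      have h2 : HasFDerivAt f (fderiv ℂ f y) (r y) := by
        rw [hry]; exact (hy.1.2.2.differentiableAt (by simp)).hasFDerivAt
      have h3 := h2.comp y h1
      have h4 : HasFDerivAt (f ∘ r) (0 : Cn n →L[ℂ] ℂ) y :=
        (hasFDerivAt_const (0 : ℂ) y).congr_of_eventuallyEq
          (hy.1.1.mono fun y' hy' => hy'.2.1)
      exact h3.unique h4
    apply hy.1.2.1
    have hsurj : Function.Surjective (((fderiv ℂ r y).restrictScalars ℝ : Cn n →L[ℝ] Cn n) :
        Cn n →ₗ[ℝ] Cn n) := by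
      have := (LinearMap.isUnit_iff_isUnit_det _).2 (isUnit_iff_ne_zero.2 hdet)
      exact ((Module.End.isUnit_iff _).1 this).2
    ext1 v
    obtain ⟨w, rfl⟩ := hsurj v
    exact DFunLike.congr_fun hz w

/-- Local form of the division of a transverse form by the conjugate differential of a defining
function. -/
theorem exists_local_division {f : Cn n → ℂ} {y₀ : Cn n} {W : Set (Cn n)} (hW : W ∈ 𝓝 y₀)
    (hf : ContDiffAt ℂ ω f y₀) (hf0 : f y₀ = 0) (hdf : fderiv ℂ f y₀ ≠ 0)
    {ξ : Cn n → Cn n [⋀^Fin (p + 1)]→L[ℝ] ℂ} (hξ : ContDiffOn ℝ ∞ ξ (W ∩ {y | f y = 0}))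
    (hξc : ∀ y ∈ W, f y = 0 → IsConjLin (ξ y))
    (hξt : ∀ y ∈ W, f y = 0 → ∀ v : Fin (p + 1) → Cn n, (∀ i, fderiv ℂ f y (v i) = 0) →
      ξ y v = 0) :
    ∃ β : Cn n → Cn n [⋀^Fin p]→L[ℝ] ℂ, ∀ᶠ y in 𝓝 y₀, ContDiffAt ℝ ∞ β y ∧ IsConjLin (β y) ∧
      (f y = 0 → dbarSymbol n p ((conjFunctional (fderiv ℂ f y)).smulRight (β y)) = ξ y) := by
  obtain ⟨r, hr0, hr⟩ := exists_holomorphic_retraction hf hf0 hdf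
  obtain ⟨a, ha⟩ : ∃ a, fderiv ℂ f y₀ a ≠ 0 := by
    by_contra! h; exact hdf (ContinuousLinearMap.ext h)
  have hcd : ∀ᶠ y in 𝓝 y₀, ContDiffAt ℂ ω f y := hf.eventually (by simp)
  have hda : ∀ᶠ y in 𝓝 y₀, fderiv ℂ f y a ≠ 0 :=
    (((hf.fderiv_right (m := 0) (by simp)).continuousAt).clm_apply
      continuousAt_const).eventually_ne ha
  have hrc : Filter.Tendsto r (𝓝 y₀) (𝓝 y₀) := by
    have := hr.self_of_nhds.1.continuousAt
    rwa [ContinuousAt, hr0] at this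
  have hcurry : ∀ y ∈ W, f y = 0 → ∀ c : ℂ, IsConjLin (c • (ξ y).curryLeft a) := by
    intro y hy hy0 c
    refine IsConjLin.smul (fun v i c => ?_) c
    have h := hξc y hy hy0 (Matrix.vecCons a v) i.succ c
    have h2 : Function.update (Matrix.vecCons a v) i.succ (c • v i) =
        Matrix.vecCons a (Function.update v i (c • v i)) := by
      simp [Matrix.vecCons]
    simp only [Matrix.cons_val_succ] at h
    rw [h2] at h
    exact h
  -- The quotient from the division lemma, evaluated at `r y`: `ξ` is smooth only along the zero
  -- set, and composing with `r` extends the quotient smoothly to a neighbourhood.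
  refine ⟨fun y => ((starRingEnd ℂ) (fderiv ℂ f (r y) a))⁻¹ • (ξ (r y)).curryLeft a, ?_⟩
  have hev := hr.and ((hrc.eventually (hcd.and (hda.and (Filter.eventually_mem_set.2 hW)))).and
    (Filter.eventually_mem_set.2 hW))
  filter_upwards [hev.eventually_nhds] with y hy
  obtain ⟨⟨hy1, hy2, hy3⟩, ⟨hy4, hy5, hy6⟩, hy7⟩ := hy.self_of_nhds
  refine ⟨?_, hcurry _ hy6 hy2 _, fun h0 => ?_⟩
  · have hrs : ContDiffAt ℝ ∞ r y := (hy1.restrict_scalars ℝ).of_le le_top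
    have h1 : ContDiffAt ℂ ω (fun y => fderiv ℂ f y a) (r y) :=
      (hy4.fderiv_right (m := ω) (by simp)).clm_apply contDiffAt_const
    have h2 : ContDiffAt ℝ ∞ (fun y => ((starRingEnd ℂ) (fderiv ℂ f (r y) a))⁻¹) y := by
      refine ContDiffAt.inv ?_ (by simpa using hy5)
      exact Complex.conjCLE.contDiff.contDiffAt.comp y
        (ContDiffAt.comp y ((h1.restrict_scalars ℝ).of_le le_top) hrs)
    refine h2.smul ?_
    have h3 : ContDiffAt ℝ ∞ (fun y => ξ (r y)) y := by
      rw [← contDiffWithinAt_univ]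
      obtain ⟨V, hV, hVo, hyV⟩ := eventually_nhds_iff.1 hy
      have := ContDiffOn.comp (s := V) (f := r) hξ
        (fun z hz => ((((hV z hz).1.1).restrict_scalars ℝ).of_le le_top).contDiffWithinAt)
        (fun z hz => ⟨(hV z hz).2.1.2.2, (hV z hz).1.2.1⟩)
      exact (this.contDiffAt (hVo.mem_nhds hyV)).contDiffWithinAt
    rw [← contDiffWithinAt_univ] at h3 ⊢
    exact contDiffWithinAt_form fun v =>
      (ContinuousAlternatingMap.apply ℝ (Cn n) ℂ
        (Matrix.vecCons a v)).contDiff.contDiffAt.comp_contDiffWithinAt y h3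
  · have hry := hy3 h0
    rw [hry]
    rw [hry] at hy5
    exact (hξc y hy7 h0).wedge_contract hy5 (hξt y hy7 h0)

end Retraction

/-! ### The underlying real manifold and partitions of unity -/

section RealStructure

variable {n : ℕ} {X : Type*} [TopologicalSpace X] [ChartedSpace (Cn n) X]
  [IsManifold 𝓘(ℂ, Cn n) ω X]

theorem isManifold_real : IsManifold 𝓘(ℝ, Cn n) ∞ X := by
  refine isManifold_of_contDiffOn _ _ _ fun e e' he he' => ?_
  have h : ContDiffOn ℂ ω (𝓘(ℂ, Cn n) ∘ (e.symm ≫ₕ e') ∘ 𝓘(ℂ, Cn n).symm)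
      (𝓘(ℂ, Cn n).symm ⁻¹' (e.symm ≫ₕ e').source ∩ range 𝓘(ℂ, Cn n)) :=
    (HasGroupoid.compatible (G := contDiffGroupoid ω 𝓘(ℂ, Cn n)) he he').1
  exact (h.restrict_scalars ℝ).of_le le_top

theorem exists_smooth_partition {X : Type u} [TopologicalSpace X] [ChartedSpace (Cn n) X]
    [IsManifold 𝓘(ℂ, Cn n) ω X] [T2Space X] [SecondCountableTopology X] {U : X → Set X}
    (hU : ∀ x, U x ∈ 𝓝 x) :
    ∃ (ι : Type u) (_ : Countable ι) (c : ι → X) (ψ : ι → X → ℝ),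
      (∀ i, ContMDiff 𝓘(ℝ, Cn n) 𝓘(ℝ, ℝ) ∞ (ψ i)) ∧ (∀ i x, 0 ≤ ψ i x) ∧
      (∀ x, ∑ᶠ i, ψ i x = 1) ∧ LocallyFinite (fun i => tsupport (ψ i)) ∧
      (∀ i, IsCompact (tsupport (ψ i))) ∧ ∀ i, tsupport (ψ i) ⊆ U (c i) := by
  have := isManifold_real (n := n) (X := X)
  have : LocallyCompactSpace X := ChartedSpace.locallyCompactSpace (Cn n) X
  have : SigmaCompactSpace X := inferInstance
  -- Starting from bump functions makes the supports of the partition compact.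
  obtain ⟨ι, fs, hfs⟩ := SmoothBumpCovering.exists_isSubordinate 𝓘(ℝ, Cn n) (isClosed_univ (X := X))
    fun x _ => hU x
  set P := fs.toSmoothPartitionOfUnity with hP
  -- Discarding the functions that vanish identically makes the index set countable: a locally
  -- finite family of nonempty sets in a σ-compact space is countable.
  let ι' := {i : ι // (Function.support (P i)).Nonempty}
  have hlf : LocallyFinite fun i : ι' => Function.support (P i) :=
    P.locallyFinite.comp_injective Subtype.val_injective
  refine ⟨ι', ?_, fun i => fs.c i, fun i => P i, fun i => (P i.1).contMDiff,
    fun i x => P.nonneg i.1 x, fun x => ?_, hlf.closure, fun i => ?_, fun i => ?_⟩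
  · exact Set.countable_univ_iff.1 (hlf.countable_univ fun i => i.2)
  · rw [← P.sum_eq_one (mem_univ x)]
    refine (finsum_subtype_eq_finsum_cond (f := fun i => P i x)
      (fun i => (Function.support (P i)).Nonempty)).trans (finsum_congr fun i => ?_)
    by_cases hi : (Function.support (P i)).Nonempty
    · simp [hi]
    · rw [not_nonempty_iff_eq_empty, Function.support_eq_empty_iff] at hi
      simp [hi]
  · exact (fs i.1).hasCompactSupport.of_isClosed_subset (isClosed_tsupport _)
      (closure_mono (fs.support_toSmoothPartitionOfUnity_subset i.1))
  · exact (closure_mono (fs.support_toSmoothPartitionOfUnity_subset i.1)).trans (hfs i.1)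

theorem contDiffAt_chart_of_contMDiff {F : Type*} [NormedAddCommGroup F] [NormedSpace ℝ F]
    {ψ : X → F} {x₀ x : X} (hx : x ∈ (chartAt (Cn n) x₀).source)
    (hψ : ContMDiffAt 𝓘(ℝ, Cn n) 𝓘(ℝ, F) ∞ ψ x) :
    ContDiffAt ℝ ∞ (fun y => ψ ((chartAt (Cn n) x₀).symm y)) (chartAt (Cn n) x₀ x) := by
  have := isManifold_real (n := n) (X := X)
  have hs : ContMDiffAt 𝓘(ℝ, Cn n) 𝓘(ℝ, Cn n) ∞ (chartAt (Cn n) x₀).symm (chartAt (Cn n) x₀ x) :=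
    (contMDiffOn_chart_symm (I := 𝓘(ℝ, Cn n)) (n := ∞)).contMDiffAt
      ((chartAt (Cn n) x₀).open_target.mem_nhds ((chartAt (Cn n) x₀).map_source hx))
  exact (ContMDiffAt.comp (g := ψ) _ (by rwa [(chartAt (Cn n) x₀).left_inv hx]) hs).contDiffAt

theorem contMDiffAt_of_contDiffAt_chart {F : Type*} [NormedAddCommGroup F] [NormedSpace ℝ F]
    {ψ : X → F} {x₀ x : X} (hx : x ∈ (chartAt (Cn n) x₀).source)
    (hψ : ContDiffAt ℝ ∞ (fun y => ψ ((chartAt (Cn n) x₀).symm y)) (chartAt (Cn n) x₀ x)) :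
    ContMDiffAt 𝓘(ℝ, Cn n) 𝓘(ℝ, F) ∞ ψ x := by
  have := isManifold_real (n := n) (X := X)
  have hs : ContMDiffAt 𝓘(ℝ, Cn n) 𝓘(ℝ, Cn n) ∞ (chartAt (Cn n) x₀) x :=
    (contMDiffOn_chart (I := 𝓘(ℝ, Cn n)) (n := ∞)).contMDiffAt
      ((chartAt (Cn n) x₀).open_source.mem_nhds hx)
  refine (hψ.contMDiffAt.comp x hs).congr_of_eventuallyEq ?_
  filter_upwards [(chartAt (Cn n) x₀).open_source.mem_nhds hx] with x' hx'
  simp [(chartAt (Cn n) x₀).left_inv hx']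

end RealStructure

/-! ### Coordinates of a holomorphic section and their derivatives -/

section Sections

variable {n : ℕ} {X : Type*} [TopologicalSpace X] [ChartedSpace (Cn n) X]
  [IsManifold 𝓘(ℂ, Cn n) ω X]
  {E : X → Type*} [TopologicalSpace (TotalSpace ℂ E)]
  [∀ x, AddCommGroup (E x)] [∀ x, Module ℂ (E x)] [∀ x, TopologicalSpace (E x)]
  [FiberBundle ℂ E] [VectorBundle ℂ ℂ E]

/-- The coordinate of a section in the trivialization around `x₀`. -/
def sectionCoord (f : ∀ x, E x) (x₀ x : X) : ℂ :=
  (trivializationAt ℂ E x₀).continuousLinearMapAt ℂ x (f x)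

/-- The coordinate of a section in the chart and the trivialization around `x₀`. -/
def sectionRep (n : ℕ) {X : Type*} [TopologicalSpace X] [ChartedSpace (Cn n) X]
    {E : X → Type*} [TopologicalSpace (TotalSpace ℂ E)]
    [∀ x, AddCommGroup (E x)] [∀ x, Module ℂ (E x)] [∀ x, TopologicalSpace (E x)]
    [FiberBundle ℂ E] [VectorBundle ℂ ℂ E] (f : ∀ x, E x) (x₀ : X) (y : Cn n) : ℂ :=
  sectionCoord f x₀ ((chartAt (Cn n) x₀).symm y)

theorem sectionRep_chart (f : ∀ x, E x) {x₀ x : X} (hx : x ∈ (chartAt (Cn n) x₀).source) :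
    sectionRep n f x₀ (chartAt (Cn n) x₀ x) = sectionCoord f x₀ x := by
  rw [sectionRep, (chartAt (Cn n) x₀).left_inv hx]

theorem sectionCoord_eq (f : ∀ x, E x) {x₀ x : X} (hx : x ∈ (trivializationAt ℂ E x₀).baseSet) :
    sectionCoord f x₀ x = (trivializationAt ℂ E x₀ ⟨x, f x⟩).2 := by
  rw [sectionCoord, Trivialization.continuousLinearMapAt_apply, Trivialization.linearMapAt_apply,
    if_pos hx]

theorem sectionCoord_eq_zero_iff (f : ∀ x, E x) {x₀ x : X}
    (hx : x ∈ (trivializationAt ℂ E x₀).baseSet) : sectionCoord f x₀ x = 0 ↔ f x = 0 := by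
  refine ⟨fun h => ?_, fun h => by rw [sectionCoord, h, map_zero]⟩
  rw [← (trivializationAt ℂ E x₀).symmL_continuousLinearMapAt (R := ℂ) hx (f x)]
  change (trivializationAt ℂ E x₀).symmL ℂ x (sectionCoord f x₀ x) = 0
  rw [h, map_zero]

theorem frameChange_ne_zero {x₀ x₁ x : X} (h0 : x ∈ (trivializationAt ℂ E x₀).baseSet)
    (h1 : x ∈ (trivializationAt ℂ E x₁).baseSet) : frameChange E x₀ x₁ x ≠ 0 := fun h => by
  have h2 := frameChange_mul (x₁ := x₁) h0 ((trivializationAt ℂ E x₁).symmL ℂ x 1)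
  rw [h, zero_mul, (trivializationAt ℂ E x₁).continuousLinearMapAt_symmL h1] at h2
  exact one_ne_zero h2

theorem contDiffAt_sectionRep [ContMDiffVectorBundle ω ℂ E 𝓘(ℂ, Cn n)] {f : ∀ x, E x}
    (hf : ContMDiff 𝓘(ℂ, Cn n) (𝓘(ℂ, Cn n).prod 𝓘(ℂ, ℂ)) ω (fun x => TotalSpace.mk' ℂ x (f x)))
    {x₀ x : X} (hx : x ∈ frameDomain n E x₀) :
    ContDiffAt ℂ ω (sectionRep n f x₀) (chartAt (Cn n) x₀ x) := by
  have h1 : ContMDiffAt 𝓘(ℂ, Cn n) 𝓘(ℂ, ℂ) ω (fun x => (trivializationAt ℂ E x₀ ⟨x, f x⟩).2) x :=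
    ((trivializationAt ℂ E x₀).contMDiffAt_section_iff hx.2).1 (hf x)
  have hs : ContMDiffAt 𝓘(ℂ, Cn n) 𝓘(ℂ, Cn n) ω (chartAt (Cn n) x₀).symm (chartAt (Cn n) x₀ x) :=
    (contMDiffOn_chart_symm (I := 𝓘(ℂ, Cn n)) (n := ω)).contMDiffAt
      ((chartAt (Cn n) x₀).open_target.mem_nhds ((chartAt (Cn n) x₀).map_source hx.1))
  have h2 := (ContMDiffAt.comp (g := fun x => (trivializationAt ℂ E x₀ ⟨x, f x⟩).2) _
    (by rwa [(chartAt (Cn n) x₀).left_inv hx.1]) hs).contDiffAt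
  refine h2.congr_of_eventuallyEq ?_
  filter_upwards [eventually_mem_chart hx.1 ((isOpen_frameDomain x₀).mem_nhds hx)] with y hy
  rw [sectionRep, sectionCoord_eq f hy.2.2]; rfl

theorem sectionDeriv_eq [ContMDiffVectorBundle ω ℂ E 𝓘(ℂ, Cn n)] {f : ∀ x, E x}
    (hf : ContMDiff 𝓘(ℂ, Cn n) (𝓘(ℂ, Cn n).prod 𝓘(ℂ, ℂ)) ω (fun x => TotalSpace.mk' ℂ x (f x)))
    (x : X) : sectionDeriv n f x = fderiv ℂ (sectionRep n f x) (chartAt (Cn n) x x) := by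
  have hx := mem_frameDomain_self (n := n) (L := E) x
  have h1 : ContMDiffAt 𝓘(ℂ, Cn n) 𝓘(ℂ, ℂ) ω (fun x' => (trivializationAt ℂ E x ⟨x', f x'⟩).2) x :=
    ((trivializationAt ℂ E x).contMDiffAt_section_iff hx.2).1 (hf x)
  rw [sectionDeriv, (h1.mdifferentiableAt (by simp)).mfderiv]
  simp only [modelWithCornersSelf_coe, range_id, fderivWithin_univ]
  refine Filter.EventuallyEq.fderiv_eq ?_
  filter_upwards [eventually_mem_chart hx.1 ((isOpen_frameDomain x).mem_nhds hx)] with y hy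
  rw [sectionRep, sectionCoord_eq f hy.2.2]; rfl

/-- Changing the frame multiplies the coordinate by a holomorphic function. At a zero of `f` the
derivative of this factor does not contribute, so the derivatives differ only by the value of the
factor and the chart change. This carries transversality, stated in the frame at each point, to a
fixed frame. -/
theorem fderiv_sectionRep [ContMDiffVectorBundle ω ℂ E 𝓘(ℂ, Cn n)] {f : ∀ x, E x}
    (hf : ContMDiff 𝓘(ℂ, Cn n) (𝓘(ℂ, Cn n).prod 𝓘(ℂ, ℂ)) ω (fun x => TotalSpace.mk' ℂ x (f x)))
    {x₀ x : X} (h0 : x ∈ frameDomain n E x₀) (hfx : f x = 0) (v : Cn n) :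
    fderiv ℂ (sectionRep n f x₀) (chartAt (Cn n) x₀ x) v = frameChange E x x₀ x *
      sectionDeriv n f x
        ((trivializationAt (Cn n) (TangentSpace 𝓘(ℂ, Cn n) : X → Type _) x₀).symmL ℂ x v) := by
  have hx := mem_frameDomain_self (n := n) (L := E) x
  have hev : sectionRep n f x₀ =ᶠ[𝓝 (chartAt (Cn n) x₀ x)] fun y =>
      frameChange E x x₀ ((chartAt (Cn n) x₀).symm y) •
        sectionRep n f x (transition n x x₀ y) := by
    filter_upwards [eventually_mem_chart h0.1 ((isOpen_frameDomain x).mem_nhds hx)] with y hy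
    rw [transition, Function.comp_apply, sectionRep_chart _ hy.2.1, sectionRep, sectionCoord,
      frameChange_mul hy.2.2]
    rfl
  have hT := (contDiffAt_transition hx.1 h0.1).differentiableAt (by simp)
  have hTx : transition n x x₀ (chartAt (Cn n) x₀ x) = chartAt (Cn n) x x := by
    rw [transition, Function.comp_apply, (chartAt (Cn n) x₀).left_inv h0.1]
  have hc := (contDiffAt_frameChange hx.2 h0.2 h0.1).differentiableAt (by simp)
  have hs : DifferentiableAt ℂ (sectionRep n f x) (transition n x x₀ (chartAt (Cn n) x₀ x)) := by
    rw [hTx]; exact (contDiffAt_sectionRep hf hx).differentiableAt (by simp)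
  have hz : sectionRep n f x (chartAt (Cn n) x x) = 0 := by
    rw [sectionRep_chart _ hx.1, sectionCoord, hfx, map_zero]
  have hd := hc.hasFDerivAt.smul (hs.hasFDerivAt.comp _ hT.hasFDerivAt)
  have hd' : HasFDerivAt (fun y => frameChange E x x₀ ((chartAt (Cn n) x₀).symm y) •
      sectionRep n f x (transition n x x₀ y)) _ (chartAt (Cn n) x₀ x) := hd
  rw [hev.fderiv_eq, hd'.fderiv, sectionDeriv_eq hf, ← tangent_transition hx.1 h0.1]
  -- The tangent trivialization around `x` is the identity at `x` itself.
  have hid : ∀ w : Cn n, (trivializationAt (Cn n) (TangentSpace 𝓘(ℂ, Cn n) : X → Type _)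
      x).continuousLinearMapAt ℂ x w = w := fun w => by
    rw [TangentBundle.continuousLinearMapAt_trivializationAt_eq_core hx.1]
    exact (tangentBundleCore 𝓘(ℂ, Cn n) X).coordChange_self (achart _ x) x
      (mem_chart_source _ x) w
  simp only [Function.comp_apply, hTx, hz, _root_.add_apply, _root_.smul_apply,
    ContinuousLinearMap.comp_apply, ContinuousLinearMap.smulRight_apply,
    (chartAt (Cn n) x₀).left_inv h0.1, smul_eq_mul]
  rw [mul_zero, add_zero]
  exact congrArg (fun w : Cn n => frameChange E x x₀ x *
    fderiv ℂ (sectionRep n f x) (chartAt (Cn n) x x) w) (hid _)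

end Sections

/-! ### Sums and multiples of forms, and locality of `∂̄` -/

section FormAlgebra

variable {n q : ℕ} {X : Type*} [TopologicalSpace X] [ChartedSpace (Cn n) X]
  [IsManifold 𝓘(ℂ, Cn n) ω X]
  {L : X → Type*} [TopologicalSpace (TotalSpace ℂ L)]
  [∀ x, AddCommGroup (L x)] [∀ x, Module ℂ (L x)] [∀ x, TopologicalSpace (L x)]
  [∀ x, IsTopologicalAddGroup (L x)] [∀ x, ContinuousSMul ℂ (L x)]
  [FiberBundle ℂ L] [VectorBundle ℂ ℂ L]

theorem IsType0q.zero {x : X} : IsType0q (0 : FormAt n L q x) := fun _ _ _ => by simp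

theorem IsType0q.add {x : X} {η θ : FormAt n L q x} (hη : IsType0q η) (hθ : IsType0q θ) :
    IsType0q (η + θ) := fun v i c => by
  simp only [ContinuousAlternatingMap.add_apply, hη v i c, hθ v i c, smul_add]

theorem IsType0q.smul {x : X} {η : FormAt n L q x} (hη : IsType0q η) (a : ℂ) :
    IsType0q (a • η) := fun v i c => by
  simp only [ContinuousAlternatingMap.smul_apply, hη v i c, smul_comm a]

theorem IsType0q.sum {ι : Type*} {s : Finset ι} {x : X} {η : ι → FormAt n L q x}
    (hη : ∀ i ∈ s, IsType0q (η i)) : IsType0q (∑ i ∈ s, η i) := fun v i c => by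
  simp only [ContinuousAlternatingMap.sum_apply, Finset.smul_sum]
  exact Finset.sum_congr rfl fun j hj => hη j hj v i c

theorem formRep_zero (x₀ x : X) : formRep x₀ x (0 : FormAt n L q x) = 0 := by
  ext v
  exact map_zero ((trivializationAt ℂ L x₀).continuousLinearMapAt ℂ x)

theorem formRep_smul (x₀ x : X) (a : ℂ) (η : FormAt n L q x) :
    formRep x₀ x (a • η) = a • formRep x₀ x η := by
  ext v
  simp only [formRep_apply, ContinuousAlternatingMap.smul_apply, map_smul]

theorem formRep_sum {ι : Type*} (s : Finset ι) (x₀ x : X) (η : ι → FormAt n L q x) :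
    formRep x₀ x (∑ i ∈ s, η i) = ∑ i ∈ s, formRep x₀ x (η i) := by
  ext v
  simp only [formRep_apply, ContinuousAlternatingMap.sum_apply, map_sum]

theorem formRep_injective {x₀ x : X} (hx : x ∈ frameDomain n L x₀) :
    Function.Injective (fun η : FormAt n L q x => formRep x₀ x η) :=
  Function.LeftInverse.injective (g := formOfRep L x₀ x) (formOfRep_formRep hx)

theorem localRep_congr {u u' : ∀ x, FormAt n L q x} {x₀ x : X}
    (hx : x ∈ (chartAt (Cn n) x₀).source) (h : ∀ᶠ x' in 𝓝 x, u x' = u' x') :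
    localRep u x₀ =ᶠ[𝓝 (chartAt (Cn n) x₀ x)] localRep u' x₀ := by
  filter_upwards [eventually_mem_chart hx h] with y hy
  rw [localRep_eq, localRep_eq, hy.2]

theorem SmoothFormAt.congr {u u' : ∀ x, FormAt n L q x} {x : X} (hu : SmoothFormAt u x)
    (h : ∀ᶠ x' in 𝓝 x, u' x' = u x') : SmoothFormAt u' x :=
  ContDiffAt.congr_of_eventuallyEq hu (localRep_congr (mem_chart_source _ x) h)

theorem dbar_congr {u u' : ∀ x, FormAt n L q x} {x : X} (h : ∀ᶠ x' in 𝓝 x, u x' = u' x') :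
    dbar u x = dbar u' x := by
  rw [dbar_eq, dbar_eq, flatDbar_congr (localRep_congr (mem_chart_source _ x) h)]

theorem SmoothFormAt.zero (x : X) : SmoothFormAt (fun x => (0 : FormAt n L q x)) x :=
  (contDiffAt_const (c := (0 : Cn n [⋀^Fin q]→L[ℝ] ℂ))).congr_of_eventuallyEq
    (.of_forall fun _ => formRep_zero _ _)

theorem SmoothFormAt.sum {ι : Type*} {s : Finset ι} {u : ι → ∀ x, FormAt n L q x} {x : X}
    (hu : ∀ i ∈ s, SmoothFormAt (u i) x) : SmoothFormAt (fun x => ∑ i ∈ s, u i x) x :=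
  (ContDiffAt.sum hu).congr_of_eventuallyEq (.of_forall fun _ => formRep_sum s _ _ _)

theorem SmoothFormAt.smul {u : ∀ x, FormAt n L q x} {x : X} (hu : SmoothFormAt u x) {a : X → ℂ}
    (ha : ContMDiffAt 𝓘(ℝ, Cn n) 𝓘(ℝ, ℂ) ∞ a x) : SmoothFormAt (fun x => a x • u x) x :=
  ((contDiffAt_chart_of_contMDiff (mem_chart_source _ x) ha).smul hu).congr_of_eventuallyEq
    (.of_forall fun _ => formRep_smul _ _ _ _)

theorem dbar_sum {ι : Type*} {s : Finset ι} {u : ι → ∀ x, FormAt n L q x} {x : X}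
    (hu : ∀ i ∈ s, SmoothFormAt (u i) x) :
    dbar (fun x => ∑ i ∈ s, u i x) x = ∑ i ∈ s, dbar (u i) x := by
  apply formRep_injective (mem_frameDomain_self x)
  change formRep x x _ = formRep x x _
  rw [formRep_sum, dbar_eq, formRep_formOfRep (mem_frameDomain_self x)]
  have h1 : localRep (fun x => ∑ i ∈ s, u i x) x = fun y => ∑ i ∈ s, localRep (u i) x y :=
    funext fun y => formRep_sum s _ _ _
  have h2 : fderiv ℝ (fun y => ∑ i ∈ s, localRep (u i) x y) (chartAt (Cn n) x x) =
      ∑ i ∈ s, fderiv ℝ (localRep (u i) x) (chartAt (Cn n) x x) :=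
    fderiv_fun_sum fun i hi => (hu i hi).differentiableAt (by simp)
  rw [h1, flatDbar_eq, h2, map_sum]
  refine Finset.sum_congr rfl fun i _ => ?_
  rw [dbar_eq, formRep_formOfRep (mem_frameDomain_self x), flatDbar_eq]

end FormAlgebra

/-! ### Global division of a transverse form by the conjugate of `df` -/

section TwistedForm

variable {n p : ℕ} {X : Type*} [TopologicalSpace X] [ChartedSpace (Cn n) X]
  [IsManifold 𝓘(ℂ, Cn n) ω X]
  {L : X → Type*} [TopologicalSpace (TotalSpace ℂ L)]
  [∀ x, AddCommGroup (L x)] [∀ x, Module ℂ (L x)] [∀ x, TopologicalSpace (L x)]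
  [∀ x, IsTopologicalAddGroup (L x)] [∀ x, ContinuousSMul ℂ (L x)]
  [FiberBundle ℂ L] [VectorBundle ℂ ℂ L] [ContMDiffVectorBundle ω ℂ L 𝓘(ℂ, Cn n)]
  {E : X → Type*} [TopologicalSpace (TotalSpace ℂ E)]
  [∀ x, AddCommGroup (E x)] [∀ x, Module ℂ (E x)] [∀ x, TopologicalSpace (E x)]
  [FiberBundle ℂ E] [VectorBundle ℂ ℂ E] [ContMDiffVectorBundle ω ℂ E 𝓘(ℂ, Cn n)]

theorem contMDiffAt_complex_mul {a b : X → ℂ} {x : X} (ha : ContMDiffAt 𝓘(ℝ, Cn n) 𝓘(ℝ, ℂ) ∞ a x)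
    (hb : ContMDiffAt 𝓘(ℝ, Cn n) 𝓘(ℝ, ℂ) ∞ b x) :
    ContMDiffAt 𝓘(ℝ, Cn n) 𝓘(ℝ, ℂ) ∞ (fun x => a x * b x) x :=
  contMDiffAt_of_contDiffAt_chart (mem_chart_source _ x)
    ((contDiffAt_chart_of_contMDiff (mem_chart_source _ x) ha).mul
      (contDiffAt_chart_of_contMDiff (mem_chart_source _ x) hb))

theorem eventually_localRep_formOfRep {q : ℕ} (b : Cn n → Cn n [⋀^Fin q]→L[ℝ] ℂ) {c x : X}
    (hx : x ∈ frameDomain n L c) :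
    localRep (fun x => formOfRep L c x (b (chartAt (Cn n) c x))) c =ᶠ[𝓝 (chartAt (Cn n) c x)] b := by
  filter_upwards [eventually_mem_chart hx.1 ((isOpen_frameDomain c).mem_nhds hx)] with y hy
  rw [localRep_eq, formRep_formOfRep hy.2, (chartAt (Cn n) c).right_inv hy.1]

theorem smoothFormAt_formOfRep {q : ℕ} {b : Cn n → Cn n [⋀^Fin q]→L[ℝ] ℂ} {c x : X}
    (hx : x ∈ frameDomain n L c) (hb : ContDiffAt ℝ ∞ b (chartAt (Cn n) c x)) :
    SmoothFormAt (fun x => formOfRep L c x (b (chartAt (Cn n) c x))) x :=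
  (smoothFormAt_iff hx).2 (hb.congr_of_eventuallyEq (eventually_localRep_formOfRep b hx))

/-- Off `Z` the zero form works, since `f` stays nonzero nearby and the equation along `Z` is then
empty. At a point of `Z` this is the local division, with transversality transported to the fixed
frame. -/
theorem exists_local_form {Z : Set X} {f : ∀ x, E x} (hf : IsDefiningSection n f Z)
    {ξ : ∀ x, FormAt n L (p + 1) x} (hξ_type : ∀ z ∈ Z, IsType0q (ξ z))
    (hξ_smooth : SmoothFormOn ξ Z) (hξ_transverse : IsTransverse f Z ξ) (x₀ : X) :
    ∃ β : Cn n → Cn n [⋀^Fin p]→L[ℝ] ℂ, ∀ᶠ x in 𝓝 x₀, x ∈ frameDomain n L x₀ ∧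
      x ∈ frameDomain n E x₀ ∧ ContDiffAt ℝ ∞ β (chartAt (Cn n) x₀ x) ∧
      IsConjLin (β (chartAt (Cn n) x₀ x)) ∧
      (x ∈ Z → dbarSymbol n p ((conjFunctional (fderiv ℂ (sectionRep n f x₀)
        (chartAt (Cn n) x₀ x))).smulRight (β (chartAt (Cn n) x₀ x))) = formRep x₀ x (ξ x)) := by
  have hL := (isOpen_frameDomain (n := n) (L := L) x₀).mem_nhds (mem_frameDomain_self x₀)
  have hE := (isOpen_frameDomain (n := n) (L := E) x₀).mem_nhds (mem_frameDomain_self x₀)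
  have hx₀ := mem_chart_source (Cn n) x₀
  have hZ : ∀ x, x ∈ Z ↔ f x = 0 := fun x => by rw [hf.zero_set]; rfl
  by_cases hz : x₀ ∈ Z
  swap
  · have hs0 : sectionRep n f x₀ (chartAt (Cn n) x₀ x₀) ≠ 0 := by
      rw [sectionRep_chart f hx₀, Ne,
        sectionCoord_eq_zero_iff f (mem_frameDomain_self (n := n) (L := E) x₀).2, ← hZ]
      exact hz
    have hc : ContinuousAt (fun x => sectionRep n f x₀ (chartAt (Cn n) x₀ x)) x₀ :=
      ContinuousAt.comp (g := sectionRep n f x₀) (f := chartAt (Cn n) x₀) (contDiffAt_sectionRep hf.holomorphic (mem_frameDomain_self x₀)).continuousAt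
        ((chartAt (Cn n) x₀).continuousAt hx₀)
    refine ⟨fun _ => 0, ?_⟩
    filter_upwards [hL, hE, hc.eventually_ne hs0] with x hxL hxE hne
    refine ⟨hxL, hxE, contDiffAt_const, IsConjLin.zero, fun hxZ => absurd ?_ hne⟩
    rw [sectionRep_chart f hxL.1, sectionCoord, (hZ x).1 hxZ, map_zero]
  · let W : Set (Cn n) := {y | y ∈ (chartAt (Cn n) x₀).target ∧
      (chartAt (Cn n) x₀).symm y ∈ frameDomain n L x₀ ∩ frameDomain n E x₀}
    have hW : W ∈ 𝓝 (chartAt (Cn n) x₀ x₀) := eventually_mem_chart hx₀ (Filter.inter_mem hL hE)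
    have hWZ : ∀ y ∈ W, sectionRep n f x₀ y = 0 → (chartAt (Cn n) x₀).symm y ∈ Z := fun y hy h => by
      rw [hZ, ← sectionCoord_eq_zero_iff f hy.2.2.2]; exact h
    have hdf : fderiv ℂ (sectionRep n f x₀) (chartAt (Cn n) x₀ x₀) ≠ 0 := by
      have := hf.deriv_ne_zero x₀ hz
      rw [sectionDeriv_eq hf.holomorphic] at this
      exact this
    have hf0 : sectionRep n f x₀ (chartAt (Cn n) x₀ x₀) = 0 := by
      rw [sectionRep_chart f hx₀, sectionCoord, (hZ x₀).1 hz, map_zero]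
    obtain ⟨β, hβ⟩ := exists_local_division (ξ := localRep ξ x₀) hW
      (contDiffAt_sectionRep hf.holomorphic (mem_frameDomain_self x₀)) hf0 hdf
      ((hξ_smooth x₀).mono fun y hy => ⟨hy.1.1, hy.1.2.1.2, hWZ y hy.1 hy.2⟩)
      (fun y hy h => isConjLin_formRep (hξ_type _ (hWZ y hy h)))
      (fun y hy h v hv => by
        rw [localRep_eq, formRep_apply, hξ_transverse _ (hWZ y hy h) _ fun i => ?_, map_zero]
        have h1 := hv i
        have hyx := (chartAt (Cn n) x₀).right_inv hy.1
        rw [← hyx, fderiv_sectionRep hf.holomorphic hy.2.2 ((hZ _).1 (hWZ y hy h))] at h1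
        exact (mul_eq_zero.1 h1).resolve_left
          (frameChange_ne_zero (FiberBundle.mem_baseSet_trivializationAt' _) hy.2.2.2))
    refine ⟨β, ?_⟩
    filter_upwards [hL, hE, ((chartAt (Cn n) x₀).continuousAt hx₀).eventually hβ] with x hxL hxE hx
    refine ⟨hxL, hxE, hx.1, hx.2.1, fun hxZ => ?_⟩
    rw [hx.2.2 (by rw [sectionRep_chart f hxL.1, sectionCoord, (hZ x).1 hxZ, map_zero]),
      localRep_chart ξ hxL.1]

/-- By conjugate-linearity in the fibre of `E`, the conjugate of the coordinate of `f` comes out as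
a factor; in this sense `α x (f x)` is `f̄ α`. -/
theorem IsSmoothTwistedForm.apply_section {α : ∀ x, E x → FormAt n L p x}
    (hα : IsSmoothTwistedForm α) (f : ∀ x, E x) {x₀ x : X}
    (hx : x ∈ (trivializationAt ℂ E x₀).baseSet) :
    α x (f x) = (starRingEnd ℂ) (sectionCoord f x₀ x) •
      α x ((trivializationAt ℂ E x₀).symm x 1) := by
  have h : f x = sectionCoord f x₀ x • (trivializationAt ℂ E x₀).symm x 1 := by
    rw [← (trivializationAt ℂ E x₀).symmL_apply (R := ℂ) hx, ← map_smul, smul_eq_mul, mul_one]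
    exact ((trivializationAt ℂ E x₀).symmL_continuousLinearMapAt hx (f x)).symm
  ext v
  conv_lhs => rw [h]
  exact hα.smul _ _ _ _

theorem contMDiffAt_conj_sectionCoord {f : ∀ x, E x}
    (hf : ContMDiff 𝓘(ℂ, Cn n) (𝓘(ℂ, Cn n).prod 𝓘(ℂ, ℂ)) ω (fun x => TotalSpace.mk' ℂ x (f x)))
    {x₀ x : X} (hx : x ∈ frameDomain n E x₀) :
    ContMDiffAt 𝓘(ℝ, Cn n) 𝓘(ℝ, ℂ) ∞ (fun x => (starRingEnd ℂ) (sectionCoord f x₀ x)) x :=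
  contMDiffAt_of_contDiffAt_chart hx.1 (Complex.conjCLE.contDiff.contDiffAt.comp _
    (((contDiffAt_sectionRep hf hx).restrict_scalars ℝ).of_le le_top))

theorem IsSmoothTwistedForm.smoothFormAt {α : ∀ x, E x → FormAt n L p x}
    (hα : IsSmoothTwistedForm α) {x₀ x : X} (hx : x ∈ (trivializationAt ℂ E x₀).baseSet) :
    SmoothFormAt (fun x => α x ((trivializationAt ℂ E x₀).symm x 1)) x :=
  (hα.smooth x₀).smoothFormAt ((trivializationAt ℂ E x₀).open_baseSet.mem_nhds hx)

theorem IsSmoothTwistedForm.smoothFormAt_section {α : ∀ x, E x → FormAt n L p x}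
    (hα : IsSmoothTwistedForm α) {f : ∀ x, E x}
    (hf : ContMDiff 𝓘(ℂ, Cn n) (𝓘(ℂ, Cn n).prod 𝓘(ℂ, ℂ)) ω (fun x => TotalSpace.mk' ℂ x (f x)))
    (x : X) : SmoothFormAt (fun x => α x (f x)) x := by
  have hx := mem_frameDomain_self (n := n) (L := E) x
  refine ((hα.smoothFormAt hx.2).smul (contMDiffAt_conj_sectionCoord hf hx)).congr ?_
  filter_upwards [(trivializationAt ℂ E x).open_baseSet.mem_nhds hx.2] with x' hx'
  exact hα.apply_section f hx'

/-- A form that is transverse to `Z` is the value along `Z` of `∂̄ (f̄ α)` for a global smooth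
twisted form `α`. -/
theorem exists_twisted_form {X : Type u} [TopologicalSpace X] [ChartedSpace (Cn n) X]
    [IsManifold 𝓘(ℂ, Cn n) ω X] [T2Space X] [SecondCountableTopology X]
    {L : X → Type*} [TopologicalSpace (TotalSpace ℂ L)]
    [∀ x, AddCommGroup (L x)] [∀ x, Module ℂ (L x)] [∀ x, TopologicalSpace (L x)]
    [∀ x, IsTopologicalAddGroup (L x)] [∀ x, ContinuousSMul ℂ (L x)]
    [FiberBundle ℂ L] [VectorBundle ℂ ℂ L] [ContMDiffVectorBundle ω ℂ L 𝓘(ℂ, Cn n)]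
    {E : X → Type*} [TopologicalSpace (TotalSpace ℂ E)]
    [∀ x, AddCommGroup (E x)] [∀ x, Module ℂ (E x)] [∀ x, TopologicalSpace (E x)]
    [FiberBundle ℂ E] [VectorBundle ℂ ℂ E] [ContMDiffVectorBundle ω ℂ E 𝓘(ℂ, Cn n)]
    {Z : Set X} {f : ∀ x, E x} (hf : IsDefiningSection n f Z)
    {ξ : ∀ x, FormAt n L (p + 1) x} (hξ_type : ∀ z ∈ Z, IsType0q (ξ z))
    (hξ_smooth : SmoothFormOn ξ Z) (hξ_transverse : IsTransverse f Z ξ) :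
    ∃ α : ∀ x, E x → FormAt n L p x, IsSmoothTwistedForm α ∧
      ∀ z ∈ Z, dbar (fun x => α x (f x)) z = ξ z := by
  choose β hβ using exists_local_form hf hξ_type hξ_smooth hξ_transverse
  let U : X → Set X := fun c => interior {x | x ∈ frameDomain n L c ∧
      x ∈ frameDomain n E c ∧ ContDiffAt ℝ ∞ (β c) (chartAt (Cn n) c x) ∧
      IsConjLin (β c (chartAt (Cn n) c x)) ∧
      (x ∈ Z → dbarSymbol n p ((conjFunctional (fderiv ℂ (sectionRep n f c)
        (chartAt (Cn n) c x))).smulRight (β c (chartAt (Cn n) c x))) = formRep c x (ξ x))}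
  have hU : ∀ c, U c ∈ 𝓝 c := fun c => interior_mem_nhds.2 (hβ c)
  obtain ⟨ι, -, c, ψ, hψs, hψ0, hψ1, hlf, -, hsub⟩ := exists_smooth_partition (n := n) hU
  have hgood := fun i x (hx : x ∈ tsupport (ψ i)) => interior_subset (hsub i hx)
  let B : ∀ i x, FormAt n L p x := fun i x => formOfRep L (c i) x (β (c i) (chartAt (Cn n) (c i) x))
  -- The local piece `ψᵢ s̄ βᵢ`. The factor `ψᵢ` makes it `0` at points where the local form has no
  -- meaning.
  let t : ι → ∀ x, E x → FormAt n L p x := fun i x s =>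
    ((ψ i x : ℂ) * (starRingEnd ℂ) ((trivializationAt ℂ E (c i)).continuousLinearMapAt ℂ x s)) • B i x
  have ht0 : ∀ i x s, x ∉ tsupport (ψ i) → t i x s = 0 := fun i x s hx => by
    simp only [t, image_eq_zero_of_notMem_tsupport hx, Complex.ofReal_zero, zero_mul, zero_smul]
  -- the finitely many indices that matter near a point
  have hfin : ∀ x, ∃ F : Finset ι, (∀ᶠ x' in 𝓝 x, ∀ i, x' ∈ tsupport (ψ i) → i ∈ F) := fun x => by
    obtain ⟨V, hV, hVf⟩ := hlf x
    refine ⟨hVf.toFinset, ?_⟩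
    filter_upwards [hV] with x' hx' i hi
    exact hVf.mem_toFinset.2 ⟨x', hi, hx'⟩
  let α : ∀ x, E x → FormAt n L p x := fun x s => ∑ᶠ i, t i x s
  have hαF : ∀ (F : Finset ι) x, (∀ i, x ∈ tsupport (ψ i) → i ∈ F) →
      ∀ s, α x s = ∑ i ∈ F, t i x s := fun F x hF s =>
    finsum_eq_sum_of_support_subset _ fun i hi => hF i (by
      by_contra h; exact hi (ht0 i x s h))
  -- Stated for arbitrary sections `g` because it serves twice: for the local frames of `E`, which
  -- test the smoothness of `α`, and for `f` itself.
  have hts : ∀ (g : ∀ x, E x) (i : ι) (x : X), (x ∈ tsupport (ψ i) → ContMDiffAt 𝓘(ℝ, Cn n) 𝓘(ℝ, ℂ)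
      ∞ (fun x => (starRingEnd ℂ) (sectionCoord g (c i) x)) x) →
      SmoothFormAt (fun x => t i x (g x)) x := fun g i x hg => by
    by_cases hx : x ∈ tsupport (ψ i)
    · obtain ⟨h1, h2, h3, -, -⟩ := hgood i x hx
      refine SmoothFormAt.smul (smoothFormAt_formOfRep h1 h3) ?_
      exact contMDiffAt_complex_mul
        ((Complex.ofRealCLM.contDiff.contMDiff.contMDiffAt).comp x (hψs i x)) (hg hx)
    · refine (SmoothFormAt.zero x).congr ?_
      filter_upwards [(isClosed_tsupport (ψ i)).isOpen_compl.mem_nhds hx] with x' hx'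
      exact ht0 i x' _ hx'
  have htt : ∀ i x s, IsType0q (t i x s) := fun i x s => by
    by_cases hx : x ∈ tsupport (ψ i)
    · exact (isType0q_formOfRep (hgood i x hx).2.2.2.1).smul _
    · rw [ht0 i x s hx]; exact IsType0q.zero
  have hα : IsSmoothTwistedForm α := by
    refine ⟨fun x s s' v => ?_, fun x a s v => ?_, fun x s => ?_, fun x₀ => ?_⟩
    · obtain ⟨F, hF⟩ := hfin x
      simp only [hαF F x hF.self_of_nhds, ContinuousAlternatingMap.sum_apply,
        ← Finset.sum_add_distrib]
      refine Finset.sum_congr rfl fun i _ => ?_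
      simp only [t, map_add, mul_add, add_smul, ContinuousAlternatingMap.add_apply]
    · obtain ⟨F, hF⟩ := hfin x
      simp only [hαF F x hF.self_of_nhds, ContinuousAlternatingMap.sum_apply, Finset.smul_sum]
      refine Finset.sum_congr rfl fun i _ => ?_
      simp only [t, map_smul, smul_eq_mul, map_mul, ContinuousAlternatingMap.smul_apply, smul_smul]
      congr 1; ring
    · obtain ⟨F, hF⟩ := hfin x
      rw [hαF F x hF.self_of_nhds]
      exact IsType0q.sum fun i _ => htt i x s
    · refine smoothFormOn_of_smoothFormAt fun x hx => ?_
      obtain ⟨F, hF⟩ := hfin x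
      refine SmoothFormAt.congr (u := fun x => ∑ i ∈ F, t i x ((trivializationAt ℂ E x₀).symm x 1))
        (SmoothFormAt.sum fun i _ => hts _ i x fun hi => ?_)
        (hF.mono fun x' hx' => hαF F x' hx' _)
      have hxi := (hgood i x hi).2.1
      have h := contDiffAt_frameChange hx hxi.2 hxi.1
      refine contMDiffAt_of_contDiffAt_chart hxi.1 (Complex.conjCLE.contDiff.contDiffAt.comp _
        (ContDiffAt.congr_of_eventuallyEq ((h.restrict_scalars ℝ).of_le le_top) ?_))
      filter_upwards [eventually_mem_chart hxi.1 ((trivializationAt ℂ E x₀).open_baseSet.mem_nhds hx)]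
        with y hy
      rw [sectionCoord, frameChange, Trivialization.symmL_apply _ hy.2]
  refine ⟨α, hα, fun z hz => ?_⟩
  obtain ⟨F, hF⟩ := hfin z
  have hfs := fun i => hts f i z fun hi => contMDiffAt_conj_sectionCoord hf.holomorphic (hgood i z hi).2.1
  rw [dbar_congr (u' := fun x => ∑ i ∈ F, t i x (f x)) (hF.mono fun x' hx' => hαF F x' hx' _),
    dbar_sum fun i _ => hfs i]
  -- Each piece contributes `ψᵢ(z) ξ(z)`. Since `f z = 0`, the terms with `∂̄ψᵢ` and `∂̄βᵢ` vanish,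
  -- and `conj(df) ∧ βᵢ = ξ` remains, weighted by `ψᵢ`.
  have hterm : ∀ i, dbar (fun x => t i x (f x)) z = (ψ i z : ℂ) • ξ z := fun i => by
    by_cases hi : z ∈ tsupport (ψ i)
    · obtain ⟨h1, h2, h3, h4, h5⟩ := hgood i z hi
      apply formRep_injective h1
      change formRep (c i) z _ = formRep (c i) z _
      rw [localRep_dbar h1 (hfs i) (htt i z _), formRep_smul, ← h5 hz]
      have hev : localRep (fun x => t i x (f x)) (c i) =ᶠ[𝓝 (chartAt (Cn n) (c i) z)] fun y =>
          ((ψ i ((chartAt (Cn n) (c i)).symm y) : ℂ) * (starRingEnd ℂ) (sectionRep n f (c i) y)) •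
            β (c i) y := by
        filter_upwards [eventually_localRep_formOfRep (L := L) (β (c i)) h1] with y hy
        rw [← hy, localRep_eq, formRep_smul]
        rfl
      have hd1 := ((contDiffAt_chart_of_contMDiff h1.1 ((hψs i) z)).differentiableAt
        (by simp)).hasFDerivAt
      have hd2 := ((contDiffAt_sectionRep hf.holomorphic h2).differentiableAt (by simp)).hasFDerivAt
      have hz0 : sectionRep n f (c i) (chartAt (Cn n) (c i) z) = 0 := by
        rw [hf.zero_set] at hz
        rw [sectionRep_chart f h2.1, sectionCoord, show f z = 0 from hz, map_zero]
      have hd3 : HasFDerivAt (fun y => (starRingEnd ℂ) (sectionRep n f (c i) y))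
          (conjFunctional (fderiv ℂ (sectionRep n f (c i)) (chartAt (Cn n) (c i) z)))
          (chartAt (Cn n) (c i) z) :=
        Complex.conjCLE.hasFDerivAt.comp _ (hd2.restrictScalars ℝ)
      have hd4 := (Complex.ofRealCLM.hasFDerivAt.comp _ hd1).mul hd3
      have hd5 : HasFDerivAt (fun y => (ψ i ((chartAt (Cn n) (c i)).symm y) : ℂ) *
          (starRingEnd ℂ) (sectionRep n f (c i) y)) ((ψ i z : ℂ) •
            conjFunctional (fderiv ℂ (sectionRep n f (c i)) (chartAt (Cn n) (c i) z)))
          (chartAt (Cn n) (c i) z) := by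
        refine hd4.congr_fderiv ?_
        rw [hz0]
        ext v
        simp [(chartAt (Cn n) (c i)).left_inv h1.1]
      rw [flatDbar_congr hev, flatDbar_smul hd5.differentiableAt (h3.differentiableAt (by simp)),
        hd5.fderiv, hz0, map_zero, mul_zero]
      ext v
      simp only [ContinuousAlternatingMap.add_apply, zero_mul, zero_add, dbarSymbol_smulRight_apply, ContinuousAlternatingMap.smul_apply, Finset.mul_sum,
        antilinearPart_apply, _root_.smul_apply, smul_eq_mul, mul_smul_comm]
      refine Finset.sum_congr rfl fun j _ => ?_
      congr 1; ring
    · rw [image_eq_zero_of_notMem_tsupport hi, Complex.ofReal_zero, zero_smul,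
        dbar_congr (u' := fun x => (0 : FormAt n L p x)) ?_]
      · have := dbar_sum (s := (∅ : Finset ι)) (u := fun i x => t i x (f x)) (x := z) (by simp)
        simpa using this
      · filter_upwards [(isClosed_tsupport (ψ i)).isOpen_compl.mem_nhds hi] with x' hx'
        exact ht0 i x' _ hx'
  rw [Finset.sum_congr rfl fun i _ => hterm i, ← Finset.sum_smul, ← Complex.ofReal_sum]
  have hsum : ∑ i ∈ F, ψ i z = 1 := by
    rw [← hψ1 z]
    exact (finsum_eq_sum_of_support_subset _ fun i hi => hF.self_of_nhds i
      (subset_tsupport _ hi)).symm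
  rw [hsum, Complex.ofReal_one, one_smul]

end TwistedForm

/-! ### The volume measure in a chart -/

section Volume

variable {n : ℕ} {X : Type*} [TopologicalSpace X] [ChartedSpace (Cn n) X]
  [IsManifold 𝓘(ℂ, Cn n) ω X]

/-- The pullback of a sesquilinear form under a linear map. -/
def sesqPullback {V W : Type*} [AddCommGroup V] [Module ℂ V] [AddCommGroup W] [Module ℂ W]
    (B : W →ₗ⋆[ℂ] W →ₗ[ℂ] ℂ) (M : V →ₗ[ℂ] W) : V →ₗ⋆[ℂ] V →ₗ[ℂ] ℂ :=
  LinearMap.mk₂'ₛₗ (starRingEnd ℂ) (RingHom.id ℂ) (fun a b => B (M a) (M b))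
    (fun _ _ _ => by simp only [map_add, LinearMap.add_apply])
    (fun _ _ _ => by simp only [map_smul, map_smulₛₗ, LinearMap.smul_apply])
    (fun _ _ _ => by simp only [map_add])
    (fun _ _ _ => by simp only [map_smul, RingHom.id_apply])

/-- The Hermitian metric at `x`, in the coordinates of the chart around `x₀`. -/
def metricForm (g : HermitianMetric n (Cn n) (TangentSpace 𝓘(ℂ, Cn n) : X → Type _)) (x₀ x : X) :
    Cn n →ₗ⋆[ℂ] Cn n →ₗ[ℂ] ℂ :=
  sesqPullback (g.inner x)
    ((trivializationAt (Cn n) (TangentSpace 𝓘(ℂ, Cn n) : X → Type _) x₀).symmL ℂ x).toLinearMap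

theorem metricCoeff_eq (g : HermitianMetric n (Cn n) (TangentSpace 𝓘(ℂ, Cn n) : X → Type _))
    {x₀ : X} {y : Cn n} (hy : y ∈ (chartAt (Cn n) x₀).target) (a b : Cn n) :
    metricCoeff g x₀ a b y = metricForm g x₀ ((chartAt (Cn n) x₀).symm y) a b := by
  have hb : (chartAt (Cn n) x₀).symm y ∈
      (trivializationAt (Cn n) (TangentSpace 𝓘(ℂ, Cn n) : X → Type _) x₀).baseSet := by
    rw [TangentBundle.trivializationAt_baseSet]; exact (chartAt (Cn n) x₀).map_target hy
  rw [metricCoeff, ← Trivialization.symmL_apply (R := ℂ) _ hb, ← Trivialization.symmL_apply (R := ℂ)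
    _ hb]
  rfl

/-- The matrix of a sesquilinear form on `ℂⁿ`. -/
def gramMatrix (B : Cn n →ₗ⋆[ℂ] Cn n →ₗ[ℂ] ℂ) : Matrix (Fin n) (Fin n) ℂ :=
  Matrix.of fun j k => B (EuclideanSpace.single j 1) (EuclideanSpace.single k 1)

theorem sum_single (v : Cn n) : v = ∑ j, v j • EuclideanSpace.single j (1 : ℂ) := by
  conv_lhs => rw [← (EuclideanSpace.basisFun (Fin n) ℂ).sum_repr v]
  simp

theorem sesq_expand (B : Cn n →ₗ⋆[ℂ] Cn n →ₗ[ℂ] ℂ) (v w : Cn n) :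
    B v w = ∑ j, ∑ k, starRingEnd ℂ (v j) * w k * gramMatrix B j k := by
  conv_lhs => rw [sum_single v, sum_single w]
  simp only [map_sum, LinearMap.sum_apply, map_smulₛₗ, LinearMap.smul_apply, smul_eq_mul,
    RingHom.id_apply, gramMatrix, Matrix.of_apply, Finset.mul_sum]
  rw [Finset.sum_comm]
  refine Finset.sum_congr rfl fun j _ => Finset.sum_congr rfl fun k _ => by ring

/-- The Gram matrix becomes `P* G P`, so its determinant is multiplied by `|det P|²`, which is the
real determinant of a complex-linear map. This is the Jacobian of the change of variables formula.
-/
theorem det_gramMatrix_comp (B : Cn n →ₗ⋆[ℂ] Cn n →ₗ[ℂ] ℂ) (M : Cn n →ₗ[ℂ] Cn n) :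
    (gramMatrix (sesqPullback B M)).det.re =
      |LinearMap.det (M.restrictScalars ℝ)| * (gramMatrix B).det.re := by
  set P := LinearMap.toMatrix (EuclideanSpace.basisFun (Fin n) ℂ).toBasis
    (EuclideanSpace.basisFun (Fin n) ℂ).toBasis M with hP
  have h1 : gramMatrix (sesqPullback B M) = P.conjTranspose * gramMatrix B * P := by
    ext j k
    have : gramMatrix (sesqPullback B M) j k =
      B (M (EuclideanSpace.single j 1)) (M (EuclideanSpace.single k 1)) := rfl
    rw [this, sesq_expand]
    simp only [Matrix.mul_apply, Matrix.conjTranspose_apply, hP, LinearMap.toMatrix_apply,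
      Finset.sum_mul]
    rw [Finset.sum_comm]
    refine Finset.sum_congr rfl fun a _ => Finset.sum_congr rfl fun b _ => ?_
    simp
    ring
  rw [h1, Matrix.det_mul, Matrix.det_mul, Matrix.det_conjTranspose, hP, LinearMap.det_toMatrix,
    LinearMap.det_restrictScalars, Algebra.norm_complex_apply, abs_of_nonneg (Complex.normSq_nonneg _),
    mul_right_comm]
  have : star (LinearMap.det M) * LinearMap.det M = (Complex.normSq (LinearMap.det M) : ℂ) :=
    (Complex.normSq_eq_conj_mul_self).symm
  rw [this, Complex.re_ofReal_mul]

theorem metricForm_transition (g : HermitianMetric n (Cn n) (TangentSpace 𝓘(ℂ, Cn n) : X → Type _))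
    {x₀ x₁ x : X} (h0 : x ∈ (chartAt (Cn n) x₀).source) (h1 : x ∈ (chartAt (Cn n) x₁).source) :
    metricForm g x₁ x = sesqPullback (metricForm g x₀ x)
      (fderiv ℂ (transition n x₀ x₁) (chartAt (Cn n) x₁ x)).toLinearMap := by
  have hb : x ∈ (trivializationAt (Cn n) (TangentSpace 𝓘(ℂ, Cn n) : X → Type _) x₀).baseSet := by
    rw [TangentBundle.trivializationAt_baseSet]; exact h0
  have key : ∀ v : Cn n,
      (trivializationAt (Cn n) (TangentSpace 𝓘(ℂ, Cn n) : X → Type _) x₀).symmL ℂ x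
        (fderiv ℂ (transition n x₀ x₁) (chartAt (Cn n) x₁ x) v) =
      (trivializationAt (Cn n) (TangentSpace 𝓘(ℂ, Cn n) : X → Type _) x₁).symmL ℂ x v := fun v => by
    rw [← tangent_transition h0 h1]
    exact (trivializationAt (Cn n) (TangentSpace 𝓘(ℂ, Cn n) : X → Type _)
      x₀).symmL_continuousLinearMapAt (R := ℂ) hb _
  ext v w
  change g.inner x _ _ = g.inner x ((trivializationAt (Cn n) (TangentSpace 𝓘(ℂ, Cn n) : X → Type _)
    x₀).symmL ℂ x (fderiv ℂ (transition n x₀ x₁) (chartAt (Cn n) x₁ x) v))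
    ((trivializationAt (Cn n) (TangentSpace 𝓘(ℂ, Cn n) : X → Type _)
    x₀).symmL ℂ x (fderiv ℂ (transition n x₀ x₁) (chartAt (Cn n) x₁ x) w))
  rw [key, key]; rfl

/-- The density of the volume measure in the chart around `x₀`. -/
def volumeDensity (g : HermitianMetric n (Cn n) (TangentSpace 𝓘(ℂ, Cn n) : X → Type _)) (x₀ : X)
    (y : Cn n) : ℝ≥0∞ :=
  ENNReal.ofReal (gramMatrix (metricForm g x₀ ((chartAt (Cn n) x₀).symm y))).det.re

variable [MeasurableSpace X] [BorelSpace X]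

theorem measurableSet_chart_preimage (x₀ : X) {S : Set X} (hS : MeasurableSet S) :
    MeasurableSet ((chartAt (Cn n) x₀).symm ⁻¹' S ∩ (chartAt (Cn n) x₀).target) := by
  have h1 : Measurable ((chartAt (Cn n) x₀).target.domRestrict (chartAt (Cn n) x₀).symm) :=
    (continuousOn_iff_continuous_domRestrict.1 (chartAt (Cn n) x₀).continuousOn_symm).measurable
  have h2 := (chartAt (Cn n) x₀).open_target.measurableSet.subtype_image (h1 hS)
  convert h2 using 1
  ext y
  simp [and_comm, Set.domRestrict]

theorem chartVolume_apply (g : HermitianMetric n (Cn n) (TangentSpace 𝓘(ℂ, Cn n) : X → Type _))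
    (x₀ : X) {S : Set X} (hS : MeasurableSet S) :
    chartVolume g x₀ S =
      ∫⁻ y in (chartAt (Cn n) x₀).symm ⁻¹' S ∩ (chartAt (Cn n) x₀).target, volumeDensity g x₀ y := by
  have h1 : AEMeasurable (chartAt (Cn n) x₀).symm
      ((volume : Measure (Cn n)).restrict (chartAt (Cn n) x₀).target) :=
    (chartAt (Cn n) x₀).continuousOn_symm.aemeasurable (chartAt (Cn n) x₀).open_target.measurableSet
  rw [chartVolume, Measure.map_apply_of_aemeasurable
    (h1.mono_ac (withDensity_absolutelyContinuous _ _)) hS, withDensity_apply',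
    Measure.restrict_restrict' (chartAt (Cn n) x₀).open_target.measurableSet]
  refine setLIntegral_congr_fun (measurableSet_chart_preimage x₀ hS) fun y hy => ?_
  simp only [metricCoeff_eq g hy.2]
  rfl

/-- By change of variables, the measure of the chart around `x₁` equals that of the chart around
`x₀` on the part of `S` that both charts see. Only an inequality results, since part of `S` may lie
outside the chart around `x₁`. -/
theorem chartVolume_le (g : HermitianMetric n (Cn n) (TangentSpace 𝓘(ℂ, Cn n) : X → Type _))
    (x₀ x₁ : X) {S : Set X} (hS : MeasurableSet S) (hS0 : S ⊆ (chartAt (Cn n) x₀).source) :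
    chartVolume g x₁ S ≤ chartVolume g x₀ S := by
  rw [chartVolume_apply g x₁ hS, chartVolume_apply g x₀ hS]
  set A := (chartAt (Cn n) x₁).symm ⁻¹' S ∩ (chartAt (Cn n) x₁).target with hA
  set T := transition n x₀ x₁ with hT
  have hT' : ∀ y ∈ A, HasFDerivAt T (fderiv ℂ T y) y := fun y hy => by
    have h := contDiffAt_transition (n := n) (hS0 hy.1) ((chartAt (Cn n) x₁).map_target hy.2)
    rw [(chartAt (Cn n) x₁).right_inv hy.2] at h
    exact (h.differentiableAt (by simp)).hasFDerivAt
  have hinj : InjOn T A := fun y hy z hz hyz =>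
    (chartAt (Cn n) x₁).symm.injOn hy.2 hz.2
      ((chartAt (Cn n) x₀).injOn (hS0 hy.1) (hS0 hz.1) hyz)
  have hsub : T '' A ⊆ (chartAt (Cn n) x₀).symm ⁻¹' S ∩ (chartAt (Cn n) x₀).target := by
    rintro _ ⟨y, hy, rfl⟩
    refine ⟨?_, (chartAt (Cn n) x₀).map_source (hS0 hy.1)⟩
    rw [mem_preimage, hT, transition, Function.comp_apply, (chartAt (Cn n) x₀).left_inv (hS0 hy.1)]
    exact hy.1
  refine le_trans (le_of_eq ?_) (lintegral_mono_set hsub)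
  rw [lintegral_image_eq_lintegral_abs_det_fderiv_mul volume (measurableSet_chart_preimage x₁ hS)
    (f' := fun y => (fderiv ℂ T y).restrictScalars ℝ)
    (fun y hy => ((hT' y hy).restrictScalars ℝ).hasFDerivWithinAt) hinj]
  refine setLIntegral_congr_fun (measurableSet_chart_preimage x₁ hS) fun y hy => ?_
  have h1 : (chartAt (Cn n) x₀).symm (T y) = (chartAt (Cn n) x₁).symm y :=
    (chartAt (Cn n) x₀).left_inv (hS0 hy.1)
  change _ = ENNReal.ofReal _ * volumeDensity g x₀ (T y)
  rw [volumeDensity, volumeDensity, h1, ← ENNReal.ofReal_mul (abs_nonneg _),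
    metricForm_transition g (hS0 hy.1) ((chartAt (Cn n) x₁).map_target hy.2),
    (chartAt (Cn n) x₁).right_inv hy.2, det_gramMatrix_comp]
  rfl

/-- A supremum of measures is not taken set by set, so it is bounded by a single measure dominating
all chart measures: the measure of the chart around `x₀` on its domain, and `⊤` on the complement.
-/
theorem volumeMeasure_le (g : HermitianMetric n (Cn n) (TangentSpace 𝓘(ℂ, Cn n) : X → Type _))
    (x₀ : X) {S : Set X} (hS : MeasurableSet S) (hS0 : S ⊆ (chartAt (Cn n) x₀).source) :
    volumeMeasure g S ≤ chartVolume g x₀ S := by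
  have hm : MeasurableSet (chartAt (Cn n) x₀).source := (chartAt (Cn n) x₀).open_source.measurableSet
  have h : volumeMeasure g ≤ (chartVolume g x₀).restrict (chartAt (Cn n) x₀).source +
      (⊤ : Measure X).restrict (chartAt (Cn n) x₀).sourceᶜ := by
    refine iSup_le fun x₁ => ?_
    rw [← Measure.restrict_add_restrict_compl (μ := chartVolume g x₁) hm]
    refine add_le_add (Measure.le_iff.2 fun A hA => ?_) (Measure.restrict_mono le_rfl le_top)
    rw [Measure.restrict_apply hA, Measure.restrict_apply hA]
    exact chartVolume_le g x₀ x₁ (hA.inter hm) inter_subset_right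
  refine (h S).trans ?_
  rw [Measure.add_apply, Measure.restrict_apply hS, Measure.restrict_apply hS,
    inter_eq_self_of_subset_left hS0, ← sdiff_eq, sdiff_eq_empty.2 hS0, measure_empty, add_zero]

end Volume

/-! ### The defining section in a fixed frame -/

section DefiningSection

variable {n : ℕ} {X : Type*} [TopologicalSpace X] [ChartedSpace (Cn n) X]
  [IsManifold 𝓘(ℂ, Cn n) ω X]
  {E : X → Type*} [TopologicalSpace (TotalSpace ℂ E)]
  [∀ x, AddCommGroup (E x)] [∀ x, Module ℂ (E x)] [∀ x, TopologicalSpace (E x)]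
  [FiberBundle ℂ E] [VectorBundle ℂ ℂ E] [ContMDiffVectorBundle ω ℂ E 𝓘(ℂ, Cn n)]

theorem contMDiffAt_sectionCoord {f : ∀ x, E x}
    (hf : ContMDiff 𝓘(ℂ, Cn n) (𝓘(ℂ, Cn n).prod 𝓘(ℂ, ℂ)) ω (fun x => TotalSpace.mk' ℂ x (f x)))
    {x₀ x : X} (hx : x ∈ frameDomain n E x₀) :
    ContMDiffAt 𝓘(ℝ, Cn n) 𝓘(ℝ, ℂ) ∞ (sectionCoord f x₀) x :=
  contMDiffAt_of_contDiffAt_chart hx.1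
    (((contDiffAt_sectionRep hf hx).restrict_scalars ℝ).of_le le_top)

theorem fderiv_sectionRep_ne_zero {f : ∀ x, E x} {Z : Set X} (hf : IsDefiningSection n f Z)
    {x₀ x : X} (hx : x ∈ frameDomain n E x₀) (hxZ : x ∈ Z) :
    fderiv ℂ (sectionRep n f x₀) (chartAt (Cn n) x₀ x) ≠ 0 := fun h0 => by
  have hfx : f x = 0 := by have := hf.zero_set ▸ hxZ; exact this
  refine hf.deriv_ne_zero x hxZ (ContinuousLinearMap.ext fun v => ?_)
  have h1 := fderiv_sectionRep hf.holomorphic hx hfx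
    ((trivializationAt (Cn n) (TangentSpace 𝓘(ℂ, Cn n) : X → Type _)
      x₀).continuousLinearMapAt ℂ x v)
  rw [h0, (trivializationAt (Cn n) (TangentSpace 𝓘(ℂ, Cn n) : X → Type _)
    x₀).symmL_continuousLinearMapAt (R := ℂ) (mem_tangent_baseSet hx)] at h1
  exact (mul_eq_zero.1 h1.symm).resolve_left
    (frameChange_ne_zero (FiberBundle.mem_baseSet_trivializationAt' x) hx.2)

end DefiningSection

/-! ### `Z` is a null set, and thin tubes around it have small volume -/

section Null

variable {n : ℕ} {X : Type*} [TopologicalSpace X] [ChartedSpace (Cn n) X]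
  [IsManifold 𝓘(ℂ, Cn n) ω X]

theorem continuousOn_metricForm
    (g : HermitianMetric n (Cn n) (TangentSpace 𝓘(ℂ, Cn n) : X → Type _)) (x₀ : X) (a b : Cn n) :
    ContinuousOn (fun y => metricForm g x₀ ((chartAt (Cn n) x₀).symm y) a b)
      (chartAt (Cn n) x₀).target := by
  refine ((g.smooth x₀ a b).continuousOn.mono fun y hy => ⟨hy, ?_, mem_univ _⟩).congr
    fun y hy => (metricCoeff_eq g hy a b).symm
  rw [TangentBundle.trivializationAt_baseSet]
  exact (chartAt (Cn n) x₀).map_target hy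

theorem chart_image_eq {x₀ : X} {S : Set X} (hS : S ⊆ (chartAt (Cn n) x₀).source) :
    (chartAt (Cn n) x₀).symm ⁻¹' S ∩ (chartAt (Cn n) x₀).target = chartAt (Cn n) x₀ '' S := by
  rw [inter_comm, ← (chartAt (Cn n) x₀).image_source_inter_eq', inter_eq_self_of_subset_right hS]

theorem isCompact_chart_image {x₀ : X} {K : Set X} (hK : IsCompact K)
    (hKs : K ⊆ (chartAt (Cn n) x₀).source) : IsCompact (chartAt (Cn n) x₀ '' K) :=
  hK.image_of_continuousOn ((chartAt (Cn n) x₀).continuousOn.mono hKs)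

theorem chart_image_subset {x₀ : X} {K : Set X} (hKs : K ⊆ (chartAt (Cn n) x₀).source) :
    chartAt (Cn n) x₀ '' K ⊆ (chartAt (Cn n) x₀).target := by
  rintro _ ⟨x, hx, rfl⟩
  exact (chartAt (Cn n) x₀).map_source (hKs hx)

variable [MeasurableSpace X] [BorelSpace X]

/-- The density is a continuous function on the compact image of `K` in the chart, hence bounded
there. -/
theorem volumeMeasure_lt_top
    (g : HermitianMetric n (Cn n) (TangentSpace 𝓘(ℂ, Cn n) : X → Type _)) [T2Space X] {x₀ : X}
    {K : Set X} (hK : IsCompact K) (hKs : K ⊆ (chartAt (Cn n) x₀).source) :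
    volumeMeasure g K < ⊤ := by
  refine (volumeMeasure_le g x₀ hK.measurableSet hKs).trans_lt ?_
  rw [chartVolume_apply g x₀ hK.measurableSet, chart_image_eq hKs]
  have hc : ContinuousOn (fun y => (gramMatrix (metricForm g x₀
      ((chartAt (Cn n) x₀).symm y))).det) (chartAt (Cn n) x₀ '' K) := by
    simp only [Matrix.det_apply]
    refine continuousOn_finsetSum _ fun σ _ => ContinuousOn.const_smul
      (continuousOn_finsetProd _ fun i _ => ?_) _
    exact (continuousOn_metricForm g x₀ _ _).mono (chart_image_subset hKs)
  have hK' := isCompact_chart_image hK hKs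
  obtain ⟨C, hC⟩ := hK'.exists_bound_of_continuousOn hc
  calc ∫⁻ y in chartAt (Cn n) x₀ '' K, volumeDensity g x₀ y
      ≤ ∫⁻ _ in chartAt (Cn n) x₀ '' K, ENNReal.ofReal C :=
        setLIntegral_mono' hK'.measurableSet fun y hy => ENNReal.ofReal_le_ofReal
          (((le_abs_self _).trans (Complex.abs_re_le_norm _)).trans (hC y hy))
    _ < ⊤ := by
        rw [setLIntegral_const]
        exact ENNReal.mul_lt_top ENNReal.ofReal_lt_top hK'.measure_lt_top

variable {E : X → Type*} [TopologicalSpace (TotalSpace ℂ E)]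
  [∀ x, AddCommGroup (E x)] [∀ x, Module ℂ (E x)] [∀ x, TopologicalSpace (E x)]
  [FiberBundle ℂ E] [VectorBundle ℂ ℂ E] [ContMDiffVectorBundle ω ℂ E 𝓘(ℂ, Cn n)]

theorem volumeMeasure_zeroSet
    (g : HermitianMetric n (Cn n) (TangentSpace 𝓘(ℂ, Cn n) : X → Type _)) {f : ∀ x, E x} {Z : Set X}
    (hf : IsDefiningSection n f Z) {x₀ : X} {S : Set X} (hS : MeasurableSet S)
    (hSd : S ⊆ frameDomain n E x₀) (hSZ : S ⊆ Z) : volumeMeasure g S = 0 := by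
  refine le_antisymm ((volumeMeasure_le g x₀ hS fun x hx => (hSd hx).1).trans ?_) zero_le
  rw [chartVolume_apply g x₀ hS, chart_image_eq fun x hx => (hSd hx).1]
  refine (setLIntegral_measure_zero _ _ ?_).le
  refine measure_null_of_locally_null _ ?_
  rintro _ ⟨x, hx, rfl⟩
  have hz : ∀ x ∈ S, sectionRep n f x₀ (chartAt (Cn n) x₀ x) = 0 := fun x hx => by
    have hfx : f x = 0 := by have := hf.zero_set ▸ hSZ hx; exact this
    rw [sectionRep_chart f (hSd hx).1, (sectionCoord_eq_zero_iff f (hSd hx).2).2 hfx]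
  obtain ⟨U, hU, hU0⟩ := exists_nhds_volume_zeroSet (contDiffAt_sectionRep hf.holomorphic (hSd hx))
    (hz x hx) (fderiv_sectionRep_ne_zero hf (hSd hx) (hSZ hx))
  refine ⟨U ∩ {y | sectionRep n f x₀ y = 0}, Filter.inter_mem (mem_nhdsWithin_of_mem_nhds hU)
    (Filter.mem_of_superset self_mem_nhdsWithin ?_), hU0⟩
  rintro _ ⟨x', hx', rfl⟩
  exact hz x' hx'

/-- The closed tubes in `K` decrease to a subset of `Z`, which is null, and have finite measure, so
continuity from above applies. The radius is `2 * δ` because the cut-off at scale `δ` vanishes only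
from there on; `δ ≤ 1` is needed for its uniform bounds. -/
theorem exists_volume_tube_lt [T2Space X]
    (g : HermitianMetric n (Cn n) (TangentSpace 𝓘(ℂ, Cn n) : X → Type _)) {f : ∀ x, E x} {Z : Set X}
    (hf : IsDefiningSection n f Z) {x₀ : X} {K : Set X} (hK : IsCompact K)
    (hKd : K ⊆ frameDomain n E x₀) {η : ℝ≥0∞} (hη : 0 < η) :
    ∃ δ ∈ Ioc (0 : ℝ) 1, IsClosed (K ∩ {x | ‖sectionCoord f x₀ x‖ ≤ 2 * δ}) ∧
      volumeMeasure g (K ∩ {x | ‖sectionCoord f x₀ x‖ ≤ 2 * δ}) < η := by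
  have hcont : ContinuousOn (fun x => ‖sectionCoord f x₀ x‖) K := fun x hx =>
    (contMDiffAt_sectionCoord hf.holomorphic (hKd hx)).continuousAt.norm.continuousWithinAt
  have hcl : ∀ δ : ℝ, IsClosed (K ∩ {x | ‖sectionCoord f x₀ x‖ ≤ δ}) := fun δ =>
    hcont.preimage_isClosed_of_isClosed hK.isClosed isClosed_Iic
  set S : ℕ → Set X := fun m => K ∩ {x | ‖sectionCoord f x₀ x‖ ≤ 2 * (1 / ((m : ℝ) + 1))} with hS
  have hanti : Antitone S := fun a b hab => by
    refine inter_subset_inter_right _ fun x hx => ?_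
    rw [mem_ofPred_eq] at hx ⊢
    have : (1 : ℝ) / (b + 1) ≤ 1 / (a + 1) := Nat.one_div_le_one_div hab
    linarith
  have h0 : volumeMeasure g (⋂ m, S m) = 0 := by
    refine volumeMeasure_zeroSet g hf (MeasurableSet.iInter fun m => (hcl _).measurableSet)
      (fun x hx => hKd (mem_iInter.1 hx 0).1) fun x hx => ?_
    have hle : ‖sectionCoord f x₀ x‖ ≤ 2 * 0 := by
      refine ge_of_tendsto' (tendsto_const_nhds.mul tendsto_one_div_add_atTop_nhds_zero_nat)
        fun m => (mem_iInter.1 hx m).2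
    have : sectionCoord f x₀ x = 0 := by rw [mul_zero] at hle; exact norm_le_zero_iff.1 hle
    rw [hf.zero_set]
    exact (sectionCoord_eq_zero_iff f (hKd (mem_iInter.1 hx 0).1).2).1 this
  have hlim := tendsto_measure_iInter_atTop (μ := volumeMeasure g)
    (s := S) (fun m => (hcl _).measurableSet.nullMeasurableSet) hanti
    ⟨0, ((measure_mono inter_subset_left).trans_lt
      (volumeMeasure_lt_top g hK fun x hx => (hKd hx).1)).ne⟩
  rw [h0] at hlim
  obtain ⟨m, hm⟩ := (hlim.eventually (gt_mem_nhds hη)).exists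
  refine ⟨1 / ((m : ℝ) + 1), ⟨by positivity, ?_⟩, hcl _, hm⟩
  rw [div_le_one (by positivity)]
  linarith [(Nat.cast_nonneg m : (0 : ℝ) ≤ m)]

end Null

/-! ### Bounds for the pointwise norm of forms -/

section Norm

variable {n q : ℕ} {X : Type*} [TopologicalSpace X] [ChartedSpace (Cn n) X]
  [IsManifold 𝓘(ℂ, Cn n) ω X]
  {L : X → Type*} [TopologicalSpace (TotalSpace ℂ L)]
  [∀ x, AddCommGroup (L x)] [∀ x, Module ℂ (L x)] [∀ x, TopologicalSpace (L x)]
  [FiberBundle ℂ L] [VectorBundle ℂ ℂ L]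

/-- The metric is continuous and positive on the compact product of the chart image of `K` with the
unit sphere, so it has a positive lower bound there; homogeneity gives all vectors. -/
theorem exists_metric_lower_bound
    (g : HermitianMetric n (Cn n) (TangentSpace 𝓘(ℂ, Cn n) : X → Type _)) {x₀ : X} {K : Set X}
    (hK : IsCompact K) (hKs : K ⊆ (chartAt (Cn n) x₀).source) :
    ∃ c : ℝ, 0 < c ∧ ∀ x ∈ K, ∀ v : Tan n x,
      c * ‖(trivializationAt (Cn n) (TangentSpace 𝓘(ℂ, Cn n) : X → Type _)
        x₀).continuousLinearMapAt ℂ x v‖ ^ 2 ≤ (g.inner x v v).re := by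
  have hb : ∀ x ∈ K, x ∈ (trivializationAt (Cn n) (TangentSpace 𝓘(ℂ, Cn n) : X → Type _)
      x₀).baseSet := fun x hx => by
    rw [TangentBundle.trivializationAt_baseSet]; exact hKs hx
  have hcont : ContinuousOn (fun p : Cn n × Cn n =>
      (metricForm g x₀ ((chartAt (Cn n) x₀).symm p.1) p.2 p.2).re)
      ((chartAt (Cn n) x₀ '' K) ×ˢ Metric.sphere (0 : Cn n) 1) := by
    refine Complex.continuous_re.comp_continuousOn ?_
    simp only [sesq_expand]
    refine continuousOn_finsetSum _ fun j _ => continuousOn_finsetSum _ fun k _ =>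
      ContinuousOn.mul (Continuous.continuousOn (by fun_prop)) ?_
    exact ((continuousOn_metricForm g x₀ _ _).mono (chart_image_subset hKs)).comp
      continuousOn_fst fun p hp => hp.1
  obtain ⟨c, hc, hle⟩ := ((isCompact_chart_image hK hKs).prod
    (isCompact_sphere (0 : Cn n) 1)).exists_forall_le' hcont (a := 0) (by
      rintro ⟨_, a⟩ ⟨⟨x, hx, rfl⟩, ha⟩
      simp only [(chartAt (Cn n) x₀).left_inv (hKs hx)]
      refine g.pos x _ fun h => ?_
      have h2 := (trivializationAt (Cn n) (TangentSpace 𝓘(ℂ, Cn n) : X → Type _)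
        x₀).continuousLinearMapAt_symmL (R := ℂ) (hb x hx) a
      have h3 : (trivializationAt (Cn n) (TangentSpace 𝓘(ℂ, Cn n) : X → Type _) x₀).symmL ℂ x a = 0
        := h
      rw [h3, map_zero] at h2
      rw [← h2] at ha
      simp at ha)
  refine ⟨c, hc, fun x hx v => ?_⟩
  set a := (trivializationAt (Cn n) (TangentSpace 𝓘(ℂ, Cn n) : X → Type _)
    x₀).continuousLinearMapAt ℂ x v with ha
  have hv : g.inner x v v = metricForm g x₀ x a a := by
    have h1 := (trivializationAt (Cn n) (TangentSpace 𝓘(ℂ, Cn n) : X → Type _)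
      x₀).symmL_continuousLinearMapAt (R := ℂ) (hb x hx) v
    conv_lhs => rw [← h1]
    rfl
  rw [hv]
  by_cases h0 : a = 0
  · simp [h0]
  have hn : ‖a‖ ≠ 0 := norm_ne_zero_iff.2 h0
  have h1 := hle (chartAt (Cn n) x₀ x, ((‖a‖⁻¹ : ℝ) : ℂ) • a) ⟨mem_image_of_mem _ hx, by
    rw [mem_sphere_zero_iff_norm, norm_smul]; simp [hn]⟩
  simp only [(chartAt (Cn n) x₀).left_inv (hKs hx), map_smulₛₗ, LinearMap.smul_apply,
    RingHom.id_apply, Complex.conj_ofReal, smul_eq_mul, Complex.re_ofReal_mul] at h1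
  have h2 := mul_le_mul_of_nonneg_right h1 (sq_nonneg ‖a‖)
  refine h2.trans_eq ?_
  field_simp

theorem inner_eq_coord (h : HermitianMetric n ℂ L) {x₀ x : X}
    (hx : x ∈ (trivializationAt ℂ L x₀).baseSet) (s : L x) :
    (h.inner x s s).re = ‖(trivializationAt ℂ L x₀).continuousLinearMapAt ℂ x s‖ ^ 2 *
      (h.inner x ((trivializationAt ℂ L x₀).symmL ℂ x 1)
        ((trivializationAt ℂ L x₀).symmL ℂ x 1)).re := by
  set t := (trivializationAt ℂ L x₀).continuousLinearMapAt ℂ x s with ht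
  have h1 : s = t • (trivializationAt ℂ L x₀).symmL ℂ x 1 := by
    rw [← map_smul, smul_eq_mul, mul_one, ht, (trivializationAt ℂ L x₀).symmL_continuousLinearMapAt hx]
  conv_lhs => rw [h1]
  simp only [map_smulₛₗ, LinearMap.smul_apply, smul_eq_mul, RingHom.id_apply]
  rw [← mul_assoc, mul_comm t, ← Complex.normSq_eq_conj_mul_self, Complex.re_ofReal_mul,
    Complex.normSq_eq_norm_sq]

theorem exists_fibre_upper_bound (h : HermitianMetric n ℂ L) {x₀ : X} {K : Set X} (hK : IsCompact K)
    (hKd : K ⊆ frameDomain n L x₀) :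
    ∃ C : ℝ, 0 ≤ C ∧ ∀ x ∈ K, ∀ s : L x,
      (h.inner x s s).re ≤ C * ‖(trivializationAt ℂ L x₀).continuousLinearMapAt ℂ x s‖ ^ 2 := by
  have hKs : K ⊆ (chartAt (Cn n) x₀).source := fun x hx => (hKd hx).1
  have hsub : chartAt (Cn n) x₀ '' K ⊆ chartPart n x₀ (trivializationAt ℂ L x₀).baseSet univ := by
    rintro _ ⟨x, hx, rfl⟩
    refine ⟨(chartAt (Cn n) x₀).map_source (hKs hx), ?_, mem_univ _⟩
    rw [(chartAt (Cn n) x₀).left_inv (hKs hx)]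
    exact (hKd hx).2
  have hc := ((h.smooth x₀ 1 1).continuousOn).mono hsub
  obtain ⟨C, hC⟩ := (isCompact_chart_image hK hKs).exists_bound_of_continuousOn hc
  refine ⟨max C 0, le_max_right _ _, fun x hx s => ?_⟩
  rw [inner_eq_coord h (hKd hx).2, mul_comm]
  refine mul_le_mul_of_nonneg_right ?_ (sq_nonneg _)
  have h1 := hC _ (mem_image_of_mem _ hx)
  rw [(chartAt (Cn n) x₀).left_inv (hKs hx), ← Trivialization.symmL_apply (R := ℂ) _ (hKd hx).2] at h1
  exact (((le_abs_self _).trans (Complex.abs_re_le_norm _)).trans h1).trans (le_max_left _ _)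

/-- A unitary vector over `K` has coordinates of squared norm at most `c⁻¹`. Each of the `q` slots
costs one such factor, uniformly in the unitary frame, so the bound passes to the supremum over
frames. -/
theorem exists_normSq_bound (g : HermitianMetric n (Cn n) (TangentSpace 𝓘(ℂ, Cn n) : X → Type _))
    (h : HermitianMetric n ℂ L) (q : ℕ) {x₀ : X} {K : Set X} (hK : IsCompact K)
    (hKd : K ⊆ frameDomain n L x₀) :
    ∃ C : ℝ, 0 ≤ C ∧ ∀ x ∈ K, ∀ η : FormAt n L q x,
      normSq g h η ≤ ENNReal.ofReal (C * ‖formRep x₀ x η‖ ^ 2) := by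
  obtain ⟨c, hc, hlow⟩ := exists_metric_lower_bound g hK fun x hx => (hKd hx).1
  obtain ⟨C, hC, hup⟩ := exists_fibre_upper_bound h hK hKd
  refine ⟨(1 / (q ! : ℝ)) * (Fintype.card (Fin q → Fin n) * (C * (c⁻¹) ^ q)), by positivity,
    fun x hx η => iSup_le fun e => ENNReal.ofReal_le_ofReal ?_⟩
  rw [mul_assoc]
  refine mul_le_mul_of_nonneg_left ?_ (by positivity)
  rw [mul_assoc, ← nsmul_eq_mul]
  refine Finset.sum_le_card_nsmul _ _ _ fun J _ => (hup x hx _).trans ?_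
  rw [mul_assoc]
  refine mul_le_mul_of_nonneg_left ?_ hC
  set a : Fin n → Cn n := fun j => (trivializationAt (Cn n) (TangentSpace 𝓘(ℂ, Cn n) : X → Type _)
    x₀).continuousLinearMapAt ℂ x (e.1 j) with ha
  have h1 : (trivializationAt ℂ L x₀).continuousLinearMapAt ℂ x (η fun i => e.1 (J i)) =
      formRep x₀ x η fun i => a (J i) := by
    rw [formRep_apply]
    congr 2
    ext1 i
    exact ((trivializationAt (Cn n) (TangentSpace 𝓘(ℂ, Cn n) : X → Type _)
      x₀).symmL_continuousLinearMapAt (R := ℂ) (mem_tangent_baseSet (hKd hx)) _).symm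
  have h2 : ∀ j, ‖a j‖ ^ 2 ≤ c⁻¹ := fun j => by
    have := hlow x hx (e.1 j)
    rw [e.2 j j, if_pos rfl, Complex.one_re] at this
    rw [← one_div, le_div_iff₀ hc, mul_comm]
    exact this
  rw [h1]
  calc ‖formRep x₀ x η fun i => a (J i)‖ ^ 2
      ≤ (‖formRep x₀ x η‖ * ∏ i, ‖a (J i)‖) ^ 2 :=
        pow_le_pow_left₀ (norm_nonneg _) (ContinuousAlternatingMap.le_opNorm _ _) 2
    _ = (∏ i, ‖a (J i)‖ ^ 2) * ‖formRep x₀ x η‖ ^ 2 := by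
        rw [mul_pow, Finset.prod_pow, mul_comm]
    _ ≤ (c⁻¹) ^ q * ‖formRep x₀ x η‖ ^ 2 := by
        refine mul_le_mul_of_nonneg_right ?_ (sq_nonneg _)
        refine (Finset.prod_le_prod (fun i _ => sq_nonneg _) fun i _ => h2 (J i)).trans ?_
        simp

theorem normSq_zero (g : HermitianMetric n (Cn n) (TangentSpace 𝓘(ℂ, Cn n) : X → Type _))
    (h : HermitianMetric n ℂ L) {x : X} : normSq g h (0 : FormAt n L q x) = 0 := by
  simp [normSq]

variable [∀ x, IsTopologicalAddGroup (L x)]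

/-- Weighted Cauchy–Schwarz: `|∑ tₖ|² ≤ (∑ wₖ) (∑ wₖ⁻¹ |tₖ|²)`, applied to coordinates in the
one-dimensional fibre. The bound does not involve the number of summands, which is not bounded over
`X`. -/
theorem inner_sum_le (h : HermitianMetric n ℂ L) {x : X} {ι : Type*} {F : Finset ι} (s : ι → L x)
    {w : ι → ℝ} (hw : ∀ k ∈ F, 0 < w k) (hw1 : ∑ k ∈ F, w k ≤ 1) :
    (h.inner x (∑ k ∈ F, s k) (∑ k ∈ F, s k)).re ≤ ∑ k ∈ F, (w k)⁻¹ * (h.inner x (s k) (s k)).re := by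
  have hx : x ∈ (trivializationAt ℂ L x).baseSet := FiberBundle.mem_baseSet_trivializationAt' x
  have hpos : 0 ≤ (h.inner x ((trivializationAt ℂ L x).symmL ℂ x 1)
      ((trivializationAt ℂ L x).symmL ℂ x 1)).re := by
    by_cases h0 : (trivializationAt ℂ L x).symmL ℂ x 1 = 0
    · rw [h0]; simp
    · exact (h.pos x _ h0).le
  have hc : ∀ k, (w k)⁻¹ * (h.inner x (s k) (s k)).re = (w k)⁻¹ *
      ‖(trivializationAt ℂ L x).continuousLinearMapAt ℂ x (s k)‖ ^ 2 *
      (h.inner x ((trivializationAt ℂ L x).symmL ℂ x 1)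
        ((trivializationAt ℂ L x).symmL ℂ x 1)).re := fun k => by
    rw [inner_eq_coord h hx (s k), ← mul_assoc]
  simp only [hc]
  rw [inner_eq_coord h hx, ← Finset.sum_mul, map_sum]
  refine mul_le_mul_of_nonneg_right ?_ hpos
  set t := fun k => (trivializationAt ℂ L x).continuousLinearMapAt ℂ x (s k)
  have h1 := Finset.sum_sq_le_sum_mul_sum_of_sq_le_mul F (r := fun k => ‖t k‖) (f := w)
    (g := fun k => (w k)⁻¹ * ‖t k‖ ^ 2) (fun k hk => (hw k hk).le)
    (fun k hk => mul_nonneg (inv_nonneg.2 (hw k hk).le) (sq_nonneg _)) fun k hk => by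
      rw [mul_inv_cancel_left₀ (hw k hk).ne']
  calc ‖∑ k ∈ F, t k‖ ^ 2 ≤ (∑ k ∈ F, ‖t k‖) ^ 2 :=
        pow_le_pow_left₀ (norm_nonneg _) (norm_sum_le _ _) 2
    _ ≤ _ := h1
    _ ≤ _ := mul_le_of_le_one_left (Finset.sum_nonneg fun k hk =>
        mul_nonneg (inv_nonneg.2 (hw k hk).le) (sq_nonneg _)) hw1

theorem normSq_sum_le (g : HermitianMetric n (Cn n) (TangentSpace 𝓘(ℂ, Cn n) : X → Type _))
    (h : HermitianMetric n ℂ L) {x : X} {ι : Type*} {F : Finset ι} (η : ι → FormAt n L q x)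
    {w : ι → ℝ} (hw : ∀ k ∈ F, 0 < w k) (hw1 : ∑ k ∈ F, w k ≤ 1) :
    normSq g h (∑ k ∈ F, η k) ≤ ∑ k ∈ F, ENNReal.ofReal (w k)⁻¹ * normSq g h (η k) := by
  refine iSup_le fun e => ?_
  have hnn : ∀ (s : L x), 0 ≤ (h.inner x s s).re := fun s => by
    by_cases h0 : s = 0
    · simp [h0]
    · exact (h.pos x _ h0).le
  calc _ ≤ ENNReal.ofReal (∑ k ∈ F, (w k)⁻¹ * ((1 / (q ! : ℝ)) * ∑ J : Fin q → Fin n,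
        (h.inner x (η k fun i => e.1 (J i)) (η k fun i => e.1 (J i))).re)) := by
        refine ENNReal.ofReal_le_ofReal ?_
        have h2 : ∀ J : Fin q → Fin n, (h.inner x ((∑ k ∈ F, η k) fun i => e.1 (J i))
            ((∑ k ∈ F, η k) fun i => e.1 (J i))).re ≤ ∑ k ∈ F, (w k)⁻¹ *
            (h.inner x (η k fun i => e.1 (J i)) (η k fun i => e.1 (J i))).re := fun J => by
          rw [ContinuousAlternatingMap.sum_apply]
          exact inner_sum_le h _ hw hw1
        refine (mul_le_mul_of_nonneg_left (Finset.sum_le_sum fun J _ => h2 J)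
          (by positivity)).trans_eq ?_
        rw [Finset.sum_comm, Finset.mul_sum]
        refine Finset.sum_congr rfl fun k _ => ?_
        rw [← Finset.mul_sum, mul_left_comm]
    _ = ∑ k ∈ F, ENNReal.ofReal ((w k)⁻¹ * ((1 / (q ! : ℝ)) * ∑ J : Fin q → Fin n,
        (h.inner x (η k fun i => e.1 (J i)) (η k fun i => e.1 (J i))).re)) :=
        ENNReal.ofReal_sum_of_nonneg fun k hk => mul_nonneg (inv_nonneg.2 (hw k hk).le)
          (mul_nonneg (by positivity) (Finset.sum_nonneg fun J _ => hnn _))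
    _ ≤ _ := by
        refine Finset.sum_le_sum fun k hk => ?_
        rw [ENNReal.ofReal_mul (inv_nonneg.2 (hw k hk).le)]
        exact mul_le_mul_right (le_iSup (fun e : UnitaryFrame g x => ENNReal.ofReal
          ((1 / (q ! : ℝ)) * ∑ J : Fin q → Fin n,
            (h.inner x (η k fun i => e.1 (J i)) (η k fun i => e.1 (J i))).re)) e) _

end Norm

/-! ### Cut-offs near `Z` with bounds independent of the width -/

section Cutoff

/-- A fixed bump function on `ℂ`. -/
def bump : ContDiffBump (0 : ℂ) := ⟨1, 2, one_pos, one_lt_two⟩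

/-- The rescaled cut-off of the conjugation, `w ↦ χ(w / δ) w̄`. -/
def conjCutoff (δ : ℝ) (w : ℂ) : ℂ := (bump (δ⁻¹ • w) : ℂ) * (starRingEnd ℂ) w

theorem contDiff_conjCutoff (δ : ℝ) : ContDiff ℝ ∞ (conjCutoff δ) := by
  have h1 : ContDiff ℝ ∞ fun w : ℂ => bump (δ⁻¹ • w) := bump.contDiff.comp (contDiff_const_smul δ⁻¹)
  exact (Complex.ofRealCLM.contDiff.comp h1).mul Complex.conjCLE.contDiff

theorem conjCutoff_eq {δ : ℝ} (hδ : δ ≠ 0) :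
    conjCutoff δ = fun w => δ • conjCutoff 1 (δ⁻¹ • w) := by
  ext w
  simp only [conjCutoff, inv_one, one_smul, Complex.real_smul, map_mul, Complex.conj_ofReal]
  have : (δ : ℂ) * (δ⁻¹ : ℝ) = 1 := by
    rw [← Complex.ofReal_mul, mul_inv_cancel₀ hδ, Complex.ofReal_one]
  linear_combination (-(bump ((δ⁻¹ : ℝ) * w) : ℂ) * (starRingEnd ℂ) w) * this

/-- The cut-off at scale `δ` is `δ` times the one at scale `1`, precomposed with dilation by `δ⁻¹`.
So its derivative is the rescaled derivative at scale `1`, with no power of `δ`, and compact support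
bounds both. This is where the factor `f̄` compensates the steepness of the cut-off. -/
theorem exists_conjCutoff_bound : ∃ M : ℝ, 0 ≤ M ∧ ∀ δ ∈ Ioc (0 : ℝ) 1, ∀ w,
    ‖conjCutoff δ w‖ ≤ M ∧ ‖fderiv ℝ (conjCutoff δ) w‖ ≤ M := by
  have hs : HasCompactSupport (conjCutoff 1) := by
    refine bump.hasCompactSupport.mono fun w hw => ?_
    intro h0
    apply hw
    rw [conjCutoff, inv_one, one_smul, h0, Complex.ofReal_zero, zero_mul]
  obtain ⟨M₁, hM₁⟩ := hs.exists_bound_of_continuous (contDiff_conjCutoff 1).continuous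
  obtain ⟨M₂, hM₂⟩ := (hs.fderiv ℝ).exists_bound_of_continuous
    ((contDiff_conjCutoff 1).continuous_fderiv (by simp))
  refine ⟨max M₁ M₂, (norm_nonneg _).trans ((hM₁ 0).trans (le_max_left _ _)), fun δ hδ w => ?_⟩
  rw [conjCutoff_eq hδ.1.ne']
  refine ⟨?_, ?_⟩
  · rw [norm_smul, Real.norm_of_nonneg hδ.1.le]
    exact (mul_le_of_le_one_left (norm_nonneg _) hδ.2).trans ((hM₁ _).trans (le_max_left _ _))
  · have h1 : HasFDerivAt (fun w : ℂ => δ • conjCutoff 1 (δ⁻¹ • w))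
        (δ • (fderiv ℝ (conjCutoff 1) (δ⁻¹ • w)).comp (δ⁻¹ • ContinuousLinearMap.id ℝ ℂ)) w := by
      have h2 := (((contDiff_conjCutoff 1).differentiable (by simp)) (δ⁻¹ • w)).hasFDerivAt
      exact (h2.comp w ((hasFDerivAt_id w).const_smul δ⁻¹)).const_smul δ
    rw [h1.fderiv, ContinuousLinearMap.comp_smul, smul_smul, mul_inv_cancel₀ hδ.1.ne', one_smul,
      ContinuousLinearMap.comp_id]
    exact (hM₂ _).trans (le_max_right _ _)

variable {n : ℕ} {X : Type*} [TopologicalSpace X] [ChartedSpace (Cn n) X]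
  [IsManifold 𝓘(ℂ, Cn n) ω X]
  {E : X → Type*} [TopologicalSpace (TotalSpace ℂ E)]
  [∀ x, AddCommGroup (E x)] [∀ x, Module ℂ (E x)] [∀ x, TopologicalSpace (E x)]
  [FiberBundle ℂ E] [VectorBundle ℂ ℂ E]

/-- The function `ψ`, cut off to the tube `|f| ≤ 2 δ` in the trivialization around `c`. -/
def tubeCutoff (f : ∀ x, E x) (c : X) (ψ : X → ℝ) (δ : ℝ) (x : X) : ℝ :=
  ψ x * bump (δ⁻¹ • sectionCoord f c x)

theorem tubeCutoff_nonneg {f : ∀ x, E x} {c : X} {ψ : X → ℝ} {δ : ℝ} {x : X} (hψ : 0 ≤ ψ x) :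
    0 ≤ tubeCutoff f c ψ δ x := mul_nonneg hψ bump.nonneg

theorem tubeCutoff_le {f : ∀ x, E x} {c : X} {ψ : X → ℝ} {δ : ℝ} {x : X} (hψ : 0 ≤ ψ x) :
    tubeCutoff f c ψ δ x ≤ ψ x := mul_le_of_le_one_right hψ bump.le_one

theorem support_tubeCutoff_subset (f : ∀ x, E x) (c : X) (ψ : X → ℝ) (δ : ℝ) :
    Function.support (tubeCutoff f c ψ δ) ⊆ Function.support ψ :=
  Function.support_mul_subset_left _ _

theorem tubeCutoff_eq_zero {f : ∀ x, E x} {c : X} {ψ : X → ℝ} {δ : ℝ} (hδ : 0 < δ) {x : X}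
    (hx : x ∉ tsupport ψ ∩ {x | ‖sectionCoord f c x‖ ≤ 2 * δ}) : tubeCutoff f c ψ δ x = 0 := by
  by_cases h : x ∈ tsupport ψ
  · have h2 : 2 * δ < ‖sectionCoord f c x‖ := not_le.1 fun h2 => hx ⟨h, h2⟩
    have h3 : bump (δ⁻¹ • sectionCoord f c x) = 0 := by
      apply bump.zero_of_le_dist
      rw [dist_zero_right, norm_smul, norm_inv, Real.norm_of_nonneg hδ.le, inv_mul_eq_div,
        le_div_iff₀ hδ]
      exact h2.le
    rw [tubeCutoff, h3, mul_zero]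
  · rw [tubeCutoff, image_eq_zero_of_notMem_tsupport h, zero_mul]

theorem tubeCutoff_eq_self {f : ∀ x, E x} {c : X} {ψ : X → ℝ} {δ : ℝ} (hδ : 0 < δ) {x : X}
    (hx : ‖sectionCoord f c x‖ ≤ δ) : tubeCutoff f c ψ δ x = ψ x := by
  have h3 : bump (δ⁻¹ • sectionCoord f c x) = 1 := by
    apply bump.one_of_mem_closedBall
    rw [mem_closedBall_zero_iff, norm_smul, norm_inv, Real.norm_of_nonneg hδ.le, inv_mul_eq_div]
    exact div_le_one_of_le₀ hx hδ.le
  rw [tubeCutoff, h3, mul_one]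

variable [ContMDiffVectorBundle ω ℂ E 𝓘(ℂ, Cn n)]

theorem contMDiff_tubeCutoff {f : ∀ x, E x}
    (hf : ContMDiff 𝓘(ℂ, Cn n) (𝓘(ℂ, Cn n).prod 𝓘(ℂ, ℂ)) ω (fun x => TotalSpace.mk' ℂ x (f x)))
    {c : X} {ψ : X → ℝ} (hψ : ContMDiff 𝓘(ℝ, Cn n) 𝓘(ℝ, ℝ) ∞ ψ)
    (hψs : tsupport ψ ⊆ frameDomain n E c) (δ : ℝ) :
    ContMDiff 𝓘(ℝ, Cn n) 𝓘(ℝ, ℝ) ∞ (tubeCutoff f c ψ δ) := fun x => by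
  by_cases hx : x ∈ tsupport ψ
  · have h1 : ContDiff ℝ ∞ fun w : ℂ => bump (δ⁻¹ • w) :=
      bump.contDiff.comp (contDiff_const_smul δ⁻¹)
    exact (hψ x).mul (h1.contDiffAt.comp_contMDiffAt (contMDiffAt_sectionCoord hf (hψs hx)))
  · refine (contMDiffAt_const (c := (0 : ℝ))).congr_of_eventuallyEq ?_
    filter_upwards [(isClosed_tsupport ψ).isOpen_compl.mem_nhds hx] with x' hx'
    rw [tubeCutoff, image_eq_zero_of_notMem_tsupport hx', zero_mul]

/-- On the support of `ψ` the coordinate of `f` is continuous and vanishes at `z`, so it is smaller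
than `δ` nearby; off the support both sides are `0`. -/
theorem eventually_tubeCutoff_eq {f : ∀ x, E x} {Z : Set X} (hf : IsDefiningSection n f Z) {c : X}
    {ψ : X → ℝ} (hψs : tsupport ψ ⊆ frameDomain n E c) {δ : ℝ} (hδ : 0 < δ) {z : X} (hz : z ∈ Z) :
    ∀ᶠ x in 𝓝 z, tubeCutoff f c ψ δ x = ψ x := by
  by_cases hx : z ∈ tsupport ψ
  · have hfz : f z = 0 := by have := hf.zero_set ▸ hz; exact this
    have h1 := (contMDiffAt_sectionCoord hf.holomorphic (hψs hx)).continuousAt.norm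
    have h2 : ‖sectionCoord f c z‖ < δ := by
      rwa [(sectionCoord_eq_zero_iff f (hψs hx).2).2 hfz, norm_zero]
    filter_upwards [h1.eventually (gt_mem_nhds h2)] with x hx
    exact tubeCutoff_eq_self hδ hx.le
  · filter_upwards [(isClosed_tsupport ψ).isOpen_compl.mem_nhds hx] with x' hx'
    rw [tubeCutoff, image_eq_zero_of_notMem_tsupport hx', zero_mul]

variable {p : ℕ} {L : X → Type*} [TopologicalSpace (TotalSpace ℂ L)]
  [∀ x, AddCommGroup (L x)] [∀ x, Module ℂ (L x)] [∀ x, TopologicalSpace (L x)]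
  [∀ x, IsTopologicalAddGroup (L x)] [∀ x, ContinuousSMul ℂ (L x)]
  [FiberBundle ℂ L] [VectorBundle ℂ ℂ L] [ContMDiffVectorBundle ω ℂ L 𝓘(ℂ, Cn n)]

theorem contMDiff_ofReal_comp {ρ : X → ℝ} (hρ : ContMDiff 𝓘(ℝ, Cn n) 𝓘(ℝ, ℝ) ∞ ρ) :
    ContMDiff 𝓘(ℝ, Cn n) 𝓘(ℝ, ℂ) ∞ (fun x => (ρ x : ℂ)) :=
  Complex.ofRealCLM.contDiff.contMDiff.comp hρ

theorem dbar_tubeCutoff_eq_zero {f : ∀ x, E x} {c : X} {ψ : X → ℝ} {δ : ℝ} (hδ : 0 < δ)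
    (hcl : IsClosed (tsupport ψ ∩ {x | ‖sectionCoord f c x‖ ≤ 2 * δ}))
    (β : ∀ x, FormAt n L p x) {x : X}
    (hx : x ∉ tsupport ψ ∩ {x | ‖sectionCoord f c x‖ ≤ 2 * δ}) :
    dbar (fun x => (tubeCutoff f c ψ δ x : ℂ) • β x) x = 0 := by
  -- The zero form is written as an empty sum, so that additivity of `∂̄` gives its vanishing.
  have h1 : ∀ᶠ x' in 𝓝 x, (tubeCutoff f c ψ δ x' : ℂ) • β x' = ∑ i ∈ (∅ : Finset ℕ), β x' := by
    filter_upwards [hcl.isOpen_compl.mem_nhds hx] with x' hx'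
    rw [tubeCutoff_eq_zero hδ hx', Finset.sum_empty]
    ext v
    simp
  rw [dbar_congr h1, dbar_sum (u := fun _ : ℕ => β) (by simp), Finset.sum_empty]

theorem exists_dbarSymbol_bound (n q : ℕ) : ∃ N : ℝ, 0 < N ∧
    ∀ T : Cn n →L[ℝ] Cn n [⋀^Fin q]→L[ℝ] ℂ, ‖dbarSymbol n q T‖ ≤ N * ‖T‖ := by
  have h := ContinuousLinearMap.isBoundedLinearMap (𝕜 := ℝ) (E := Cn n →L[ℝ] Cn n [⋀^Fin q]→L[ℝ] ℂ)
    (F := Cn n [⋀^Fin (q + 1)]→L[ℝ] ℂ) (dbarSymbol n q)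
  exact h.bound

/-- In the frame around `c` the form is `conjCutoff δ (s) • B`, where `s` and `B` do not depend on
`δ`. The Leibniz rule then bounds its `∂̄` by the uniform bounds on `conjCutoff δ` and its
derivative, times continuous functions on a compact set. -/
theorem exists_dbar_tubeCutoff_bound
    (g : HermitianMetric n (Cn n) (TangentSpace 𝓘(ℂ, Cn n) : X → Type _))
    (h : HermitianMetric n ℂ L) {f : ∀ x, E x}
    (hf : ContMDiff 𝓘(ℂ, Cn n) (𝓘(ℂ, Cn n).prod 𝓘(ℂ, ℂ)) ω (fun x => TotalSpace.mk' ℂ x (f x)))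
    {α : ∀ x, E x → FormAt n L p x} (hα : IsSmoothTwistedForm α) {c : X} {ψ : X → ℝ}
    (hψ : ContMDiff 𝓘(ℝ, Cn n) 𝓘(ℝ, ℝ) ∞ ψ) (hψc : IsCompact (tsupport ψ))
    (hψE : tsupport ψ ⊆ frameDomain n E c) (hψL : tsupport ψ ⊆ frameDomain n L c) :
    ∃ C : ℝ, ∀ δ ∈ Ioc (0 : ℝ) 1, ∀ x ∈ tsupport ψ,
      normSq g h (dbar (fun x => (tubeCutoff f c ψ δ x : ℂ) • α x (f x)) x) ≤ ENNReal.ofReal C := by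
  obtain ⟨C, hC, hCb⟩ := exists_normSq_bound g h (p + 1) hψc hψL
  obtain ⟨N, hN, hNb⟩ := exists_dbarSymbol_bound n p
  obtain ⟨M, hM, hMb⟩ := exists_conjCutoff_bound
  -- The function `ψ` is absorbed into the form, so that `δ` enters only through the scalar factor.
  set β : ∀ x, FormAt n L p x := fun x => (ψ x : ℂ) • α x ((trivializationAt ℂ E c).symm x 1) with hβ
  set B := localRep β c with hB
  set s := sectionRep n f c with hs
  have hBs : ∀ x ∈ tsupport ψ, ContDiffAt ℝ ∞ B (chartAt (Cn n) c x) := fun x hx =>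
    (smoothFormAt_iff (hψL hx)).1 ((hα.smoothFormAt (hψE hx).2).smul (contMDiff_ofReal_comp hψ x))
  have hss : ∀ x ∈ tsupport ψ, ContDiffAt ℝ ∞ s (chartAt (Cn n) c x) := fun x hx =>
    ((contDiffAt_sectionRep hf (hψE hx)).restrict_scalars ℝ).of_le le_top
  have hcont : ContinuousOn (fun y => M * ‖flatDbar B y‖ +
      N * (M * ‖fderiv ℝ s y‖ * ‖B y‖)) (chartAt (Cn n) c '' tsupport ψ) := by
    rintro _ ⟨x, hx, rfl⟩
    refine ContinuousAt.continuousWithinAt ?_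
    have h1 := (ContDiffAt.flatDbar (hBs x hx)).continuousAt.norm
    have h2 := (((hss x hx).fderiv_right (m := ∞) (by norm_cast))).continuousAt.norm
    exact (h1.const_mul M).add (((h2.const_mul M).mul (hBs x hx).continuousAt.norm).const_mul _)
  obtain ⟨D, hD⟩ := (isCompact_chart_image hψc fun x hx => (hψL hx).1).exists_bound_of_continuousOn
    hcont
  refine ⟨C * D ^ 2, fun δ hδ x hx => (hCb x hx _).trans (ENNReal.ofReal_le_ofReal
    (mul_le_mul_of_nonneg_left (pow_le_pow_left₀ (norm_nonneg _) ?_ 2) hC))⟩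
  have hd := hD _ (mem_image_of_mem _ hx)
  rw [Real.norm_of_nonneg (by positivity)] at hd
  refine le_trans ?_ hd
  set y := chartAt (Cn n) c x with hy
  rw [localRep_dbar (hψL hx) ((hα.smoothFormAt_section hf x).smul
    (contMDiff_ofReal_comp (contMDiff_tubeCutoff hf hψ hψE δ) x)) ((hα.type0q x _).smul _)]
  have hev : localRep (fun x => (tubeCutoff f c ψ δ x : ℂ) • α x (f x)) c =ᶠ[𝓝 y]
      fun y => conjCutoff δ (s y) • B y := by
    filter_upwards [eventually_mem_chart (hψE hx).1 ((isOpen_frameDomain c).mem_nhds (hψE hx))]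
      with y' hy'
    rw [localRep_eq, hB, localRep_eq, hα.apply_section f hy'.2.2, hβ]
    simp only [formRep_smul, smul_smul]
    congr 1
    rw [tubeCutoff, conjCutoff, hs, sectionRep]
    push_cast
    ring
  have hθ := (contDiff_conjCutoff δ).differentiable (by simp) (s y)
  have hsd := (hss x hx).differentiableAt (by simp)
  have hcomp : HasFDerivAt (fun y => conjCutoff δ (s y))
      ((fderiv ℝ (conjCutoff δ) (s y)).comp (fderiv ℝ s y)) y :=
    hθ.hasFDerivAt.comp y hsd.hasFDerivAt
  rw [flatDbar_congr hev, flatDbar_smul hcomp.differentiableAt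
    ((hBs x hx).differentiableAt (by simp)), hcomp.fderiv]
  refine (norm_add_le _ _).trans (add_le_add ?_ ?_)
  · rw [norm_smul]
    exact mul_le_mul_of_nonneg_right (hMb δ hδ _).1 (norm_nonneg _)
  · refine (hNb _).trans (mul_le_mul_of_nonneg_left ?_ hN.le)
    refine ContinuousLinearMap.opNorm_le_bound _ (by positivity) fun v => ?_
    rw [ContinuousLinearMap.smulRight_apply, norm_smul, mul_right_comm]
    refine mul_le_mul_of_nonneg_right ?_ (norm_nonneg _)
    refine ((fderiv ℝ (conjCutoff δ) (s y)).le_opNorm _).trans ?_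
    rw [mul_assoc]
    exact mul_le_mul (hMb δ hδ _).2 ((fderiv ℝ s y).le_opNorm v) (norm_nonneg _) hM

end Cutoff

/-! ### Choice of the width of one tube -/

section Assembly

variable {n p : ℕ} {X : Type*} [TopologicalSpace X] [T2Space X]
  [ChartedSpace (Cn n) X] [IsManifold 𝓘(ℂ, Cn n) ω X] [MeasurableSpace X] [BorelSpace X]
  {L : X → Type*} [TopologicalSpace (TotalSpace ℂ L)]
  [∀ x, AddCommGroup (L x)] [∀ x, Module ℂ (L x)] [∀ x, TopologicalSpace (L x)]
  [∀ x, IsTopologicalAddGroup (L x)] [∀ x, ContinuousSMul ℂ (L x)]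
  [FiberBundle ℂ L] [VectorBundle ℂ ℂ L] [ContMDiffVectorBundle ω ℂ L 𝓘(ℂ, Cn n)]
  {E : X → Type*} [TopologicalSpace (TotalSpace ℂ E)]
  [∀ x, AddCommGroup (E x)] [∀ x, Module ℂ (E x)] [∀ x, TopologicalSpace (E x)]
  [FiberBundle ℂ E] [VectorBundle ℂ ℂ E] [ContMDiffVectorBundle ω ℂ E 𝓘(ℂ, Cn n)]

/-- The weighted norm is at most a constant `b`, independent of `δ`, on the tube, and `0` off it, so
a tube of volume below `η / (b + 1)` suffices. The majorant `F` is the constant `b` on the tube;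
being measurable, it allows exchanging sum and integral later. -/
theorem exists_tube_radius
    (g : HermitianMetric n (Cn n) (TangentSpace 𝓘(ℂ, Cn n) : X → Type _))
    (h : HermitianMetric n ℂ L) {f : ∀ x, E x} {Z : Set X} (hf : IsDefiningSection n f Z)
    {α : ∀ x, E x → FormAt n L p x} (hα : IsSmoothTwistedForm α) {c : X} {ψ : X → ℝ}
    (hψ : ContMDiff 𝓘(ℝ, Cn n) 𝓘(ℝ, ℝ) ∞ ψ) (hψc : IsCompact (tsupport ψ))
    (hψE : tsupport ψ ⊆ frameDomain n E c) (hψL : tsupport ψ ⊆ frameDomain n L c)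
    (a : ℝ) {η : ℝ≥0∞} (hη : 0 < η) :
    ∃ δ, 0 < δ ∧ ∃ F : X → ℝ≥0∞, Measurable F ∧
      (∀ x, ENNReal.ofReal a *
        normSq g h (dbar (fun x => (tubeCutoff f c ψ δ x : ℂ) • α x (f x)) x) ≤ F x) ∧
      ∫⁻ x, F x ∂(volumeMeasure g) ≤ η := by
  obtain ⟨C, hC⟩ := exists_dbar_tubeCutoff_bound g h hf.holomorphic hα hψ hψc hψE hψL
  set b := ENNReal.ofReal a * ENNReal.ofReal C with hb
  have hbt : b + 1 ≠ ⊤ := by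
    simp [hb, ENNReal.mul_eq_top]
  obtain ⟨δ, hδ, hcl, hvol⟩ := exists_volume_tube_lt g hf hψc hψE (ENNReal.div_pos hη.ne' hbt)
  refine ⟨δ, hδ.1, (tsupport ψ ∩ {x | ‖sectionCoord f c x‖ ≤ 2 * δ}).indicator fun _ => b,
    measurable_const.indicator hcl.measurableSet, fun x => ?_, ?_⟩
  · by_cases hx : x ∈ tsupport ψ ∩ {x | ‖sectionCoord f c x‖ ≤ 2 * δ}
    · rw [indicator_of_mem hx]
      exact mul_le_mul_right (hC δ hδ x hx.1) _
    · rw [dbar_tubeCutoff_eq_zero hδ.1 hcl _ hx, normSq_zero, mul_zero]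
      exact zero_le
  · rw [lintegral_indicator_const hcl.measurableSet]
    calc _ ≤ (b + 1) * (η / (b + 1)) := mul_le_mul' le_self_add hvol.le
      _ ≤ η := ENNReal.mul_div_le

/-- The local finiteness of a family of functions, in the form of finite sums. -/
theorem exists_finset_eventually {X ι : Type*} [TopologicalSpace X] {ψ : ι → X → ℝ}
    (hlf : LocallyFinite fun i => tsupport (ψ i)) (x : X) :
    ∃ F : Finset ι, ∀ᶠ x' in 𝓝 x, ∀ i ∉ F, ψ i x' = 0 := by
  obtain ⟨N, hN, hfin⟩ := hlf x
  refine ⟨hfin.toFinset, Filter.mem_of_superset hN fun x' hx' i hi => ?_⟩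
  by_contra h0
  exact hi (hfin.mem_toFinset.2 ⟨x', subset_tsupport _ h0, hx'⟩)

end Assembly

end TransverseExtension

end

/-! ### The extension theorem -/

open TransverseExtension in
/-- Transverse ambient `L`-valued `(0,q)`-forms on `Z`, in degree `q = p + 1 ≥ 1`, have
`∂̄`-closed extensions of arbitrarily small norm. The ambient form `ξ` is only used on `Z`. -/
theorem proposition6p2 {n : ℕ}
    {X : Type*} [TopologicalSpace X] [T2Space X] [SecondCountableTopology X]
    [ChartedSpace (Cn n) X] [IsManifold 𝓘(ℂ, Cn n) ω X] [MeasurableSpace X] [BorelSpace X]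
    {L : X → Type*} [TopologicalSpace (TotalSpace ℂ L)]
    [∀ x, AddCommGroup (L x)] [∀ x, Module ℂ (L x)] [∀ x, TopologicalSpace (L x)]
    [∀ x, IsTopologicalAddGroup (L x)] [∀ x, ContinuousSMul ℂ (L x)]
    [FiberBundle ℂ L] [VectorBundle ℂ ℂ L] [ContMDiffVectorBundle ω ℂ L 𝓘(ℂ, Cn n)]
    {E : X → Type*} [TopologicalSpace (TotalSpace ℂ E)]
    [∀ x, AddCommGroup (E x)] [∀ x, Module ℂ (E x)] [∀ x, TopologicalSpace (E x)]
    [FiberBundle ℂ E] [VectorBundle ℂ ℂ E] [ContMDiffVectorBundle ω ℂ E 𝓘(ℂ, Cn n)]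
    (g : HermitianMetric n (Cn n) (TangentSpace 𝓘(ℂ, Cn n) : X → Type _)) (hg : IsKahler g)
    (h : HermitianMetric n ℂ L)
    (Z : Set X) (f : ∀ x, E x) (hf : IsDefiningSection n f Z)
    (p : ℕ) (ξ : ∀ x, FormAt n L (p + 1) x)
    (hξ_type : ∀ z ∈ Z, IsType0q (ξ z)) (hξ_smooth : SmoothFormOn ξ Z)
    (hξ_transverse : IsTransverse f Z ξ)
    (ε : ℝ) (hε : 0 < ε) :
    ∃ u : ∀ x, FormAt n L (p + 1) x,
      (∀ x, IsType0q (u x)) ∧ SmoothFormOn u univ ∧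
      (∀ x, dbar u x = 0) ∧
      (∀ z ∈ Z, u z = ξ z) ∧
      (n ! : ℝ≥0∞) * ∫⁻ x, normSq g h (u x) ∂(volumeMeasure g) < ENNReal.ofReal ε ∧
      ∃ (ρ : X → ℝ) (α : ∀ x, E x → FormAt n L p x),
        ContMDiff 𝓘(ℝ, Cn n) 𝓘(ℝ, ℝ) ∞ ρ ∧ (∀ x, ρ x ∈ Icc (0 : ℝ) 1) ∧
        (∀ᶠ x in 𝓝ˢ Z, ρ x = 1) ∧
        IsSmoothTwistedForm α ∧
        ∀ x, u x = dbar (fun x => ρ x • α x (f x)) x := by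
  obtain ⟨α, hα, hαξ⟩ := exists_twisted_form hf hξ_type hξ_smooth hξ_transverse
  -- A second partition of unity, separate from the one that built `α`, is used to cut off near `Z`.
  obtain ⟨ι, hι, c, ψ, hψ, hψ0, hψ1, hψlf, hψc, hψU⟩ := exists_smooth_partition (n := n)
    (U := fun x => frameDomain n L x ∩ frameDomain n E x) fun x => Filter.inter_mem
      ((isOpen_frameDomain x).mem_nhds (mem_frameDomain_self x))
      ((isOpen_frameDomain x).mem_nhds (mem_frameDomain_self x))
  have hψL : ∀ i, tsupport (ψ i) ⊆ frameDomain n L (c i) := fun i => (hψU i).trans inter_subset_left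
  have hψE : ∀ i, tsupport (ψ i) ⊆ frameDomain n E (c i) := fun i => (hψU i).trans inter_subset_right
  have hε' : ENNReal.ofReal ε / (n ! : ℝ≥0∞) ≠ 0 :=
    (ENNReal.div_pos (ENNReal.ofReal_pos.2 hε).ne' (ENNReal.natCast_ne_top _)).ne'
  -- The share of the `i`-th piece in the integral; the total stays below `ε / n!`.
  obtain ⟨e, he0, hesum⟩ := ENNReal.exists_pos_sum_of_countable' hε' ι
  have : Encodable ι := Encodable.ofCountable ι
  -- Weights of total mass at most `1` for Cauchy–Schwarz. Their inverses are unbounded in general,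
  -- which is harmless since each radius `δ i` is chosen after its weight.
  obtain ⟨w, hw0, s, hws, hs1⟩ := posSumOfEncodable one_pos ι
  choose δ hδ F hFm hF hFint using fun i => exists_tube_radius g h hf hα (hψ i) (hψc i) (hψE i)
    (hψL i) (w i)⁻¹ (he0 i)
  set κ : ι → X → ℝ := fun i => tubeCutoff f (c i) (ψ i) (δ i) with hκ
  have hκψ : ∀ i x, ψ i x = 0 → κ i x = 0 := fun i x h0 => by
    by_contra h1
    exact support_tubeCutoff_subset f (c i) (ψ i) (δ i) h1 h0
  have hκs : ∀ i, ContMDiff 𝓘(ℝ, Cn n) 𝓘(ℝ, ℝ) ∞ (κ i) := fun i =>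
    contMDiff_tubeCutoff hf.holomorphic (hψ i) (hψE i) (δ i)
  set ρ : X → ℝ := fun x => ∑ᶠ i, κ i x with hρ
  have hρs : ContMDiff 𝓘(ℝ, Cn n) 𝓘(ℝ, ℝ) ∞ ρ := contMDiff_finsum hκs
    (hψlf.subset fun i => (support_tubeCutoff_subset f (c i) (ψ i) (δ i)).trans (subset_tsupport _))
  have hsumψ : ∀ (I : Finset ι) x, (∀ i ∉ I, ψ i x = 0) → ∑ i ∈ I, ψ i x = 1 := fun I x hI => by
    rw [← hψ1 x]
    refine (finsum_eq_sum_of_support_subset _ fun i hi => ?_).symm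
    by_contra h1
    exact hi (hI i h1)
  have hsumκ : ∀ (I : Finset ι) x, (∀ i ∉ I, ψ i x = 0) → ρ x = ∑ i ∈ I, κ i x := fun I x hI =>
    finsum_eq_sum_of_support_subset _ fun i hi => by
      by_contra h1
      exact hi (hκψ i x (hI i h1))
  -- Near a point of `Z` only finitely many pieces matter and each cut-off is `1` wherever its `ψᵢ`
  -- is nonzero, so `ρ = ∑ ψᵢ = 1`.
  have hρ1 : ∀ z ∈ Z, ∀ᶠ x in 𝓝 z, ρ x = 1 := fun z hz => by
    obtain ⟨I, hI⟩ := exists_finset_eventually hψlf z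
    have h1 : ∀ᶠ x in 𝓝 z, ∀ i ∈ I, κ i x = ψ i x := (Filter.eventually_all_finset I).2 fun i _ =>
      eventually_tubeCutoff_eq hf (hψE i) (hδ i) hz
    filter_upwards [hI, h1] with x hx1 hx2
    rw [hsumκ I x hx1, Finset.sum_congr rfl hx2, hsumψ I x hx1]
  have hαs := hα.smoothFormAt_section hf.holomorphic
  set v : ∀ x, FormAt n L p x := fun x => ρ x • α x (f x) with hv
  have hvs : ∀ x, SmoothFormAt v x := fun x => (hαs x).smul (contMDiff_ofReal_comp hρs x)
  have hvt : ∀ x, IsType0q (v x) := fun x => (hα.type0q x (f x)).smul (ρ x : ℂ)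
  refine ⟨dbar v, isType0q_dbar hvt, smoothFormOn_of_smoothFormAt fun x _ =>
    smoothFormAt_dbar hvs hvt x, dbar_dbar hvs hvt, fun z hz => ?_, ?_, ρ, α, hρs, fun x => ?_,
    Filter.eventually_iff.2 (mem_nhdsSet_iff_forall.2 hρ1), hα, fun _ => rfl⟩
  · rw [← hαξ z hz]
    refine dbar_congr ?_
    filter_upwards [hρ1 z hz] with x hx
    rw [hv]
    simp only [hx, one_smul]
  -- At each point `u` is a finite sum of the pieces `∂̄(κᵢ f̄ α)`, to which weighted Cauchy–Schwarz
  -- applies. The resulting series of majorants no longer depends on the finite set of indices.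
  · have hpt : ∀ x, normSq g h (dbar v x) ≤ ∑' i, F i x := fun x => by
      obtain ⟨I, hI⟩ := exists_finset_eventually hψlf x
      have h1 : dbar v x = ∑ i ∈ I, dbar (fun x => (κ i x : ℂ) • α x (f x)) x := by
        rw [← dbar_sum fun i _ => (hαs x).smul (contMDiff_ofReal_comp (hκs i) x)]
        refine dbar_congr ?_
        filter_upwards [hI] with x' hx'
        rw [← Finset.sum_smul, ← Complex.ofReal_sum, ← hsumκ I x' hx']
        rfl
      rw [h1]
      refine (normSq_sum_le g h _ (fun i _ => hw0 i)
        ((sum_le_hasSum I (fun i _ => (hw0 i).le) hws).trans hs1)).trans ?_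
      exact (Finset.sum_le_sum fun i _ => hF i x).trans (ENNReal.sum_le_tsum I)
    rw [mul_comm]
    refine ENNReal.mul_lt_of_lt_div (lt_of_le_of_lt ?_ hesum)
    calc ∫⁻ x, normSq g h (dbar v x) ∂(volumeMeasure g)
        ≤ ∫⁻ x, ∑' i, F i x ∂(volumeMeasure g) := lintegral_mono hpt
      _ = ∑' i, ∫⁻ x, F i x ∂(volumeMeasure g) := lintegral_tsum fun i => (hFm i).aemeasurable
      _ ≤ ∑' i, e i := ENNReal.tsum_le_tsum hFint
  · obtain ⟨I, hI⟩ := exists_finset_eventually hψlf x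
    rw [hsumκ I x hI.self_of_nhds]
    refine ⟨Finset.sum_nonneg fun i _ => tubeCutoff_nonneg (hψ0 i x), ?_⟩
    rw [← hsumψ I x hI.self_of_nhds]
    exact Finset.sum_le_sum fun i _ => tubeCutoff_le (hψ0 i x)
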